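/- **Setting.** Let $N\ge 1$ and $K\ge 1$ be integers and $M\ge 0$ a real number. A server holds $N$ independent files $W_0,\dots,W_{N-1}$, each uniformly distributed on $\{0,\dots,2^F-1\}$ ($F\ge 1$ bits), and serves $K$ users over a noiseless broadcast link; user $k$ demands the file with index $D_k\in\{0,\dots,N-1\}$. Write $W=(W_0,\dots,W_{N-1})$ and $D=(D_0,\dots,D_{K-1})$. A word of $x$ bits is an element of $\{0,\dots,2^x-1\}$ (of an alphabet of size $\lfloor 2^x\rfloor$ if $2^x$ is not an integer). *Non-private schemes.* An $(N,K,M,R)$-non-private scheme consists of cache contents $C_k(W)$ of $MF$ bits for each user $k$, a transmission $E(W,D)$ of $RF$ bits, and decoding functions $G_k$ with $G_k(D,E(W,D),C_k(W))=W_{D_k}$ for all $k$, $D$, $W$. The optimal non-private rate $R^*_{N,K}(M)$ is the infimum of all $R$ for which such a scheme exists for some $F\ge 1$. *Private schemes.* Here there are in addition random variables $S=(S_0,\dots,S_{K-1})$, where $S_k$ is shared by the server and user $k$, and private randomness $P$ of the server; $S$, $P$, $W$, $D$ are independent and $D$ is uniform on $\{0,\dots,N-1\}^K$. The cache content is $Z_k=(C_k(S_k,P,W),S_k)$,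 with $C_k$ of $MF$ bits, and the broadcast message is $X=(E(W,D,P,S),J(D,P,S))$, with $E$ of $RF$ bits. User $k$ must recover $W_{D_k}$ from $(D_k,Z_k,X)$, and the demands of the other users must satisfy $I\big((D_j)_{j\ne k};Z_k,X,D_k\big)=0$, for every $k$. The pair $(M,R)$ is achievable with demand privacy if there are such schemes in which the sizes in bits of the $S_k$ and of the auxiliary transmission $J$ are negligible, that is, for every $\varepsilon>0$ there is such a scheme for some $F\ge1$ in which each of them is at most $\varepsilon F$. The optimal private rate $R^{*p}_{N,K}(M)$ is the infimum of all $R$ such that $(M,R)$ is achievable with demand privacy. *Envelopes.* Let $R^A_{N,K}$ be the lower convex envelope of the memory-rate pairs of Scheme A, $$\left(\frac{Nr}{NK-K+1},\ \frac{\binom{NK-K+1}{r+1}-\binom{NK-K-N+1}{r+1}}{\binom{NK-K+1}{r}}\right),\qquad r\in\{0,\dots,NK-K+1\}.$$ Let $R^{BC}_{N,K}$ be the lower convex envelope of the memory-rate pairs of Scheme B, $\left(m,\ \min\{N,K\}\left(1-\frac mN\right)\right)$ with $0\le m\le N$, together with those of Scheme C, $$\left(\frac{N\sum_{s=t}^{NK-1}\binom{NK-1}{s-1}r^{NK-s-1}}{\sum_{s=t}^{NK-1}\binom{NK}{s}r^{NK-s-1}},\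 \frac{\sum_{s=t+1}^{NK}\left[\binom{NK}{s}-\binom{NK-K}{s}\right]r^{NK-s}}{\sum_{s=t}^{NK-1}\binom{NK}{s}r^{NK-s-1}}\right),\qquad t\in\{1,\dots,NK-1\},\ r\in[1,N-1]\ \text{real}.$$ Both envelopes live on $0\le M\le N$ and are extended by their value $0$ at $M=N$ to $M>N$. **Theorem.** The following hold, where a bound $a/b\le c$ is understood as $a\le c\,b$ (this matters only for $M\ge N$, where all the rates are $0$). 0. $R^*_{N,K}(M)\le R^{*p}_{N,K}(M)\le R^A_{N,K}(M)$; if $K<N$, also $R^{*p}_{N,K}(M)\le R^{BC}_{N,K}(M)$. 1. If $N\le K$, then $$\frac{R^{A}_{N,K}(M)}{R^{*}_{N,K}(M)}\le\begin{cases}4&\text{if } M\le 1-\frac NK,\\ 8&\text{if } 1-\frac NK\le M\le\frac N2,\\ 2&\text{if } M\ge\frac N2,\end{cases}$$ and the same bounds hold for $R^{A}_{N,K}(M)/R^{*p}_{N,K}(M)$ and $R^{*p}_{N,K}(M)/R^{*}_{N,K}(M)$. 2. If $K<N$, then $$\frac{R^{BC}_{N,K}(M)}{R^{*}_{N,K}(M)}\le\begin{cases}3&\text{if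 } M<\frac N2,\\ 2&\text{if } M\ge\frac N2,\end{cases}$$ and the same bounds hold for $R^{BC}_{N,K}(M)/R^{*p}_{N,K}(M)$ and $R^{*p}_{N,K}(M)/R^{*}_{N,K}(M)$. 3. For all $N$ and $K$, if $M\ge\frac{N(NK-K)}{NK-K+1}$, then $R^{*p}_{N,K}(M)=R^{*}_{N,K}(M)$. -/

import Mathlib

noncomputable section

namespace CodedCaching

/-- The contents of a file of `F` bits: an element of `{0, …, 2^F - 1}`. -/
abbrev FileWord (F : ℕ) : Type := Fin (2 ^ F)

/-- The alphabet `{0, …, 2^x - 1}` of words of `x` bits for a real number `x` (as `x = M F` or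
`x = R F`).  If `2^x` is not an integer, this is the largest alphabet with at most `2^x`
elements. -/
abbrev Bits (x : ℝ) : Type := Fin ⌊(2 : ℝ) ^ x⌋₊

/-- The contents `(W_0, …, W_{N-1})` of the `N` files of `F` bits. -/
abbrev Files (N F : ℕ) : Type := Fin N → FileWord F

/-- The demand vectors `(D_0, …, D_{K-1})` of the `K` users. -/
abbrev Demands (N K : ℕ) : Type := Fin K → Fin N

/-! ### Non-private coded caching -/

/-- The cache encoding, broadcast encoding and decoding functions of a non-private scheme with
files of `F` bits, caches of `M F` bits and a transmission of `R F` bits.  The demand vector is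
known to every decoder. -/
structure NonPrivateCode (N K F : ℕ) (M R : ℝ) where
  cacheEnc : Fin K → Files N F → Bits (M * F)
  enc : Files N F → Demands N K → Bits (R * F)
  dec : Fin K → Demands N K → Bits (R * F) → Bits (M * F) → FileWord F

/-- Every user recovers the demanded file, for all demands and all file contents. -/
def NonPrivateCode.Decodes {N K F : ℕ} {M R : ℝ} (c : NonPrivateCode N K F M R) : Prop :=
  ∀ (k : Fin K) (D : Demands N K) (W : Files N F),
    c.dec k D (c.enc W D) (c.cacheEnc k W) = W (D k)

/-- `(M, R)` is achievable for the `(N, K)` coded caching problem. -/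
def Achievable (N K : ℕ) (M R : ℝ) : Prop :=
  ∃ F : ℕ, 0 < F ∧ ∃ c : NonPrivateCode N K F M R, c.Decodes

/-- The optimal non-private rate `R*_{N,K}(M)`. -/
def optRate (N K : ℕ) (M : ℝ) : ℝ := sInf {R : ℝ | Achievable N K M R}

/-! ### Mutual information on a finite probability space -/

/-- The probability of the event `A` under the probability mass function `p`. -/
def prob {Ω : Type*} [Fintype Ω] (p : Ω → ℝ) (A : Set Ω) : ℝ := ∑ ω, A.indicator p ω

/-- The mutual information `I(X; Y)` in bits of two random variables with finite alphabets, with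
the usual convention `0 log (0 / q) = 0`. -/
def mutualInfo {Ω α β : Type*} [Fintype Ω] [Fintype α] [Fintype β] (p : Ω → ℝ)
    (X : Ω → α) (Y : Ω → β) : ℝ :=
  ∑ x, ∑ y, prob p {ω | X ω = x ∧ Y ω = y} *
    Real.logb 2 (prob p {ω | X ω = x ∧ Y ω = y} / (prob p {ω | X ω = x} * prob p {ω | Y ω = y}))

/-! ### Demand-private coded caching -/

/-- A private code: the random variables `S = (S_0, …, S_{K-1})` (where `S_k` is shared by the
server and user `k`) and `P` (private randomness of the server) with their laws, the alphabet `J`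
of the auxiliary transmission, and the encoding and decoding functions.  The components of `S` may
be dependent. -/
structure PrivateCode (N K F : ℕ) (M R : ℝ) where
  S : Fin K → Type
  P : Type
  J : Type
  [fintypeS : ∀ k, Fintype (S k)]
  [fintypeP : Fintype P]
  [fintypeJ : Fintype J]
  lawS : PMF (∀ k, S k)
  lawP : PMF P
  cacheEnc : ∀ k, S k → P → Files N F → Bits (M * F)
  enc : Files N F → Demands N K → P → (∀ k, S k) → Bits (R * F)
  aux : Demands N K → P → (∀ k, S k) → J
  dec : ∀ k, Fin N → S k → J → Bits (R * F) → Bits (M * F) → FileWord F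

attribute [instance] PrivateCode.fintypeS PrivateCode.fintypeP PrivateCode.fintypeJ

namespace PrivateCode

variable {N K F : ℕ} {M R : ℝ} (c : PrivateCode N K F M R)

/-- Joint outcomes of shared randomness, private randomness, files and demands. -/
abbrev Outcome : Type := (∀ k, c.S k) × c.P × Files N F × Demands N K

/-- The joint law: `S`, `P`, the files and the demands are independent, and the files and the
demands are uniformly distributed. -/
def law (ω : c.Outcome) : ℝ :=
  (c.lawS ω.1).toReal * (c.lawP ω.2.1).toReal *
    (Fintype.card (Files N F) : ℝ)⁻¹ * (Fintype.card (Demands N K) : ℝ)⁻¹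

/-- The demand of user `k`. -/
def demand (k : Fin K) (ω : c.Outcome) : Fin N := ω.2.2.2 k

/-- The demands of all users other than `k`. -/
def otherDemands (k : Fin K) (ω : c.Outcome) : {j : Fin K // j ≠ k} → Fin N :=
  fun j => ω.2.2.2 j

/-- The cache content `Z_k = (C_k(S_k, P, W), S_k)` of user `k`. -/
def cache (k : Fin K) (ω : c.Outcome) : Bits (M * F) × c.S k :=
  (c.cacheEnc k (ω.1 k) ω.2.1 ω.2.2.1, ω.1 k)

/-- The broadcast message `X = (E(W, D, P, S), J(D, P, S))`. -/
def message (ω : c.Outcome) : Bits (R * F) × c.J :=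
  (c.enc ω.2.2.1 ω.2.2.2 ω.2.1 ω.1, c.aux ω.2.2.2 ω.2.1 ω.1)

/-- Every user recovers the demanded file, in every outcome of positive probability. -/
def Decodes : Prop :=
  ∀ (k : Fin K) (ω : c.Outcome), 0 < c.law ω →
    c.dec k (c.demand k ω) (c.cache k ω).2 (c.message ω).2 (c.message ω).1 (c.cache k ω).1
      = ω.2.2.1 (c.demand k ω)

/-- Demand privacy: for each user `k`, the demands of the other users have zero mutual information
with all that user `k` knows, namely `Z_k`, `X` and `D_k`. -/
def IsDemandPrivate : Prop :=
  ∀ k : Fin K,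
    mutualInfo c.law (c.otherDemands k) (fun ω => (c.cache k ω, c.message ω, c.demand k ω)) = 0

end PrivateCode

/-- `(M, R)` is achievable with demand privacy for the `(N, K)` coded caching problem.  The shared
randomness and the auxiliary transmission count neither as memory nor as rate, and are therefore
required to be negligible: their sizes in bits can be made an arbitrarily small fraction of the
file size. -/
def PrivatelyAchievable (N K : ℕ) (M R : ℝ) : Prop :=
  ∀ ε : ℝ, 0 < ε → ∃ F : ℕ, 0 < F ∧ ∃ c : PrivateCode N K F M R,
    c.Decodes ∧ c.IsDemandPrivate ∧
    Real.logb 2 (Fintype.card c.J) ≤ ε * F ∧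
    ∀ k, Real.logb 2 (Fintype.card (c.S k)) ≤ ε * F

/-- The optimal rate with demand privacy, `R*p_{N,K}(M)`. -/
def optPrivateRate (N K : ℕ) (M : ℝ) : ℝ := sInf {R : ℝ | PrivatelyAchievable N K M R}

/-! ### The memory-rate pairs of Schemes A, B and C and their envelopes -/

/-- The memory-rate pairs of Scheme A; here `U = NK - K + 1`. -/
def pointsA (N K : ℕ) : Set (ℝ × ℝ) :=
  {x | ∃ U : ℕ, U = N * K - K + 1 ∧ ∃ r : ℕ, r ≤ U ∧
    x = ((N : ℝ) * r / U,
      ((U.choose (r + 1) : ℝ) - ((U - N).choose (r + 1) : ℝ)) / (U.choose r : ℝ))}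

/-- The memory-rate pairs of Scheme B. -/
def pointsB (N K : ℕ) : Set (ℝ × ℝ) :=
  {x | ∃ m : ℝ, 0 ≤ m ∧ m ≤ N ∧ x = (m, min (N : ℝ) K * (1 - m / N))}

/-- The memory-rate pairs of Scheme C, with an integer parameter `t` and a real parameter `r`. -/
def pointsC (N K : ℕ) : Set (ℝ × ℝ) :=
  {x | ∃ (t : ℕ) (r : ℝ), 1 ≤ t ∧ t ≤ N * K - 1 ∧ 1 ≤ r ∧ r ≤ (N : ℝ) - 1 ∧
    x = ((N : ℝ) * (∑ s ∈ Finset.Icc t (N * K - 1),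
            ((N * K - 1).choose (s - 1) : ℝ) * r ^ (N * K - s - 1)) /
          (∑ s ∈ Finset.Icc t (N * K - 1), ((N * K).choose s : ℝ) * r ^ (N * K - s - 1)),
        (∑ s ∈ Finset.Icc (t + 1) (N * K),
            (((N * K).choose s : ℝ) - ((N * K - K).choose s : ℝ)) * r ^ (N * K - s)) /
          (∑ s ∈ Finset.Icc t (N * K - 1), ((N * K).choose s : ℝ) * r ^ (N * K - s - 1)))}

/-- The lower convex envelope of a set of memory-rate pairs: the lower boundary of its convex
hull. -/
def lowerConvexEnvelope (A : Set (ℝ × ℝ)) (m : ℝ) : ℝ := sInf {R : ℝ | (m, R) ∈ convexHull ℝ A}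

/-- `R^A_{N,K}(M)`.  The points have memories in `[0, N]`, with `(N, 0)` among them; memory beyond
`N` is left unused. -/
def rateA (N K : ℕ) (M : ℝ) : ℝ := lowerConvexEnvelope (pointsA N K) (min M N)

/-- `R^{BC}_{N,K}(M)`; memory beyond `N` is left unused. -/
def rateBC (N K : ℕ) (M : ℝ) : ℝ := lowerConvexEnvelope (pointsB N K ∪ pointsC N K) (min M N)

end CodedCaching

end

/-! The lower bounds come from entropy, the upper bounds from linear schemes built on exterior
powers, and the constants from comparing the two.

Converse. Under uniform files every function of the files is a partition, here a `Setoid`, with a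
Shannon entropy. Demands are chosen greedily: given the caches of users 0, …, i and the files
already chosen, some remaining file keeps, by averaging, at least F - (i+1)MF/(N-i) bits of
uncertainty (`exists_large_gain`, `exists_greedy_demands`). One transmission must supply all these
bits, so submodularity gives R ≥ ∑_{i<s} (1 - (i+1)M/(N-i)) (`Achievable.rate_lower_bound`). Taking
s = 1, s = K or s ≈ (N+1)/(M+1) yields 1 - M/N, K/2 and (N-M)/(2(M+1)). A private scheme becomes a
non-private one when its randomness is fixed, so these bounds apply to it too.

Achievability. Each user k is replaced by N virtual users (k, x) with functionals u_{k,x} on a space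
M over the field with two elements. Files are elements of the t-th exterior power, the cache of (k,
x) holds the contractions of all files with u_{k,x}, and the transmission is ∑ a_n ∧ W_n. If
u_{k,x}(a_n) is 1 for the demanded n and 0 otherwise, contracting the transmission gives the
demanded file minus terms known from the cache (`exists_linearScheme`). The real user k holds the
cache of (k, j_k) for a random j_k, and only the shifts D - j are published. Since the decoding maps
of user k have a range depending only on j_k, a random invertible matrix together with one-time pads
hides the other j_i (`LinearScheme.toUniformScheme`). These keys do not grow with the number of
copies of the scheme, hence are negligible. Arrays with equal row sums give the points of Scheme A
(`pointsA_subset_uniformRegion`). Unrestricted arrays, with the part of the transmission useless to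
all chosen virtual users removed, give the levels of which Schemes B and C are convex combinations
(`level_mem_uniformRegion`).

Comparison. Binomial mixtures of the levels turn the envelopes into (N-M)/M for A and (N-M)/M · (1 -
(1-M/N)^K) for BC (`rateA_le_ratio`, `ratio_mem_hull'`). Together with chords to the end points,
elementary inequalities finish the proof. For N ≤ K the factor 4 in fact holds for every M. On the
last segment of A the envelope equals the bound 1 - M/N, which gives the exact rate. -/

noncomputable section

namespace CodedCaching

/-! ### Entropy of partitions of a finite uniform probability space -/

section Entropy

open Classical in
/-- The size of the class of `ω`. -/
def classCard {Ω : Type*} [Fintype Ω] (r : Setoid Ω) (ω : Ω) : ℕ :=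
  (Finset.univ.filter fun ω' => r ω ω').card

/-- The Shannon entropy (in nats) of the partition `r` under the uniform distribution. -/
def entropy {Ω : Type*} [Fintype Ω] (r : Setoid Ω) : ℝ :=
  (∑ ω, Real.log (Fintype.card Ω / classCard r ω)) / Fintype.card Ω

variable {Ω : Type*} [Fintype Ω]

lemma classCard_pos (r : Setoid Ω) (ω : Ω) : 0 < classCard r ω := by
  classical
  exact Finset.card_pos.2 ⟨ω, by simp⟩

lemma classCard_congr {r : Setoid Ω} {ω ω' : Ω} (h : r ω ω') :
    classCard r ω = classCard r ω' := by
  classical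
  unfold classCard
  congr 1
  ext x
  simp only [Finset.mem_filter, Finset.mem_univ, true_and]
  exact ⟨fun hx => r.trans (r.symm h) hx, fun hx => r.trans h hx⟩

lemma classCard_mono {r s : Setoid Ω} (h : r ≤ s) (ω : Ω) : classCard r ω ≤ classCard s ω := by
  classical
  refine Finset.card_le_card fun x hx => ?_
  simp only [Finset.mem_filter, Finset.mem_univ, true_and] at hx ⊢
  exact h hx

lemma classCard_top (ω : Ω) : classCard (⊤ : Setoid Ω) ω = Fintype.card Ω := by
  classical
  unfold classCard
  rw [Finset.filter_true_of_mem]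
  · rfl
  · intros; trivial

lemma classCard_bot (ω : Ω) : classCard (⊥ : Setoid Ω) ω = 1 := by
  classical
  unfold classCard
  rw [Finset.card_eq_one]
  exact ⟨ω, by ext x; simp [eq_comm]⟩

lemma entropy_antitone {r s : Setoid Ω} (h : r ≤ s) : entropy s ≤ entropy r := by
  unfold entropy
  refine div_le_div_of_nonneg_right (Finset.sum_le_sum fun ω _ => ?_) (by positivity)
  have h1 : (0 : ℝ) < classCard r ω := by exact_mod_cast classCard_pos r ω
  have h2 : (0 : ℝ) < classCard s ω := by exact_mod_cast classCard_pos s ω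
  have h3 : (classCard r ω : ℝ) ≤ classCard s ω := by exact_mod_cast classCard_mono h ω
  have h4 : (0 : ℝ) < Fintype.card Ω := by exact_mod_cast Fintype.card_pos_iff.2 ⟨ω⟩
  exact Real.log_le_log (by positivity) (by gcongr)

lemma entropy_top : entropy (⊤ : Setoid Ω) = 0 := by
  unfold entropy
  rw [Finset.sum_eq_zero, zero_div]
  intro ω _
  have h4 : (0 : ℝ) < Fintype.card Ω := by exact_mod_cast Fintype.card_pos_iff.2 ⟨ω⟩
  rw [classCard_top, div_self h4.ne', Real.log_one]

lemma entropy_bot [Nonempty Ω] : entropy (⊥ : Setoid Ω) = Real.log (Fintype.card Ω) := by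
  unfold entropy
  have h4 : (0 : ℝ) < Fintype.card Ω := by exact_mod_cast Fintype.card_pos
  simp only [classCard_bot, Nat.cast_one, div_one, Finset.sum_const, Finset.card_univ, nsmul_eq_mul]
  field_simp

/-- Every nonempty fibre of `f` contributes exactly 1 and every empty one 0. -/
lemma sum_inv_classCard_le {α : Type*} [Fintype α] (f : Ω → α) :
    ∑ ω, (1 : ℝ) / classCard (Setoid.ker f) ω ≤ Fintype.card α := by
  classical
  rw [← Finset.sum_fiberwise (s := Finset.univ) (g := f)]
  calc _ ≤ ∑ _a : α, (1 : ℝ) := Finset.sum_le_sum fun a _ => ?_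
    _ = _ := by simp
  by_cases h : (Finset.univ.filter fun ω => f ω = a).Nonempty
  · have hc : ∀ ω ∈ Finset.univ.filter (fun ω => f ω = a),
        (1 : ℝ) / classCard (Setoid.ker f) ω = 1 / (Finset.univ.filter fun ω => f ω = a).card := by
      intro ω hω
      simp only [Finset.mem_filter, Finset.mem_univ, true_and] at hω
      unfold classCard
      congr 3
      ext x
      simp only [Finset.mem_filter, Finset.mem_univ, true_and, Setoid.ker_def]
      rw [hω, eq_comm]
    rw [Finset.sum_congr rfl hc, Finset.sum_const, nsmul_eq_mul]
    have : (0 : ℝ) < (Finset.univ.filter fun ω => f ω = a).card := by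
      exact_mod_cast Finset.card_pos.2 h
    rw [mul_one_div_cancel this.ne']
  · rw [Finset.not_nonempty_iff_eq_empty.1 h]
    simp

lemma entropy_ker_le [Nonempty Ω] {α : Type*} [Fintype α] (f : Ω → α) :
    entropy (Setoid.ker f) ≤ Real.log (Fintype.card α) := by
  have h4 : (0 : ℝ) < Fintype.card Ω := by exact_mod_cast Fintype.card_pos
  have hα : (0 : ℝ) < Fintype.card α := by
    exact_mod_cast Fintype.card_pos_iff.2 ⟨f (Classical.arbitrary Ω)⟩
  have key : ∀ ω, Real.log (Fintype.card Ω / classCard (Setoid.ker f) ω) ≤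
      Real.log (Fintype.card α) +
        (Fintype.card Ω / Fintype.card α * (1 / classCard (Setoid.ker f) ω) - 1) := by
    intro ω
    have h1 : (0 : ℝ) < classCard (Setoid.ker f) ω := by exact_mod_cast classCard_pos _ ω
    have := Real.log_le_sub_one_of_pos
      (x := Fintype.card Ω / Fintype.card α * (1 / (classCard (Setoid.ker f) ω : ℝ)))
      (by positivity)
    have e : (Fintype.card Ω : ℝ) / classCard (Setoid.ker f) ω =
        Fintype.card α * (Fintype.card Ω / Fintype.card α *
          (1 / (classCard (Setoid.ker f) ω : ℝ))) := by field_simp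
    rw [e, Real.log_mul hα.ne' (by positivity)]
    linarith
  unfold entropy
  rw [div_le_iff₀ h4]
  refine (Finset.sum_le_sum fun ω _ => key ω).trans ?_
  rw [Finset.sum_add_distrib, Finset.sum_sub_distrib, ← Finset.mul_sum]
  simp only [Finset.sum_const, Finset.card_univ, nsmul_eq_mul, mul_one]
  have := mul_le_mul_of_nonneg_left (sum_inv_classCard_le f)
    (by positivity : (0 : ℝ) ≤ Fintype.card Ω / Fintype.card α)
  rw [div_mul_cancel₀ _ hα.ne'] at this
  linarith

/-- Double counting: expand the numerator as a count of pairs (x, y) with x related to ω under a ⊓ c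
and y under b ⊓ c. For fixed (x, y) the admissible ω are either absent or form one class of a ⊓ b ⊓
c, so the pair contributes at most the inverse size of the c-class of x, and only when c relates x
and y. Summing over y gives 1 for each x. -/
lemma sum_classCard_ratio_le (a b c : Setoid Ω) :
    ∑ ω, ((classCard (a ⊓ c) ω : ℝ) * classCard (b ⊓ c) ω) /
      (classCard (a ⊓ b ⊓ c) ω * classCard c ω) ≤ Fintype.card Ω := by
  classical
  have hcard : ∀ (r : Setoid Ω) ω, (classCard r ω : ℝ) = ∑ x, if r ω x then (1 : ℝ) else 0 := by
    intro r ω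
    unfold classCard
    rw [Finset.sum_ite, Finset.sum_const_zero, add_zero, Finset.sum_const, nsmul_eq_mul, mul_one]
  have hswap : ∑ ω, ((classCard (a ⊓ c) ω : ℝ) * classCard (b ⊓ c) ω) /
      (classCard (a ⊓ b ⊓ c) ω * classCard c ω) =
      ∑ x, ∑ y, ∑ ω, (if (a ⊓ c) ω x then (1 : ℝ) else 0) * (if (b ⊓ c) ω y then (1 : ℝ) else 0) /
        (classCard (a ⊓ b ⊓ c) ω * classCard c ω) := by
    have : ∀ ω, ((classCard (a ⊓ c) ω : ℝ) * classCard (b ⊓ c) ω) /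
      (classCard (a ⊓ b ⊓ c) ω * classCard c ω) =
      ∑ x, ∑ y, (if (a ⊓ c) ω x then (1 : ℝ) else 0) * (if (b ⊓ c) ω y then (1 : ℝ) else 0) /
        (classCard (a ⊓ b ⊓ c) ω * classCard c ω) := by
      intro ω
      rw [hcard (a ⊓ c), hcard (b ⊓ c), Finset.sum_mul_sum, Finset.sum_div]
      exact Finset.sum_congr rfl fun x _ => Finset.sum_div _ _ _
    rw [Finset.sum_congr rfl fun ω _ => this ω, Finset.sum_comm]
    exact Finset.sum_congr rfl fun x _ => Finset.sum_comm
  have hinner : ∀ x y, ∑ ω, (if (a ⊓ c) ω x then (1 : ℝ) else 0) *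
      (if (b ⊓ c) ω y then (1 : ℝ) else 0) / (classCard (a ⊓ b ⊓ c) ω * classCard c ω) ≤
      (if c x y then (1 : ℝ) else 0) / classCard c x := by
    intro x y
    by_cases hz : ∃ z, (a ⊓ c) z x ∧ (b ⊓ c) z y
    · obtain ⟨z, ⟨hzax, hzcx⟩, hzby, hzcy⟩ := hz
      have hxy : c x y := c.trans (c.symm hzcx) hzcy
      have hN : (0 : ℝ) < classCard (a ⊓ b ⊓ c) z := by exact_mod_cast classCard_pos _ z
      rw [if_pos hxy]
      calc _ = ∑ ω, (if (a ⊓ b ⊓ c) z ω then (1 : ℝ) else 0) *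
            (1 / (classCard (a ⊓ b ⊓ c) z * classCard c x)) := by
            refine Finset.sum_congr rfl fun ω _ => ?_
            by_cases hω : (a ⊓ b ⊓ c) z ω
            · have h1 : (a ⊓ c) ω x :=
                ⟨a.trans (a.symm hω.1.1) hzax, c.trans (c.symm hω.2) hzcx⟩
              have h2 : (b ⊓ c) ω y :=
                ⟨b.trans (b.symm hω.1.2) hzby, c.trans (c.symm hω.2) hzcy⟩
              rw [if_pos h1, if_pos h2, if_pos hω, ← classCard_congr hω, classCard_congr h1.2]
              ring
            · rw [if_neg hω]
              by_cases h1 : (a ⊓ c) ω x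
              · by_cases h2 : (b ⊓ c) ω y
                · exact absurd ⟨⟨a.trans hzax (a.symm h1.1), b.trans hzby (b.symm h2.1)⟩,
                    c.trans hzcx (c.symm h1.2)⟩ hω
                · rw [if_neg h2]; simp
              · rw [if_neg h1]; simp
        _ = 1 / classCard c x := by
            rw [← Finset.sum_mul, ← hcard]
            have : (0 : ℝ) < classCard c x := by exact_mod_cast classCard_pos _ x
            field_simp
        _ ≤ _ := le_rfl
    · rw [Finset.sum_eq_zero]
      · split_ifs <;> positivity
      · intro ω _
        by_cases h1 : (a ⊓ c) ω x
        · by_cases h2 : (b ⊓ c) ω y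
          · exact absurd ⟨ω, h1, h2⟩ hz
          · rw [if_neg h2]; simp
        · rw [if_neg h1]; simp
  rw [hswap]
  calc _ ≤ ∑ x, ∑ y, (if c x y then (1 : ℝ) else 0) / classCard c x :=
        Finset.sum_le_sum fun x _ => Finset.sum_le_sum fun y _ => hinner x y
    _ = ∑ _x : Ω, (1 : ℝ) := by
        refine Finset.sum_congr rfl fun x _ => ?_
        have : (0 : ℝ) < classCard c x := by exact_mod_cast classCard_pos _ x
        rw [← Finset.sum_div, ← hcard, div_self this.ne']
    _ = _ := by simp

/-- Submodularity of entropy. -/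
lemma entropy_submodular (a b c : Setoid Ω) :
    entropy (a ⊓ b ⊓ c) + entropy c ≤ entropy (a ⊓ c) + entropy (b ⊓ c) := by
  unfold entropy
  rw [← add_div, ← add_div]
  refine div_le_div_of_nonneg_right ?_ (by positivity)
  rw [← Finset.sum_add_distrib, ← Finset.sum_add_distrib, ← sub_nonpos, ← Finset.sum_sub_distrib]
  -- The entropy difference is the sum of the logarithms of the ratios just averaged; log x ≤ x - 1
  -- linearises it.
  have hle : ∀ ω : Ω, Real.log (Fintype.card Ω / classCard (a ⊓ b ⊓ c) ω) +
      Real.log (Fintype.card Ω / classCard c ω) - (Real.log (Fintype.card Ω / classCard (a ⊓ c) ω) +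
      Real.log (Fintype.card Ω / classCard (b ⊓ c) ω)) ≤
      ((classCard (a ⊓ c) ω : ℝ) * classCard (b ⊓ c) ω) /
      (classCard (a ⊓ b ⊓ c) ω * classCard c ω) - 1 := by
    intro ω
    have h1 : (0 : ℝ) < classCard (a ⊓ c) ω := by exact_mod_cast classCard_pos _ ω
    have h2 : (0 : ℝ) < classCard (b ⊓ c) ω := by exact_mod_cast classCard_pos _ ω
    have h3 : (0 : ℝ) < classCard (a ⊓ b ⊓ c) ω := by exact_mod_cast classCard_pos _ ω
    have h5 : (0 : ℝ) < classCard c ω := by exact_mod_cast classCard_pos _ ω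
    have h4 : (0 : ℝ) < Fintype.card Ω := by exact_mod_cast Fintype.card_pos_iff.2 ⟨ω⟩
    have := Real.log_le_sub_one_of_pos (x := ((classCard (a ⊓ c) ω : ℝ) * classCard (b ⊓ c) ω) /
      (classCard (a ⊓ b ⊓ c) ω * classCard c ω)) (by positivity)
    refine le_trans (le_of_eq ?_) this
    rw [Real.log_div h4.ne' h3.ne', Real.log_div h4.ne' h5.ne', Real.log_div h4.ne' h1.ne',
      Real.log_div h4.ne' h2.ne', Real.log_div (by positivity) (by positivity),
      Real.log_mul h1.ne' h2.ne', Real.log_mul h3.ne' h5.ne']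
    ring
  refine (Finset.sum_le_sum fun ω _ => hle ω).trans ?_
  rw [Finset.sum_sub_distrib]
  have := sum_classCard_ratio_le a b c
  simp only [Finset.sum_const, Finset.card_univ, nsmul_eq_mul, mul_one]
  linarith

lemma entropy_inf_le (a b : Setoid Ω) : entropy (a ⊓ b) ≤ entropy a + entropy b := by
  have := entropy_submodular a b ⊤
  simpa [entropy_top] using this

lemma entropy_finset_inf_le {ι : Type*} (A : Finset ι) (w : ι → Setoid Ω) :
    entropy (A.inf w) ≤ ∑ n ∈ A, entropy (w n) := by
  classical
  induction A using Finset.induction_on with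
  | empty => simp [entropy_top]
  | insert n A hn ih =>
    rw [Finset.inf_insert, Finset.sum_insert hn]
    exact (entropy_inf_le _ _).trans (by linarith)

lemma entropy_inf_finset_inf_sub_le {ι : Type*} (A : Finset ι) (w : ι → Setoid Ω)
    (r : Setoid Ω) :
    entropy (A.inf w ⊓ r) - entropy r ≤ ∑ n ∈ A, (entropy (w n ⊓ r) - entropy r) := by
  classical
  induction A using Finset.induction_on with
  | empty => simp
  | insert n A hn ih =>
    rw [Finset.inf_insert, Finset.sum_insert hn]
    have := entropy_submodular (w n) (A.inf w) r
    linarith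

/-- If the partitions `w n` jointly have full entropy `N f`, some `w n` outside `A` is at least as
uncertain, given `r` and the `w n` in `A`, as the average. -/
lemma exists_large_gain {N : ℕ} (w : Fin N → Setoid Ω) (f : ℝ) (hw : ∀ n, entropy (w n) ≤ f)
    (hbot : entropy (Finset.univ.inf w) = N * f) (r : Setoid Ω) (A : Finset (Fin N))
    (hA : A.card < N) :
    ∃ n ∉ A, f - entropy r / (N - A.card) ≤
      entropy (w n ⊓ (r ⊓ A.inf w)) - entropy (r ⊓ A.inf w) := by
  classical
  -- If all files outside A fell short, the sum of their gains would be below (N - |A|) f - H(r).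
  -- But this sum is at least H(all files) - H(r, A), hence at least N f - H(r) - |A| f.
  by_contra! hcon
  have hpos : (0 : ℝ) < N - A.card := by
    have : (A.card : ℝ) < N := by exact_mod_cast hA
    linarith
  have hc : ((Aᶜ).card : ℝ) = N - A.card := by
    rw [Finset.card_compl, Fintype.card_fin, Nat.cast_sub hA.le]
  have hne : (Aᶜ).Nonempty := by
    rw [← Finset.card_pos]
    have : (0 : ℝ) < (Aᶜ).card := hc ▸ hpos
    exact_mod_cast this
  have h1 := entropy_inf_finset_inf_sub_le Aᶜ w (r ⊓ A.inf w)
  have h2 : ∑ n ∈ Aᶜ, (entropy (w n ⊓ (r ⊓ A.inf w)) - entropy (r ⊓ A.inf w)) <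
      ∑ _n ∈ Aᶜ, (f - entropy r / (N - A.card)) :=
    Finset.sum_lt_sum_of_nonempty hne fun n hn => hcon n (Finset.mem_compl.1 hn)
  rw [Finset.sum_const, nsmul_eq_mul, hc, mul_sub, mul_div_cancel₀ _ hpos.ne'] at h2
  have h3 : entropy (Finset.univ.inf w) ≤ entropy (Aᶜ.inf w ⊓ (r ⊓ A.inf w)) := by
    refine entropy_antitone ?_
    refine Finset.le_inf fun n _ => ?_
    by_cases hn : n ∈ A
    · exact inf_le_right.trans (inf_le_right.trans (Finset.inf_le hn))
    · exact inf_le_left.trans (Finset.inf_le (Finset.mem_compl.2 hn))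
  have h4 : entropy (A.inf w) ≤ A.card * f :=
    (entropy_finset_inf_le A w).trans
      ((Finset.sum_le_sum fun n _ => hw n).trans (by simp))
  have h5 := entropy_inf_le r (A.inf w)
  nlinarith

end Entropy

/-! ### A lower bound on the rate of non-private schemes -/

/-- The index i + 1 of `Z` means that the cache of user i itself is already counted when its demand
is chosen. Distinctness of the first s choices is carried along because it gives the denominator N -
i. -/
lemma exists_greedy_demands {Ω : Type*} [Fintype Ω] {N : ℕ} (hN : 1 ≤ N) (w : Fin N → Setoid Ω)
    (f : ℝ) (hw : ∀ n, entropy (w n) ≤ f) (hbot : entropy (Finset.univ.inf w) = N * f)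
    (Z : ℕ → Setoid Ω) (s : ℕ) (hs : s ≤ N) :
    ∃ n : ℕ → Fin N, ((Finset.range s).image n).card = s ∧ ∀ i < s,
      f - entropy (Z (i + 1)) / (N - i) ≤
        entropy (w (n i) ⊓ (Z (i + 1) ⊓ (Finset.range i).inf fun j => w (n j))) -
          entropy (Z (i + 1) ⊓ (Finset.range i).inf fun j => w (n j)) := by
  classical
  induction s with
  | zero => exact ⟨fun _ => ⟨0, hN⟩, by simp, by simp⟩
  | succ s ih =>
    obtain ⟨n, hcard, hn⟩ := ih (by omega)
    obtain ⟨x, hx, hgain⟩ := exists_large_gain w f hw hbot (Z (s + 1))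
      ((Finset.range s).image n) (by omega)
    have hupd : ∀ i < s, Function.update n s x i = n i := fun i hi =>
      Function.update_of_ne (by omega) _ _
    have hinf : ∀ i ≤ s, (Finset.range i).inf (fun j => w (Function.update n s x j)) =
        (Finset.range i).inf fun j => w (n j) := by
      intro i hi
      refine Finset.inf_congr rfl fun j hj => ?_
      rw [hupd j (by have := Finset.mem_range.1 hj; omega)]
    refine ⟨Function.update n s x, ?_, ?_⟩
    · rw [Finset.range_add_one, Finset.image_insert, Function.update_self,
        Finset.image_congr (g := n) (fun j hj => hupd j (Finset.mem_range.1 hj)),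
        Finset.card_insert_of_notMem hx, hcard]
    · intro i hi
      rw [hinf i (by omega)]
      rcases Nat.lt_succ_iff_lt_or_eq.1 hi with h | h
      · rw [hupd i h]; exact hn i h
      · subst h
        rw [Function.update_self]
        rw [hcard, Finset.inf_image] at hgain
        exact hgain

lemma card_bits_le (x : ℝ) : (Fintype.card (Bits x) : ℝ) ≤ (2 : ℝ) ^ x := by
  rw [Fintype.card_fin]
  exact Nat.floor_le (by positivity)

/-- One transmission serves the greedily chosen demands. Revealing the caches one user at a time
uncovers one file at a time, and the part of that file not determined by what came before must come
from the transmission. -/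
lemma Achievable.rate_lower_bound {N K : ℕ} (hN : 1 ≤ N) {M R : ℝ}
    (h : Achievable N K M R) (s : ℕ) (hsN : s ≤ N) (hsK : s ≤ K) :
    ∑ i ∈ Finset.range s, (1 - (i + 1) * M / (N - i)) ≤ R := by
  classical
  obtain ⟨F, hF, c, hc⟩ := h
  set L := Real.log 2
  have hL : 0 < L := Real.log_pos (by norm_num)
  have hFpos : (0 : ℝ) < F := by exact_mod_cast hF
  have : Nonempty (FileWord F) := ⟨⟨0, by positivity⟩⟩
  have hbits : ∀ (x : ℝ) (g : Files N F → Bits x), entropy (Setoid.ker g) ≤ x * L := by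
    intro x g
    refine (entropy_ker_le g).trans ?_
    rw [← Real.log_rpow (by norm_num)]
    have : 0 < Fintype.card (Bits x) := Fintype.card_pos_iff.2 ⟨g (Classical.arbitrary _)⟩
    exact Real.log_le_log (by exact_mod_cast this) (card_bits_le x)
  let w : Fin N → Setoid (Files N F) := fun n => Setoid.ker fun W => W n
  -- The trivial partition for k ≥ K is only a default: the argument uses k < s ≤ K.
  let z : ℕ → Setoid (Files N F) := fun k =>
    if h : k < K then Setoid.ker (c.cacheEnc ⟨k, h⟩) else ⊤
  let Z : ℕ → Setoid (Files N F) := fun i => (Finset.range i).inf z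
  have hw : ∀ n, entropy (w n) ≤ F * L := by
    intro n
    refine (entropy_ker_le _).trans ?_
    rw [Fintype.card_fin, Nat.cast_pow, Real.log_pow]
    simp [L]
  have hbot : entropy (Finset.univ.inf w) = N * (F * L) := by
    have : Finset.univ.inf w = ⊥ := by
      rw [eq_bot_iff]
      intro x y hxy
      have hall : ∀ n, w n x y := fun n => (Finset.inf_le (Finset.mem_univ n) : _ ≤ w n) hxy
      exact funext hall
    rw [this, entropy_bot, Fintype.card_fun, Fintype.card_fin, Fintype.card_fin]
    push_cast
    rw [Real.log_pow, Real.log_pow]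
  obtain ⟨n, -, hn⟩ := exists_greedy_demands hN w (F * L) hw hbot Z s hsN
  let X : Setoid (Files N F) := Setoid.ker fun W => c.enc W fun k => n k
  have hdec : ∀ i < s, X ⊓ z i ≤ w (n i) := by
    intro i hi x y hxy
    have hiK : i < K := by omega
    obtain ⟨h1, h2⟩ := hxy
    have h2' : c.cacheEnc ⟨i, hiK⟩ x = c.cacheEnc ⟨i, hiK⟩ y := by
      have h : z i x y := h2
      rw [show z i = Setoid.ker (c.cacheEnc ⟨i, hiK⟩) from dif_pos hiK] at h
      exact h
    have h1' : c.enc x (fun k => n k) = c.enc y (fun k => n k) := h1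
    have e1 := hc ⟨i, hiK⟩ (fun k => n k) x
    have e2 := hc ⟨i, hiK⟩ (fun k => n k) y
    rw [h1', h2', e2] at e1
    exact e1.symm
  have hZ : ∀ i, Z (i + 1) = z i ⊓ Z i := by
    intro i
    simp only [Z, Finset.range_add_one, Finset.inf_insert]
  let V : ℕ → Setoid (Files N F) := fun i => (Finset.range i).inf fun j => w (n j)
  have hV : ∀ i, V (i + 1) = w (n i) ⊓ V i := by
    intro i
    simp only [V, Finset.range_add_one, Finset.inf_insert]
  -- Chain rule as an invariant: H(X | Z_i, V_i) plus the gains so far is at most H(X). Conditioning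
  -- on one more cache lowers H(X | ·), and then X determines file n_i, whose gain splits off.
  have hchain : ∀ i ≤ s, entropy (X ⊓ (Z i ⊓ V i)) - entropy (Z i ⊓ V i) +
      ∑ j ∈ Finset.range i, (entropy (w (n j) ⊓ (Z (j + 1) ⊓ V j)) - entropy (Z (j + 1) ⊓ V j)) ≤
      entropy X := by
    intro i
    induction i with
    | zero => intro _; simp [Z, V, entropy_top]
    | succ i ih =>
      intro hi
      have h1 := ih (by omega)
      have h2 := entropy_submodular X (z i) (Z i ⊓ V i)
      have h3 : X ⊓ z i ⊓ (Z i ⊓ V i) = X ⊓ (Z (i + 1) ⊓ V (i + 1)) := by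
        rw [hZ, hV]
        refine le_antisymm ?_ ?_
        · refine le_inf (inf_le_left.trans inf_le_left) (le_inf (le_inf
            (inf_le_left.trans inf_le_right) (inf_le_right.trans inf_le_left))
            (le_inf (inf_le_left.trans (hdec i (by omega))) (inf_le_right.trans inf_le_right)))
        · refine le_inf (le_inf inf_le_left (inf_le_right.trans (inf_le_left.trans inf_le_left)))
            (le_inf (inf_le_right.trans (inf_le_left.trans inf_le_right))
              (inf_le_right.trans (inf_le_right.trans inf_le_right)))
      have h4 : z i ⊓ (Z i ⊓ V i) = Z (i + 1) ⊓ V i := by rw [hZ, inf_assoc]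
      have h5 : w (n i) ⊓ (Z (i + 1) ⊓ V i) = Z (i + 1) ⊓ V (i + 1) := by
        rw [hV, inf_left_comm]
      rw [h3, h4] at h2
      rw [Finset.sum_range_succ, h5]
      linarith
  have hZle : ∀ i ≤ s, entropy (Z i) ≤ i * (M * F * L) := by
    intro i hi
    refine (entropy_finset_inf_le _ _).trans ?_
    calc _ ≤ ∑ _j ∈ Finset.range i, M * F * L := Finset.sum_le_sum fun j hj => ?_
      _ = _ := by simp
    have hj' : j < K := by have := Finset.mem_range.1 hj; omega
    simp only [z, hj', dif_pos]
    exact hbits _ _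
  have hfin := hchain s le_rfl
  have hanti : entropy (Z s ⊓ V s) ≤ entropy (X ⊓ (Z s ⊓ V s)) := entropy_antitone inf_le_right
  have hX : entropy X ≤ R * F * L := hbits _ _
  have hsum : ∑ i ∈ Finset.range s, (1 - (i + 1) * M / (N - i)) * (F * L) ≤
      ∑ j ∈ Finset.range s,
        (entropy (w (n j) ⊓ (Z (j + 1) ⊓ V j)) - entropy (Z (j + 1) ⊓ V j)) := by
    refine Finset.sum_le_sum fun i hi => ?_
    have hi' := Finset.mem_range.1 hi
    refine le_trans ?_ (hn i hi')
    have hpos : (0 : ℝ) < N - i := by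
      have : (i : ℝ) < N := by exact_mod_cast (by omega : i < N)
      linarith
    have h1 := hZle (i + 1) (by omega)
    push_cast at h1
    have h2 : entropy (Z (i + 1)) / (N - i) ≤ (i + 1) * (M * F * L) / (N - i) := by gcongr
    have h3 : (1 - ((i : ℝ) + 1) * M / (N - i)) * (F * L) =
        F * L - (i + 1) * (M * F * L) / (N - i) := by ring
    linarith
  rw [← Finset.sum_mul] at hsum
  have : (∑ i ∈ Finset.range s, (1 - ((i : ℝ) + 1) * M / (N - i))) * (F * L) ≤ R * (F * L) := by
    linarith
  exact le_of_mul_le_mul_right this (by positivity)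

lemma Achievable.nonneg {N K : ℕ} (hN : 1 ≤ N) {M R : ℝ} (h : Achievable N K M R) : 0 ≤ R := by
  simpa using h.rate_lower_bound hN 0 (by omega) (by omega)

/-- Sending all the files needs no cache. -/
lemma achievable_uncached (N K : ℕ) {M : ℝ} (hM : 0 ≤ M) : Achievable N K M N := by
  refine ⟨1, one_pos, ?_⟩
  have h1 : 1 ≤ ⌊(2 : ℝ) ^ (M * (1 : ℕ))⌋₊ := by
    rw [Nat.one_le_floor_iff]
    exact Real.one_le_rpow (by norm_num) (by simpa using hM)
  have h2 : ⌊(2 : ℝ) ^ ((N : ℝ) * (1 : ℕ))⌋₊ = 2 ^ N := by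
    rw [Nat.cast_one, mul_one, Real.rpow_natCast]
    exact_mod_cast Nat.floor_natCast (R := ℝ) (2 ^ N)
  have e : Files N 1 ≃ Bits ((N : ℝ) * (1 : ℕ)) :=
    Fintype.equivOfCardEq (by
      rw [Fintype.card_fun, Fintype.card_fin, Fintype.card_fin, Fintype.card_fin, h2, pow_one])
  exact ⟨⟨fun _ _ => ⟨0, h1⟩, fun W _ => e W, fun k D x _ => e.symm x (D k)⟩,
    fun k D W => by simp⟩

/-- Uncached transmission makes the set of rates nonempty, so the value `sInf ∅ = 0` does not
interfere. -/
lemma le_optRate {N K : ℕ} {M : ℝ} (hM : 0 ≤ M) {b : ℝ}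
    (h : ∀ R, Achievable N K M R → b ≤ R) : b ≤ optRate N K M :=
  le_csInf ⟨N, achievable_uncached N K hM⟩ h

lemma optRate_nonneg {N K : ℕ} (hN : 1 ≤ N) {M : ℝ} (hM : 0 ≤ M) : 0 ≤ optRate N K M :=
  le_optRate hM fun _ h => h.nonneg hN

lemma one_sub_le_optRate {N K : ℕ} (hN : 1 ≤ N) (hK : 1 ≤ K) {M : ℝ} (hM : 0 ≤ M) :
    1 - M / N ≤ optRate N K M := by
  refine le_optRate hM fun R h => ?_
  simpa using h.rate_lower_bound hN 1 hN hK

/-- The i-th term of the converse equals (N+1 - (i+1)(M+1))/(N-i), with nonnegative numerator for i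
< s. Enlarging the denominator to N+1 leaves an arithmetic progression. -/
lemma quadratic_le_optRate {N K : ℕ} (hN : 1 ≤ N) {M : ℝ} (hM : 0 ≤ M) (s : ℕ) (hsN : s ≤ N)
    (hsK : s ≤ K) (hs : s * (M + 1) ≤ N + 1) :
    s - s * (s + 1) * (M + 1) / (2 * (N + 1)) ≤ optRate N K M := by
  refine le_optRate hM fun R h => le_trans ?_ (h.rate_lower_bound hN s hsN hsK)
  have hN1 : (0 : ℝ) < N + 1 := by positivity
  have key : ∀ m ≤ s, (m : ℝ) - m * (m + 1) * (M + 1) / (2 * (N + 1)) ≤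
      ∑ i ∈ Finset.range m, (1 - ((i : ℝ) + 1) * M / (N - i)) := by
    intro m
    induction m with
    | zero => intro _; simp
    | succ m ih =>
      intro hm
      have h1 := ih (by omega)
      rw [Finset.sum_range_succ]
      have hNm : (0 : ℝ) < N - m := by
        have : (m : ℝ) < N := by exact_mod_cast (by omega : m < N)
        linarith
      have hms : ((m : ℝ) + 1) * (M + 1) ≤ N + 1 := by
        refine le_trans ?_ hs
        have : (m : ℝ) + 1 ≤ s := by exact_mod_cast hm
        gcongr
      have h2 : 1 - ((m : ℝ) + 1) * (M + 1) / (N + 1) ≤ 1 - (m + 1) * M / (N - m) := by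
        have e1 : 1 - ((m : ℝ) + 1) * (M + 1) / (N + 1) =
            (N + 1 - (m + 1) * (M + 1)) / (N + 1) := by field_simp
        have e2 : 1 - ((m : ℝ) + 1) * M / (N - m) = (N + 1 - (m + 1) * (M + 1)) / (N - m) := by
          field_simp
          ring
        rw [e1, e2]
        have hm0 : (0 : ℝ) ≤ m := by positivity
        exact div_le_div_of_nonneg_left (by linarith) hNm (by linarith)
      have e : ((m + 1 : ℕ) : ℝ) - ((m + 1 : ℕ) : ℝ) * (((m + 1 : ℕ) : ℝ) + 1) * (M + 1) /
          (2 * (N + 1)) = (m - m * (m + 1) * (M + 1) / (2 * (N + 1))) +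
            (1 - ((m : ℝ) + 1) * (M + 1) / (N + 1)) := by
        push_cast
        field_simp
        ring
      rw [e]
      linarith
  exact key s le_rfl

lemma half_le_optRate {N K : ℕ} (hN : 1 ≤ N) (hKN : K ≤ N) {M : ℝ} (hM : 0 ≤ M)
    (h : (K + 1) * (M + 1) ≤ (N : ℝ) + 1) : (K : ℝ) / 2 ≤ optRate N K M := by
  have hN1 : (0 : ℝ) < N + 1 := by positivity
  have hK0 : (0 : ℝ) ≤ K := by positivity
  refine le_trans ?_ (quadratic_le_optRate hN hM K hKN le_rfl (by nlinarith))
  have : (K : ℝ) * (K + 1) * (M + 1) / (2 * (N + 1)) ≤ K / 2 := by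
    rw [div_le_div_iff₀ (by positivity) (by norm_num)]
    nlinarith
  linarith

/-- With y = (N+1)/(M+1) the quadratic bound is s - s(s+1)/(2y), and the target is (y-1)/2. The
difference is (y-s)(s+1-y)/(2y), nonnegative for s ≤ y ≤ s+1. The alternative in the hypothesis
ensures that such an s is at most K. -/
lemma ratio_le_optRate {N K : ℕ} (hN : 1 ≤ N) {M : ℝ} (hM : 0 ≤ M)
    (h : N ≤ K ∨ (N : ℝ) + 1 < (K + 1) * (M + 1)) :
    (N - M) / (2 * (M + 1)) ≤ optRate N K M := by
  have hM1 : 0 < M + 1 := by linarith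
  have hN1 : (0 : ℝ) < N + 1 := by positivity
  set y : ℝ := ((N : ℝ) + 1) / (M + 1)
  have hy0 : 0 < y := by positivity
  have hyM : y * (M + 1) = N + 1 := div_mul_cancel₀ _ hM1.ne'
  have hyN : y ≤ N + 1 := by nlinarith
  -- The minimum matters only at M = 0, where y = N + 1 would give s = N + 1.
  set s := min ⌊y⌋₊ N
  have hsy : (s : ℝ) ≤ y := le_trans (by exact_mod_cast min_le_left _ _) (Nat.floor_le hy0.le)
  have hys : y ≤ s + 1 := by
    rcases le_total ⌊y⌋₊ N with h' | h'
    · rw [show s = ⌊y⌋₊ from min_eq_left h']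
      exact (Nat.lt_floor_add_one y).le
    · rw [show s = N from min_eq_right h']
      exact hyN
  have hsK : s ≤ K := by
    rcases h with h | h
    · exact (min_le_right _ _).trans h
    · have : y < K + 1 := by rw [div_lt_iff₀ hM1]; linarith
      have h2 : (s : ℝ) < (K + 1 : ℕ) := by push_cast; linarith
      exact Nat.lt_succ_iff.1 (by exact_mod_cast h2)
  refine le_trans ?_ (quadratic_le_optRate hN hM s (min_le_right _ _) hsK
    (by rw [← hyM]; gcongr))
  have e1 : ((N : ℝ) - M) / (2 * (M + 1)) = (y - 1) / 2 := by
    rw [div_eq_div_iff (by positivity) (by norm_num)]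
    linear_combination (-2) * hyM
  have e2 : (s : ℝ) * (s + 1) * (M + 1) / (2 * (N + 1)) = s * (s + 1) / (2 * y) := by
    rw [← hyM]
    field_simp
  rw [e1, e2, div_le_iff₀ (by norm_num)]
  have hs0 : (0 : ℝ) ≤ s := by positivity
  have e3 : (s - (s : ℝ) * (s + 1) / (2 * y)) * 2 = (2 * s * y - s * (s + 1)) / y := by
    field_simp
  rw [e3, le_div_iff₀ hy0]
  nlinarith [mul_nonneg (sub_nonneg.2 hsy) (sub_nonneg.2 hys)]

/-! ### Private schemes are in particular non-private schemes -/

/-- Fix values of S and P of positive probability. The non-private decoders know the whole demand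
vector, so they can compute the auxiliary transmission themselves and it costs no rate. -/
lemma PrivatelyAchievable.achievable {N K : ℕ} (hN : 1 ≤ N) {M R : ℝ}
    (h : PrivatelyAchievable N K M R) : Achievable N K M R := by
  obtain ⟨F, hF, c, hdec, -⟩ := h 1 one_pos
  obtain ⟨s, hs⟩ := c.lawS.support_nonempty
  obtain ⟨p, hp⟩ := c.lawP.support_nonempty
  have hpos : ∀ {α : Type} (q : PMF α) (a : α), a ∈ q.support → 0 < (q a).toReal :=
    fun q a ha => ENNReal.toReal_pos ((q.mem_support_iff a).1 ha) (q.apply_ne_top a)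
  have : Nonempty (Fin N) := ⟨⟨0, hN⟩⟩
  have : Nonempty (FileWord F) := ⟨⟨0, by positivity⟩⟩
  refine ⟨F, hF, ⟨fun k W => c.cacheEnc k (s k) p W, fun W D => c.enc W D p s,
    fun k D e z => c.dec k (D k) (s k) (c.aux D p s) e z⟩, fun k D W => ?_⟩
  refine hdec k (s, p, W, D) ?_
  have h1 := hpos _ _ hs
  have h2 := hpos _ _ hp
  have h3 : (0 : ℝ) < Fintype.card (Files N F) := by exact_mod_cast Fintype.card_pos
  have h4 : (0 : ℝ) < Fintype.card (Demands N K) := by exact_mod_cast Fintype.card_pos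
  unfold PrivateCode.law
  positivity

/-! ### A sufficient condition for zero mutual information -/

open Classical in
-- Puts probabilities in the form of finite sums with an `if`, to which `Finset.sum_comm` and `simp`
-- apply.
lemma prob_setOf {Ω : Type*} [Fintype Ω] (p : Ω → ℝ) (Q : Ω → Prop) :
    prob p {ω | Q ω} = ∑ ω, if Q ω then p ω else 0 := by
  unfold prob
  exact Finset.sum_congr rfl fun ω _ => by rw [Set.indicator_apply]; rfl

/-- A joint law that does not depend on x is the product of the uniform law of X and the law of Y,
so every logarithm with nonzero weight is log 1. -/
lemma mutualInfo_eq_zero {Ω α β : Type*} [Fintype Ω] [Fintype α] [Fintype β] (p : Ω → ℝ)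
    (X : Ω → α) (Y : Ω → β) (hp : ∑ ω, p ω = 1)
    (h : ∀ x x' y, prob p {ω | X ω = x ∧ Y ω = y} = prob p {ω | X ω = x' ∧ Y ω = y}) :
    mutualInfo p X Y = 0 := by
  classical
  have hY : ∀ y, prob p {ω | Y ω = y} = ∑ x, prob p {ω | X ω = x ∧ Y ω = y} := by
    intro y
    simp only [prob_setOf]
    rw [Finset.sum_comm]
    refine Finset.sum_congr rfl fun ω _ => ?_
    by_cases hω : Y ω = y <;> simp [hω]
  have hX : ∀ x, prob p {ω | X ω = x} = ∑ y, prob p {ω | X ω = x ∧ Y ω = y} := by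
    intro x
    simp only [prob_setOf]
    rw [Finset.sum_comm]
    refine Finset.sum_congr rfl fun ω _ => ?_
    by_cases hω : X ω = x <;> simp [hω]
  have hXsum : ∑ x, prob p {ω | X ω = x} = 1 := by
    simp only [prob_setOf]
    rw [Finset.sum_comm, ← hp]
    exact Finset.sum_congr rfl fun ω _ => by simp
  have hXconst : ∀ x x', prob p {ω | X ω = x} = prob p {ω | X ω = x'} := by
    intro x x'
    rw [hX, hX]
    exact Finset.sum_congr rfl fun y _ => h x x' y
  have hprod : ∀ x y, prob p {ω | X ω = x} * prob p {ω | Y ω = y} =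
      prob p {ω | X ω = x ∧ Y ω = y} := by
    intro x y
    have h1 : (Fintype.card α : ℝ) * prob p {ω | X ω = x} = 1 := by
      rw [← hXsum, Finset.sum_congr rfl fun x' _ => hXconst x' x]
      simp
    rw [hY, Finset.sum_congr rfl fun x' _ => h x' x y]
    simp only [Finset.sum_const, Finset.card_univ, nsmul_eq_mul]
    linear_combination prob p {ω | X ω = x ∧ Y ω = y} * h1
  unfold mutualInfo
  refine Finset.sum_eq_zero fun x _ => Finset.sum_eq_zero fun y _ => ?_
  rw [hprod]
  rcases eq_or_ne (prob p {ω | X ω = x ∧ Y ω = y}) 0 with h0 | h0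
  · rw [h0, zero_mul]
  · rw [div_self h0, Real.logb_one, mul_zero]

/-! ### Private schemes with uniform randomness -/

/-- A private scheme for files in `A`, caches in `C` and transmissions in `E`, whose randomness is
uniformly distributed.  Privacy is stated by a map on the outcomes of the randomness and the files
that carries the view of user `k` under one demand vector to its view under another one. -/
structure UniformScheme (N K : ℕ) (A C E : Type) where
  S : Type
  P : Type
  J : Type
  [fintypeS : Fintype S]
  [fintypeP : Fintype P]
  [fintypeJ : Fintype J]
  [nonemptyS : Nonempty S]
  [nonemptyP : Nonempty P]
  cacheEnc : Fin K → S → (Fin N → A) → C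
  enc : (Fin N → A) → Demands N K → P → (Fin K → S) → E
  aux : Demands N K → P → (Fin K → S) → J
  dec : Fin K → Fin N → S → J → E → C → A
  decodes : ∀ (k : Fin K) (D : Demands N K) (p : P) (s : Fin K → S) (W : Fin N → A),
    dec k (D k) (s k) (aux D p s) (enc W D p s) (cacheEnc k (s k) W) = W (D k)
  priv : ∀ (k : Fin K) (D D' : Demands N K), D k = D' k →
    ∃ e : (Fin K → S) × P × (Fin N → A) → (Fin K → S) × P × (Fin N → A), Function.Injective e ∧
      ∀ ω, (e ω).1 k = ω.1 k ∧ cacheEnc k ((e ω).1 k) (e ω).2.2 = cacheEnc k (ω.1 k) ω.2.2 ∧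
        enc (e ω).2.2 D' (e ω).2.1 (e ω).1 = enc ω.2.2 D ω.2.1 ω.1 ∧
        aux D' (e ω).2.1 (e ω).1 = aux D ω.2.1 ω.1

attribute [instance] UniformScheme.fintypeS UniformScheme.fintypeP UniformScheme.fintypeJ
  UniformScheme.nonemptyS UniformScheme.nonemptyP

namespace UniformScheme

variable {N K : ℕ} {A C E A' C' E' : Type}

/-- Rename the files and enlarge the alphabets of caches and transmissions. -/
def transport (c : UniformScheme N K A C E) (eA : A ≃ A') (iC : C ↪ C') (iE : E ↪ E')
    [Nonempty C] [Nonempty E] : UniformScheme N K A' C' E' where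
  S := c.S
  P := c.P
  J := c.J
  cacheEnc k s W := iC (c.cacheEnc k s fun n => eA.symm (W n))
  enc W D p s := iE (c.enc (fun n => eA.symm (W n)) D p s)
  aux := c.aux
  dec k d s j x z := eA (c.dec k d s j (Function.invFun iE x) (Function.invFun iC z))
  decodes k D p s W := by
    rw [Function.leftInverse_invFun iE.injective, Function.leftInverse_invFun iC.injective,
      c.decodes, Equiv.apply_symm_apply]
  priv k D D' h := by
    obtain ⟨e, he, hv⟩ := c.priv k D D' h
    refine ⟨fun ω => ((e (ω.1, ω.2.1, fun n => eA.symm (ω.2.2 n))).1,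
      (e (ω.1, ω.2.1, fun n => eA.symm (ω.2.2 n))).2.1,
      fun n => eA ((e (ω.1, ω.2.1, fun n => eA.symm (ω.2.2 n))).2.2 n)), ?_, ?_⟩
    · rintro ⟨s, p, W⟩ ⟨s', p', W'⟩ heq
      simp only [Prod.mk.injEq] at heq
      obtain ⟨h1, h2, h3⟩ := heq
      have h3' := funext fun n => eA.injective (congrFun h3 n)
      have := he (Prod.ext h1 (Prod.ext h2 h3'))
      simp only [Prod.mk.injEq] at this
      obtain ⟨h4, h5, h6⟩ := this
      exact Prod.ext h4 (Prod.ext h5 (funext fun n => eA.symm.injective (congrFun h6 n)))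
    · rintro ⟨s, p, W⟩
      obtain ⟨h1, h2, h3, h4⟩ := hv (s, p, fun n => eA.symm (W n))
      refine ⟨h1, ?_, ?_, h4⟩
      · simp only [Equiv.symm_apply_apply]
        rw [h2]
      · simp only [Equiv.symm_apply_apply]
        rw [h3]

/-- Using two schemes for two parts of the files. -/
def prod (c : UniformScheme N K A C E) (c' : UniformScheme N K A' C' E') :
    UniformScheme N K (A × A') (C × C') (E × E') where
  S := c.S × c'.S
  P := c.P × c'.P
  J := c.J × c'.J
  cacheEnc k s W := (c.cacheEnc k s.1 fun n => (W n).1, c'.cacheEnc k s.2 fun n => (W n).2)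
  enc W D p s := (c.enc (fun n => (W n).1) D p.1 fun k => (s k).1,
    c'.enc (fun n => (W n).2) D p.2 fun k => (s k).2)
  aux D p s := (c.aux D p.1 fun k => (s k).1, c'.aux D p.2 fun k => (s k).2)
  dec k d s j x z := (c.dec k d s.1 j.1 x.1 z.1, c'.dec k d s.2 j.2 x.2 z.2)
  decodes k D p s W := by
    have h1 := c.decodes k D p.1 (fun k => (s k).1) fun n => (W n).1
    have h2 := c'.decodes k D p.2 (fun k => (s k).2) fun n => (W n).2
    exact Prod.ext h1 h2
  priv k D D' h := by
    obtain ⟨e, he, hv⟩ := c.priv k D D' h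
    obtain ⟨e', he', hv'⟩ := c'.priv k D D' h
    let l : (Fin K → c.S × c'.S) × (c.P × c'.P) × (Fin N → A × A') →
        (Fin K → c.S) × c.P × (Fin N → A) :=
      fun ω => (fun k => (ω.1 k).1, ω.2.1.1, fun n => (ω.2.2 n).1)
    let r : (Fin K → c.S × c'.S) × (c.P × c'.P) × (Fin N → A × A') →
        (Fin K → c'.S) × c'.P × (Fin N → A') :=
      fun ω => (fun k => (ω.1 k).2, ω.2.1.2, fun n => (ω.2.2 n).2)
    refine ⟨fun ω => (fun k => ((e (l ω)).1 k, (e' (r ω)).1 k), ((e (l ω)).2.1, (e' (r ω)).2.1),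
      fun n => ((e (l ω)).2.2 n, (e' (r ω)).2.2 n)), ?_, ?_⟩
    · intro ω ω' heq
      simp only [Prod.mk.injEq] at heq
      obtain ⟨h1, ⟨h2, h3⟩, h4⟩ := heq
      have hl : l ω = l ω' := he (Prod.ext (funext fun k => congrArg Prod.fst (congrFun h1 k))
        (Prod.ext h2 (funext fun n => congrArg Prod.fst (congrFun h4 n))))
      have hr : r ω = r ω' := he' (Prod.ext (funext fun k => congrArg Prod.snd (congrFun h1 k))
        (Prod.ext h3 (funext fun n => congrArg Prod.snd (congrFun h4 n))))
      simp only [l, r, Prod.mk.injEq] at hl hr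
      exact Prod.ext (funext fun k => Prod.ext (congrFun hl.1 k) (congrFun hr.1 k))
        (Prod.ext (Prod.ext hl.2.1 hr.2.1)
          (funext fun n => Prod.ext (congrFun hl.2.2 n) (congrFun hr.2.2 n)))
    · intro ω
      obtain ⟨h1, h2, h3, h4⟩ := hv (l ω)
      obtain ⟨h1', h2', h3', h4'⟩ := hv' (r ω)
      exact ⟨Prod.ext h1 h1', Prod.ext h2 h2', Prod.ext h3 h3', Prod.ext h4 h4'⟩

/-- Sending all the files. -/
def uncached (N K : ℕ) (A : Type) : UniformScheme N K A Unit (Fin N → A) where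
  S := Unit
  P := Unit
  J := Unit
  cacheEnc _ _ _ := ()
  enc W _ _ _ := W
  aux _ _ _ := ()
  dec _ d _ _ x _ := x d
  decodes _ _ _ _ _ := rfl
  priv _ _ _ _ := ⟨id, Function.injective_id, fun _ => ⟨rfl, rfl, rfl, rfl⟩⟩

variable {F : ℕ} {M R : ℝ}

/-- A scheme with uniform randomness as a private code. -/
def toPrivateCode (c : UniformScheme N K (FileWord F) (Bits (M * F)) (Bits (R * F))) :
    PrivateCode N K F M R where
  S := fun _ => c.S
  P := c.P
  J := c.J
  lawS := PMF.uniformOfFintype (Fin K → c.S)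
  lawP := PMF.uniformOfFintype c.P
  cacheEnc k s _ W := c.cacheEnc k s W
  enc := c.enc
  aux := c.aux
  dec := c.dec

lemma toPrivateCode_decodes
    (c : UniformScheme N K (FileWord F) (Bits (M * F)) (Bits (R * F))) :
    c.toPrivateCode.Decodes :=
  fun k ω _ => c.decodes k ω.2.2.2 ω.2.1 ω.1 ω.2.2.1

lemma toPrivateCode_isDemandPrivate (hN : 1 ≤ N)
    (c : UniformScheme N K (FileWord F) (Bits (M * F)) (Bits (R * F))) :
    c.toPrivateCode.IsDemandPrivate := by
  classical
  intro k
  have : Nonempty (Fin N) := ⟨⟨0, hN⟩⟩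
  have : Nonempty (FileWord F) := ⟨⟨0, by positivity⟩⟩
  have hlaw : ∀ ω, c.toPrivateCode.law ω = (Fintype.card c.toPrivateCode.Outcome : ℝ)⁻¹ := by
    intro ω
    have h1 : c.toPrivateCode.lawS ω.1 = (Fintype.card (Fin K → c.S) : ENNReal)⁻¹ :=
      PMF.uniformOfFintype_apply (α := Fin K → c.S) _
    have h2 : c.toPrivateCode.lawP ω.2.1 = (Fintype.card c.P : ENNReal)⁻¹ :=
      PMF.uniformOfFintype_apply (α := c.P) _
    have h3 : Fintype.card c.toPrivateCode.Outcome = Fintype.card (Fin K → c.S) *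
        (Fintype.card c.P * (Fintype.card (Files N F) * Fintype.card (Demands N K))) := by
      rw [← Fintype.card_prod, ← Fintype.card_prod, ← Fintype.card_prod]
      exact Fintype.card_congr (Equiv.refl _)
    rw [PrivateCode.law, h1, h2, h3]
    simp only [ENNReal.toReal_inv, ENNReal.toReal_natCast, Nat.cast_mul, mul_inv]
    ring
  have hne : Nonempty c.toPrivateCode.Outcome :=
    ⟨(fun _ => c.nonemptyS.some, c.nonemptyP.some, Classical.arbitrary _, Classical.arbitrary _)⟩
  refine mutualInfo_eq_zero _ _ _ ?_ ?_
  · simp only [hlaw, Finset.sum_const, Finset.card_univ, nsmul_eq_mul]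
    refine mul_inv_cancel₀ ?_
    exact_mod_cast Fintype.card_ne_zero
  -- Under the uniform law probabilities are counts. The view-preserving injection for the demand
  -- vectors built from x and x' bounds one count by the other; exchanging x and x' gives equality.
  · have hle : ∀ x x' y, prob c.toPrivateCode.law {ω | c.toPrivateCode.otherDemands k ω = x ∧
        (c.toPrivateCode.cache k ω, c.toPrivateCode.message ω, c.toPrivateCode.demand k ω) = y} ≤
        prob c.toPrivateCode.law {ω | c.toPrivateCode.otherDemands k ω = x' ∧
        (c.toPrivateCode.cache k ω, c.toPrivateCode.message ω, c.toPrivateCode.demand k ω) = y} := by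
      intro x x' y
      obtain ⟨yz, yx, yd⟩ := y
      let D : Demands N K := fun j => if h : j = k then yd else x ⟨j, h⟩
      let D' : Demands N K := fun j => if h : j = k then yd else x' ⟨j, h⟩
      have hD : D k = yd := dif_pos rfl
      have hD' : D' k = yd := dif_pos rfl
      obtain ⟨e, he, hv⟩ := c.priv k D D' (hD.trans hD'.symm)
      simp only [prob_setOf, hlaw]
      rw [← Finset.sum_filter, ← Finset.sum_filter, Finset.sum_const, Finset.sum_const,
        nsmul_eq_mul, nsmul_eq_mul]
      refine mul_le_mul_of_nonneg_right ?_ (by positivity)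
      have hmem : ∀ ω : c.toPrivateCode.Outcome, c.toPrivateCode.otherDemands k ω = x ∧
          (c.toPrivateCode.cache k ω, c.toPrivateCode.message ω, c.toPrivateCode.demand k ω) =
            (yz, yx, yd) → ω.2.2.2 = D := by
        rintro ω ⟨h1, h2⟩
        funext j
        by_cases hj : j = k
        · subst hj
          rw [hD]
          exact congrArg (fun t => t.2.2) h2
        · rw [show D j = x ⟨j, hj⟩ from dif_neg hj]
          exact congrFun h1 ⟨j, hj⟩
      refine Nat.cast_le.2 (Finset.card_le_card_of_injOn
        (fun ω => ((e (ω.1, ω.2.1, ω.2.2.1)).1, (e (ω.1, ω.2.1, ω.2.2.1)).2.1,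
          (e (ω.1, ω.2.1, ω.2.2.1)).2.2, D')) ?_ ?_)
      · intro ω hω
        simp only [Finset.coe_filter, Finset.mem_univ, true_and, Set.mem_ofPred_eq] at hω ⊢
        have hωD := hmem ω hω
        obtain ⟨h1, h2⟩ := hω
        obtain ⟨s, p, W, D₀⟩ := ω
        simp only at hωD
        subst hωD
        obtain ⟨v1, v2, v3, v4⟩ := hv (s, p, W)
        refine ⟨?_, ?_⟩
        · funext j
          exact dif_neg j.2
        · rw [← h2]
          refine Prod.ext (Prod.ext v2 v1) (Prod.ext (Prod.ext v3 v4) ?_)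
          exact hD'.trans hD.symm
      · intro ω hω ω' hω' heq
        simp only [Finset.coe_filter, Finset.mem_univ, true_and, Set.mem_ofPred_eq] at hω hω'
        have hd := (hmem ω hω).trans (hmem ω' hω').symm
        have := he (Prod.ext (congrArg (fun t => t.1) heq)
          (Prod.ext (congrArg (fun t => t.2.1) heq) (congrArg (fun t => t.2.2.1) heq)))
        exact Prod.ext (congrArg (fun t => t.1) this) (Prod.ext (congrArg (fun t => t.2.1) this)
          (Prod.ext (congrArg (fun t => t.2.2) this) hd))
    exact fun x x' y => le_antisymm (hle x x' y) (hle x' x y)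

end UniformScheme

/-! ### The region of memory-rate pairs reached by schemes with uniform randomness -/

/-- There is a scheme with uniform randomness for files of `F` bits whose caches, transmission and
auxiliary variables have at most `c`, `e` and `a` bits. -/
def HasUniformScheme (N K F : ℕ) (c e a : ℝ) : Prop :=
  ∃ (A C E : Type) (_ : Fintype A) (_ : Fintype C) (_ : Fintype E) (_ : Nonempty C)
    (_ : Nonempty E) (s : UniformScheme N K A C E), Fintype.card A = 2 ^ F ∧
    (Fintype.card C : ℝ) ≤ 2 ^ c ∧ (Fintype.card E : ℝ) ≤ 2 ^ e ∧
    (Fintype.card s.S : ℝ) ≤ 2 ^ a ∧ (Fintype.card s.J : ℝ) ≤ 2 ^ a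

namespace HasUniformScheme

variable {N K F F' : ℕ} {c c' e e' a a' : ℝ}

lemma mono (h : HasUniformScheme N K F c e a) (hc : c ≤ c') (he : e ≤ e') (ha : a ≤ a') :
    HasUniformScheme N K F c' e' a' := by
  obtain ⟨A, C, E, _, _, _, _, _, s, h1, h2, h3, h4, h5⟩ := h
  have hm : ∀ {x y : ℝ}, x ≤ y → (2 : ℝ) ^ x ≤ 2 ^ y := fun h =>
    Real.rpow_le_rpow_of_exponent_le (by norm_num) h
  exact ⟨A, C, E, _, _, _, inferInstance, inferInstance, s, h1, h2.trans (hm hc),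
    h3.trans (hm he), h4.trans (hm ha), h5.trans (hm ha)⟩

lemma add (h : HasUniformScheme N K F c e a) (h' : HasUniformScheme N K F' c' e' a') :
    HasUniformScheme N K (F + F') (c + c') (e + e') (a + a') := by
  obtain ⟨A, C, E, _, _, _, _, _, s, h1, h2, h3, h4, h5⟩ := h
  obtain ⟨A', C', E', _, _, _, _, _, s', h1', h2', h3', h4', h5'⟩ := h'
  have hm : ∀ {m n : ℕ} {x y : ℝ}, (m : ℝ) ≤ 2 ^ x → (n : ℝ) ≤ 2 ^ y →
      ((m * n : ℕ) : ℝ) ≤ 2 ^ (x + y) := by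
    intro m n x y hx hy
    rw [Real.rpow_add (by norm_num), Nat.cast_mul]
    gcongr
  refine ⟨A × A', C × C', E × E', inferInstance, inferInstance, inferInstance, inferInstance,
    inferInstance, s.prod s', ?_, ?_, ?_, ?_, ?_⟩
  · rw [Fintype.card_prod, h1, h1', pow_add]
  · rw [Fintype.card_prod]; exact hm h2 h2'
  · rw [Fintype.card_prod]; exact hm h3 h3'
  · exact le_trans (by exact_mod_cast (Fintype.card_prod s.S s'.S).le) (hm h4 h4')
  · exact le_trans (by exact_mod_cast (Fintype.card_prod s.J s'.J).le) (hm h5 h5')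

lemma uncached (N K F : ℕ) : HasUniformScheme N K F 0 (N * F) 0 := by
  refine ⟨Fin (2 ^ F), Unit, Fin N → Fin (2 ^ F), inferInstance, inferInstance, inferInstance,
    inferInstance, ⟨fun _ => ⟨0, by positivity⟩⟩, UniformScheme.uncached N K _, ?_, ?_, ?_, ?_, ?_⟩
  · simp
  · simp
  · rw [Fintype.card_fun, Fintype.card_fin, Fintype.card_fin, mul_comm,
      show (F : ℝ) * N = ((F * N : ℕ) : ℝ) by push_cast; ring, Real.rpow_natCast, pow_mul]
    push_cast
    rfl
  · simp only [UniformScheme.uncached, Real.rpow_zero, Nat.cast_le_one]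
    exact Fintype.card_le_one_iff_subsingleton.2 inferInstance
  · simp only [UniformScheme.uncached, Real.rpow_zero, Nat.cast_le_one]
    exact Fintype.card_le_one_iff_subsingleton.2 inferInstance

end HasUniformScheme

lemma card_le_card_bits {C : Type} [Fintype C] {x : ℝ} (h : (Fintype.card C : ℝ) ≤ 2 ^ x) :
    Nonempty (C ↪ Bits x) :=
  Function.Embedding.nonempty_of_card_le (by rw [Fintype.card_fin]; exact Nat.le_floor h)

lemma privatelyAchievable_of_hasUniformScheme {N K : ℕ} (hN : 1 ≤ N) {M R : ℝ}
    (h : ∀ ε : ℝ, 0 < ε → ∃ F : ℕ, 0 < F ∧ HasUniformScheme N K F (M * F) (R * F) (ε * F)) :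
    PrivatelyAchievable N K M R := by
  intro ε hε
  obtain ⟨F, hF, A, C, E, _, _, _, _, _, s, h1, h2, h3, h4, h5⟩ := h ε hε
  obtain ⟨iC⟩ := card_le_card_bits h2
  obtain ⟨iE⟩ := card_le_card_bits h3
  have eA : A ≃ FileWord F := Fintype.equivOfCardEq (by rw [h1, Fintype.card_fin])
  let c := s.transport eA iC iE
  have hlog : ∀ n : ℕ, (n : ℝ) ≤ 2 ^ (ε * F) → Real.logb 2 n ≤ ε * F := by
    intro n hn
    rcases Nat.eq_zero_or_pos n with rfl | hpos
    · simp only [Nat.cast_zero, Real.logb_zero]; positivity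
    · rwa [Real.logb_le_iff_le_rpow (by norm_num) (by exact_mod_cast hpos)]
  exact ⟨F, hF, c.toPrivateCode, c.toPrivateCode_decodes, c.toPrivateCode_isDemandPrivate hN,
    hlog _ h5, fun _ => hlog _ h4⟩

/-- The memory-rate pairs reached, up to an arbitrarily small increase of the rate, by schemes with
uniform randomness and negligible auxiliary variables for all large file sizes. -/
def uniformRegion (N K : ℕ) : Set (ℝ × ℝ) :=
  {x | ∀ ε : ℝ, 0 < ε → ∃ L₀ : ℕ, ∀ L ≥ L₀,
    HasUniformScheme N K L (x.1 * L) ((x.2 + ε) * L) (ε * L)}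

lemma uniformRegion_mono {N K : ℕ} {M M' R : ℝ} (h : (M, R) ∈ uniformRegion N K)
    (hM : M ≤ M') : (M', R) ∈ uniformRegion N K := by
  intro ε hε
  obtain ⟨L₀, hL⟩ := h ε hε
  exact ⟨L₀, fun L hL' => (hL L hL').mono (by dsimp only; gcongr) le_rfl le_rfl⟩

/-- Memory sharing: a fraction a of each file goes through the first scheme and the rest through the
second. -/
lemma uniformRegion_combo {N K : ℕ} {x y : ℝ × ℝ} (hx : x ∈ uniformRegion N K)
    (hy : y ∈ uniformRegion N K) (hxy : x.1 ≤ y.1) {a b : ℝ} (ha : 0 < a) (hb : 0 < b)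
    (hab : a + b = 1) : a • x + b • y ∈ uniformRegion N K := by
  intro ε hε
  obtain ⟨Lx, hLx⟩ := hx (ε / 2) (by positivity)
  obtain ⟨Ly, hLy⟩ := hy (ε / 2) (by positivity)
  -- The first two terms make both parts long enough, the extra 1 allowing for rounding; the third
  -- lets ε absorb the effect of rounding on the rate.
  refine ⟨⌈(Lx : ℝ) / a⌉₊ + ⌈((Ly : ℝ) + 1) / b⌉₊ + ⌈2 * |x.2 - y.2| / ε⌉₊, fun L hL => ?_⟩
  have hL' : (⌈(Lx : ℝ) / a⌉₊ : ℝ) + ⌈((Ly : ℝ) + 1) / b⌉₊ + ⌈2 * |x.2 - y.2| / ε⌉₊ ≤ L := by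
    exact_mod_cast hL
  have n1 : (0 : ℝ) ≤ ⌈(Lx : ℝ) / a⌉₊ := by positivity
  have n2 : (0 : ℝ) ≤ ⌈((Ly : ℝ) + 1) / b⌉₊ := by positivity
  have n3 : (0 : ℝ) ≤ ⌈2 * |x.2 - y.2| / ε⌉₊ := by positivity
  have g1 : (Lx : ℝ) ≤ a * L := by
    have : (Lx : ℝ) / a ≤ L := (Nat.le_ceil _).trans (by linarith)
    rw [div_le_iff₀ ha] at this; linarith
  have g2 : (Ly : ℝ) + 1 ≤ b * L := by
    have : ((Ly : ℝ) + 1) / b ≤ L := (Nat.le_ceil _).trans (by linarith)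
    rw [div_le_iff₀ hb] at this; linarith
  have g3 : 2 * |x.2 - y.2| ≤ ε * L := by
    have : 2 * |x.2 - y.2| / ε ≤ L := (Nat.le_ceil _).trans (by linarith)
    rw [div_le_iff₀ hε] at this; linarith
  have hL0 : (0 : ℝ) ≤ L := by positivity
  -- Rounding up favours the scheme with the smaller memory, since x.1 ≤ y.1. The memory constraint
  -- has no slack, so it must not be exceeded; only the rate may be.
  set m := ⌈a * L⌉₊
  have hm1 : a * L ≤ m := Nat.le_ceil _
  have hm2 : (m : ℝ) < a * L + 1 := Nat.ceil_lt_add_one (by positivity)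
  have hbL : b * L = L - a * L := by linear_combination (L : ℝ) * hab
  have hmL : m ≤ L := by
    have h : (m : ℝ) < L + 1 := by
      have : (0 : ℝ) ≤ Ly := by positivity
      linarith
    exact Nat.lt_succ_iff.1 (by exact_mod_cast h)
  have h1 := hLx m (by exact_mod_cast g1.trans hm1)
  have h2 := hLy (L - m) (by
    have : (Ly : ℝ) ≤ ((L - m : ℕ) : ℝ) := by
      rw [Nat.cast_sub hmL]; linarith
    exact_mod_cast this)
  have h3 := h1.add h2
  rw [Nat.add_sub_cancel' hmL] at h3
  refine h3.mono ?_ ?_ ?_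
  · rw [Nat.cast_sub hmL]
    simp only [Prod.fst_add, Prod.smul_fst, smul_eq_mul]
    have hb' : b = 1 - a := by linarith
    subst hb'
    nlinarith [mul_nonneg (sub_nonneg.2 hm1) (sub_nonneg.2 hxy)]
  · rw [Nat.cast_sub hmL]
    simp only [Prod.snd_add, Prod.smul_snd, smul_eq_mul]
    have hb' : b = 1 - a := by linarith
    subst hb'
    have e : (x.2 + ε / 2) * (m : ℝ) + (y.2 + ε / 2) * (L - m) =
      (a * x.2 + (1 - a) * y.2 + ε / 2) * L + (m - a * L) * (x.2 - y.2) := by ring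
    rw [e]
    have h4 : ((m : ℝ) - a * L) * (x.2 - y.2) ≤ |x.2 - y.2| := by
      have h5 : ((m : ℝ) - a * L) * (x.2 - y.2) ≤ ((m : ℝ) - a * L) * |x.2 - y.2| :=
        mul_le_mul_of_nonneg_left (le_abs_self _) (by linarith)
      have h6 : ((m : ℝ) - a * L) * |x.2 - y.2| ≤ 1 * |x.2 - y.2| :=
        mul_le_mul_of_nonneg_right (by linarith) (abs_nonneg _)
      linarith
    nlinarith
  · rw [Nat.cast_sub hmL]
    nlinarith

lemma convex_uniformRegion (N K : ℕ) : Convex ℝ (uniformRegion N K) := by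
  intro x hx y hy a b ha hb hab
  rcases ha.eq_or_lt with rfl | ha
  · rw [zero_add] at hab; subst hab; simpa using hy
  rcases hb.eq_or_lt with rfl | hb
  · rw [add_zero] at hab; subst hab; simpa using hx
  rcases le_total x.1 y.1 with h | h
  · exact uniformRegion_combo hx hy h ha hb hab
  · rw [add_comm]
    exact uniformRegion_combo hy hx h hb ha (by linarith)

/-- A family of schemes for all multiples of a file size yields a point of the region. -/
lemma mem_uniformRegion_of_family {N K n : ℕ} (hn : 0 < n) {c e a : ℝ} (hc : 0 ≤ c) (he : 0 ≤ e)
    (h : ∀ l : ℕ, HasUniformScheme N K (l * n) (l * c) (l * e) a) :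
    (c / n, e / n) ∈ uniformRegion N K := by
  intro ε hε
  have hn' : (0 : ℝ) < n := by exact_mod_cast hn
  refine ⟨⌈(N * n : ℝ) / ε⌉₊ + ⌈a / ε⌉₊, fun L hL => ?_⟩
  have hL' : (⌈(N * n : ℝ) / ε⌉₊ : ℝ) + ⌈a / ε⌉₊ ≤ L := by exact_mod_cast hL
  have n1 : (0 : ℝ) ≤ ⌈(N * n : ℝ) / ε⌉₊ := by positivity
  have n2 : (0 : ℝ) ≤ ⌈a / ε⌉₊ := by positivity
  have g1 : (N * n : ℝ) ≤ ε * L := by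
    have : (N * n : ℝ) / ε ≤ L := (Nat.le_ceil _).trans (by linarith)
    rw [div_le_iff₀ hε] at this; linarith
  have g2 : a ≤ ε * L := by
    have : a / ε ≤ L := (Nat.le_ceil _).trans (by linarith)
    rw [div_le_iff₀ hε] at this; linarith
  -- The fewer than n leftover bits of each file are sent uncached, at most N n further bits of
  -- transmission and no memory.
  have h1 := (h (L / n)).add (HasUniformScheme.uncached N K (L % n))
  rw [Nat.div_add_mod' L n] at h1
  have hdiv : ((L / n : ℕ) : ℝ) ≤ L / n := Nat.cast_div_le
  have hmod : ((L % n : ℕ) : ℝ) ≤ n := by exact_mod_cast (Nat.mod_lt L hn).le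
  refine h1.mono ?_ ?_ ?_
  · calc ((L / n : ℕ) : ℝ) * c + 0 ≤ L / n * c := by rw [add_zero]; gcongr
      _ = _ := by ring
  · calc ((L / n : ℕ) : ℝ) * e + N * ((L % n : ℕ) : ℝ) ≤ L / n * e + N * n := by gcongr
      _ ≤ L / n * e + ε * L := by linarith
      _ = _ := by ring
  · linarith

lemma privatelyAchievable_of_mem_uniformRegion {N K : ℕ} (hN : 1 ≤ N) {M R δ : ℝ}
    (h : (M, R) ∈ uniformRegion N K) (hδ : 0 < δ) : PrivatelyAchievable N K M (R + δ) := by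
  refine privatelyAchievable_of_hasUniformScheme hN fun ε hε => ?_
  obtain ⟨L₀, hL⟩ := h (min ε δ) (lt_min hε hδ)
  refine ⟨L₀ + 1, Nat.succ_pos _, (hL (L₀ + 1) (Nat.le_succ _)).mono le_rfl ?_ ?_⟩
  · exact mul_le_mul_of_nonneg_right (by have := min_le_right ε δ; dsimp only; linarith)
      (by positivity)
  · exact mul_le_mul_of_nonneg_right (min_le_left _ _) (by positivity)

lemma optPrivateRate_le_of_mem_uniformRegion {N K : ℕ} (hN : 1 ≤ N) {M R : ℝ}
    (h : (M, R) ∈ uniformRegion N K) : optPrivateRate N K M ≤ R := by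
  refine le_of_forall_pos_le_add fun δ hδ => ?_
  exact csInf_le ⟨0, fun R' hR' => (hR'.achievable hN).nonneg hN⟩
    (privatelyAchievable_of_mem_uniformRegion hN h hδ)

lemma optRate_le_optPrivateRate {N K : ℕ} (hN : 1 ≤ N) {M : ℝ}
    (hne : ∃ R, (M, R) ∈ uniformRegion N K) : optRate N K M ≤ optPrivateRate N K M := by
  obtain ⟨R, hR⟩ := hne
  exact csInf_le_csInf ⟨0, fun R' hR' => hR'.nonneg hN⟩
    ⟨R + 1, privatelyAchievable_of_mem_uniformRegion hN hR one_pos⟩ fun R' hR' => hR'.achievable hN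

lemma optPrivateRate_le_envelope {N K : ℕ} (hN : 1 ≤ N) {A : Set (ℝ × ℝ)}
    (hA : A ⊆ uniformRegion N K) {m M : ℝ} (hm : m ≤ M) (hne : ∃ R, (m, R) ∈ convexHull ℝ A) :
    optPrivateRate N K M ≤ lowerConvexEnvelope A m :=
  le_csInf hne fun _ hR => optPrivateRate_le_of_mem_uniformRegion hN
    (uniformRegion_mono (convexHull_min hA (convex_uniformRegion N K) hR) hm)

/-! ### Linear private schemes -/

/-- Equal ranges force kernels of equal dimension. Match the kernels arbitrarily, and complements of
the kernels through the common range. All changes of variables in the privacy proof come from this.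
-/
lemma exists_linearEquiv_comp_eq {𝔽 V W : Type*} [Field 𝔽] [AddCommGroup V] [Module 𝔽 V]
    [FiniteDimensional 𝔽 V] [AddCommGroup W] [Module 𝔽 W] (f g : V →ₗ[𝔽] W)
    (h : LinearMap.range f = LinearMap.range g) :
    ∃ T : V ≃ₗ[𝔽] V, ∀ v, g (T v) = f v := by
  obtain ⟨p, hp⟩ := (LinearMap.ker f).exists_isCompl
  obtain ⟨q, hq⟩ := (LinearMap.ker g).exists_isCompl
  have hker : Module.finrank 𝔽 (LinearMap.ker f) = Module.finrank 𝔽 (LinearMap.ker g) := by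
    have h1 := LinearMap.finrank_range_add_finrank_ker f
    have h2 := LinearMap.finrank_range_add_finrank_ker g
    rw [h] at h1
    omega
  let ek := LinearEquiv.ofFinrankEq _ _ hker
  let ec : p ≃ₗ[𝔽] q := (LinearMap.kerComplementEquivRange f hp.symm).trans
    ((LinearEquiv.ofEq _ _ h).trans (LinearMap.kerComplementEquivRange g hq.symm).symm)
  let ef := Submodule.prodEquivOfIsCompl _ _ hp
  let eg := Submodule.prodEquivOfIsCompl _ _ hq
  have hec : ∀ x : p, g (ec x) = f x := by
    intro x
    have h1 : LinearMap.kerComplementEquivRange g hq.symm (ec x) =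
        LinearEquiv.ofEq _ _ h (LinearMap.kerComplementEquivRange f hp.symm x) :=
      LinearEquiv.apply_symm_apply _ _
    exact congrArg Subtype.val h1
  refine ⟨ef.symm.trans ((ek.prodCongr ec).trans eg), fun v => ?_⟩
  obtain ⟨⟨x, y⟩, rfl⟩ := ef.surjective v
  simp only [LinearEquiv.trans_apply, LinearEquiv.symm_apply_apply]
  have h1 : eg ((ek.prodCongr ec) (x, y)) = (ek x : V) + (ec y : V) := rfl
  have h2 : ef (x, y) = (x : V) + (y : V) := rfl
  rw [h1, h2, map_add, map_add, hec, LinearMap.mem_ker.1 (ek x).2, LinearMap.mem_ker.1 x.2]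

instance finite_linearMap {𝔽 V W : Type*} [Field 𝔽] [AddCommGroup V] [Module 𝔽 V]
    [AddCommGroup W] [Module 𝔽 W] [Finite V] [Finite W] : Finite (V →ₗ[𝔽] W) :=
  Finite.of_injective (fun f => (f : V → W)) DFunLike.coe_injective

instance finite_linearEquiv {𝔽 V W : Type*} [Field 𝔽] [AddCommGroup V] [Module 𝔽 V]
    [AddCommGroup W] [Module 𝔽 W] [Finite V] [Finite W] : Finite (V ≃ₗ[𝔽] W) :=
  Finite.of_injective (fun f => (f : V → W)) DFunLike.coe_injective

/-- A family of linear caching schemes over the field with two elements, for virtual users `(k, x)`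
with `k : Fin K` and `x : Fin N`.  When the virtual user `(k, x)` demands the file `x + σ k`, the
transmission serving the virtual users `(k, j k)` is `trans σ j`, and `out σ j k` extracts from it
what the user `(k, j k)` needs. -/
structure LinearScheme (N K m g : ℕ) [NeZero N] (Λ : Type) [AddCommGroup Λ] [Module (ZMod 2) Λ] where
  cache : Fin K → Fin N → Λ →ₗ[ZMod 2] (Fin g → ZMod 2)
  trans : Demands N K → Demands N K → (Fin N → Λ) →ₗ[ZMod 2] (Fin m → ZMod 2)
  out : Demands N K → Demands N K → Fin K → (Fin m → ZMod 2) →ₗ[ZMod 2] Λ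
  correction : Demands N K → Fin K → Fin N → (Fin N → Fin g → ZMod 2) → Λ
  surj : ∀ σ j k (c : Fin N → Fin g → ZMod 2) (y : Fin m → ZMod 2),
    ∃ W, (∀ n, cache k (j k) (W n) = c n) ∧ trans σ j W = y
  range_out : ∀ σ j j' k, j k = j' k →
    LinearMap.range (out σ j k) = LinearMap.range (out σ j' k)
  decodes : ∀ σ j k W, W (j k + σ k) =
    out σ j k (trans σ j W) + correction σ k (j k) fun n => cache k (j k) (W n)

namespace LinearScheme

variable {N K m g : ℕ} [NeZero N] {Λ : Type} [AddCommGroup Λ] [Module (ZMod 2) Λ] [Finite Λ]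
  (c : LinearScheme N K m g Λ)

/-- User k cannot tell j from j': T matches its decoding maps, which have the same range, and B then
matches cache and transmission jointly. B exists because both joint maps are onto by `surj`. -/
lemma exists_change_of_choice (σ j j' : Demands N K) (k : Fin K) (h : j k = j' k) :
    ∃ (T : (Fin m → ZMod 2) ≃ₗ[ZMod 2] (Fin m → ZMod 2))
      (B : (Fin N → Λ) ≃ₗ[ZMod 2] (Fin N → Λ)),
      (∀ v, c.out σ j' k (T v) = c.out σ j k v) ∧
      (∀ W n, c.cache k (j' k) (B W n) = c.cache k (j k) (W n)) ∧
      ∀ W, c.trans σ j' (B W) = T (c.trans σ j W) := by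
  obtain ⟨T, hT⟩ := exists_linearEquiv_comp_eq _ _ (c.range_out σ j j' k h)
  let κ : (Fin N → Λ) →ₗ[ZMod 2] (Fin N → Fin g → ZMod 2) :=
    LinearMap.pi fun n => (c.cache k (j k)).comp (LinearMap.proj n)
  let f : (Fin N → Λ) →ₗ[ZMod 2] (Fin N → Fin g → ZMod 2) × (Fin m → ZMod 2) :=
    κ.prod (T.toLinearMap.comp (c.trans σ j))
  let f' : (Fin N → Λ) →ₗ[ZMod 2] (Fin N → Fin g → ZMod 2) × (Fin m → ZMod 2) :=
    κ.prod (c.trans σ j')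
  have hf : LinearMap.range f = ⊤ := by
    refine LinearMap.range_eq_top.2 fun ⟨x, y⟩ => ?_
    obtain ⟨W, h1, h2⟩ := c.surj σ j k x (T.symm y)
    exact ⟨W, Prod.ext (funext h1) (by
      change T (c.trans σ j W) = y
      rw [h2, T.apply_symm_apply])⟩
  have hf' : LinearMap.range f' = ⊤ := by
    refine LinearMap.range_eq_top.2 fun ⟨x, y⟩ => ?_
    obtain ⟨W, h1, h2⟩ := c.surj σ j' k x y
    refine ⟨W, Prod.ext (funext fun n => ?_) h2⟩
    change c.cache k (j k) (W n) = x n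
    rw [h, h1]
  obtain ⟨B, hB⟩ := exists_linearEquiv_comp_eq f f' (hf.trans hf'.symm)
  refine ⟨T, B, hT, fun W n => ?_, fun W => congrArg Prod.snd (hB W)⟩
  rw [← h]
  exact congrFun (congrArg Prod.fst (hB W)) n

/-- The private scheme for `l` copies of a linear scheme: user `k` holds the cache of the virtual
user `(k, j k)` for a random `j k`, the shifts `D - j` are public, the transmission is masked by a
random invertible matrix, and each user receives its decoding matrix encrypted with a one-time
pad. -/
def toUniformScheme (l : ℕ) : UniformScheme N K (Fin l → Λ) (Fin N → Fin l → Fin g → ZMod 2)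
    (Fin l → Fin m → ZMod 2) where
  S := Fin N × ((Fin m → ZMod 2) →ₗ[ZMod 2] Λ)
  P := (Fin m → ZMod 2) ≃ₗ[ZMod 2] (Fin m → ZMod 2)
  J := Demands N K × (Fin K → ((Fin m → ZMod 2) →ₗ[ZMod 2] Λ))
  fintypeS := Fintype.ofFinite _
  fintypeP := Fintype.ofFinite _
  fintypeJ := Fintype.ofFinite _
  nonemptyP := ⟨LinearEquiv.refl _ _⟩
  cacheEnc k s W := fun n i => c.cache k s.1 (W n i)
  enc W D p s := fun i => p (c.trans (fun k => D k - (s k).1) (fun k => (s k).1) fun n => W n i)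
  aux D p s := (fun k => D k - (s k).1, fun k =>
    (c.out (fun k => D k - (s k).1) (fun k => (s k).1) k).comp p.symm.toLinearMap + (s k).2)
  dec k _ s J x z := fun i => (J.2 k - s.2) (x i) + c.correction J.1 k s.1 fun n => z n i
  decodes k D p s W := by
    funext i
    have h := c.decodes (fun k => D k - (s k).1) (fun k => (s k).1) k fun n => W n i
    simp only [add_sub_cancel] at h
    rw [h]
    simp
  priv k D D' hD := by
    -- The new choice is j + D' - D, which keeps the public shifts and agrees with j at k.
    have hex := fun j : Demands N K => c.exists_change_of_choice (fun k => D k - j k) j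
      (fun i => j i + (D' i - D i)) k (by simp [hD])
    choose T B hT hB hTB using hex
    let g' : Demands N K → ((Fin m → ZMod 2) ≃ₗ[ZMod 2] (Fin m → ZMod 2)) →
      ((Fin m → ZMod 2) ≃ₗ[ZMod 2] (Fin m → ZMod 2)) := fun j p => (T j).symm.trans p
    -- The amount by which the pads must change so that the encrypted decoding matrices look the
    -- same. It vanishes for user k by the choice of T, so user k keeps its own pad.
    let h : Demands N K → ((Fin m → ZMod 2) ≃ₗ[ZMod 2] (Fin m → ZMod 2)) → Fin K →
      ((Fin m → ZMod 2) →ₗ[ZMod 2] Λ) := fun j p i =>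
      (c.out (fun k => D k - j k) j i).comp p.symm.toLinearMap -
      (c.out (fun k => D k - j k) (fun i => j i + (D' i - D i)) i).comp (g' j p).symm.toLinearMap
    have hk : ∀ j p, h j p k = 0 := by
      intro j p
      refine LinearMap.ext fun v => ?_
      simp [h, g', hT]
    have hshift : ∀ s : Fin K → Fin N × ((Fin m → ZMod 2) →ₗ[ZMod 2] Λ),
        (fun i => D' i - ((s i).1 + (D' i - D i))) = fun i => D i - (s i).1 := by
      intro s
      funext i
      abel
    refine ⟨fun ω => (fun i => ((ω.1 i).1 + (D' i - D i), (ω.1 i).2 + h (fun i => (ω.1 i).1) ω.2.1 i),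
      g' (fun i => (ω.1 i).1) ω.2.1,
      fun n i => B (fun i => (ω.1 i).1) (fun n => ω.2.2 n i) n), ?_, ?_⟩
    · rintro ⟨s, p, W⟩ ⟨s', p', W'⟩ heq
      simp only [Prod.mk.injEq] at heq
      obtain ⟨h1, h2, h3⟩ := heq
      have hj : (fun i => (s i).1) = fun i => (s' i).1 := by
        funext i
        have := congrArg Prod.fst (congrFun h1 i)
        simpa using this
      rw [hj] at h2 h3
      have hp : p = p' := by
        have h2' : (T fun i => (s' i).1).trans ((T fun i => (s' i).1).symm.trans p) =
          (T fun i => (s' i).1).trans ((T fun i => (s' i).1).symm.trans p') :=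
            congrArg (fun q => (T fun i => (s' i).1).trans q) h2
        ext1 v
        have := LinearEquiv.congr_fun h2' v
        simpa using this
      subst hp
      have hs : s = s' := by
        funext i
        refine Prod.ext (congrFun hj i) ?_
        have := congrArg Prod.snd (congrFun h1 i)
        simp only [hj] at this
        exact add_right_cancel this
      have hW : W = W' := by
        funext n i
        have : B (fun i => (s' i).1) (fun n => W n i) = B (fun i => (s' i).1) (fun n => W' n i) :=
          funext fun n => congrFun (congrFun h3 n) i
        exact congrFun ((B _).injective this) n
      rw [hs, hW]
    · rintro ⟨s, p, W⟩
      have hsk : ((s k).1 + (D' k - D k), (s k).2 + h (fun i => (s i).1) p k) = s k := by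
        rw [hk, hD]; simp
      refine ⟨hsk, ?_, ?_, ?_⟩
      · funext n i
        exact hB (fun i => (s i).1) (fun n => W n i) n
      · funext i
        have := hTB (fun i => (s i).1) fun n => W n i
        dsimp only
        rw [hshift s, this]
        simp [g']
      · refine Prod.ext (hshift s) (funext fun i => ?_)
        dsimp only [h]
        rw [hshift s]
        abel

/-- The types `S` and `J` do not depend on the number l of copies: the same matrices and pads serve
all copies. This is why one constant bounds the overhead. -/
lemma hasUniformScheme (c : LinearScheme N K m g Λ) (n : ℕ) (hn : Module.finrank (ZMod 2) Λ = n) :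
    ∃ a : ℝ, ∀ l : ℕ, HasUniformScheme N K (l * n) (l * (N * g)) (l * m) a := by
  have : Fintype Λ := Fintype.ofFinite Λ
  let s := fun l => c.toUniformScheme l
  refine ⟨((Fintype.card (s 0).S + Fintype.card (s 0).J : ℕ) : ℝ), fun l => ?_⟩
  have hpow : ∀ x y : ℕ, (x : ℝ) ≤ 2 ^ ((x + y : ℕ) : ℝ) ∧ (y : ℝ) ≤ 2 ^ ((x + y : ℕ) : ℝ) := by
    intro x y
    have h : x + y ≤ 2 ^ (x + y) := Nat.lt_two_pow_self.le
    rw [Real.rpow_natCast]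
    exact ⟨by exact_mod_cast (Nat.le_add_right x y).trans h,
      by exact_mod_cast (Nat.le_add_left y x).trans h⟩
  refine ⟨_, _, _, inferInstance, inferInstance, inferInstance, ⟨0⟩, ⟨0⟩, s l, ?_, ?_, ?_,
    (hpow _ _).1, (hpow _ _).2⟩
  · rw [Fintype.card_fun, Module.card_eq_pow_finrank (K := ZMod 2) (V := Λ), hn, ZMod.card,
      Fintype.card_fin, ← pow_mul, mul_comm]
  · simp only [Fintype.card_fun, ZMod.card, Fintype.card_fin]
    rw [← pow_mul, ← pow_mul,
      show (l : ℝ) * (N * g) = ((g * (l * N) : ℕ) : ℝ) by push_cast; ring, Real.rpow_natCast]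
    push_cast
    rfl
  · simp only [Fintype.card_fun, ZMod.card, Fintype.card_fin]
    rw [← pow_mul, show (l : ℝ) * m = ((m * l : ℕ) : ℝ) by push_cast; ring, Real.rpow_natCast]
    push_cast
    rfl

lemma mem_uniformRegion (c : LinearScheme N K m g Λ) (n : ℕ) (hn : Module.finrank (ZMod 2) Λ = n) (hpos : 0 < n) :
    ((N * g : ℝ) / n, (m : ℝ) / n) ∈ uniformRegion N K := by
  obtain ⟨a, h⟩ := c.hasUniformScheme n hn
  exact mem_uniformRegion_of_family hpos (by positivity) (by positivity) h

end LinearScheme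

/-! ### Contractions of exterior powers -/

section Exterior

variable {𝔽 M : Type} [Field 𝔽] [AddCommGroup M] [Module 𝔽 M]

/-- Contraction with a linear functional, on the exterior algebra. -/
def contraction (u : Module.Dual 𝔽 M) : ExteriorAlgebra 𝔽 M →ₗ[𝔽] ExteriorAlgebra 𝔽 M :=
  CliffordAlgebra.contractLeft u

lemma contraction_ι_mul (u : Module.Dual 𝔽 M) (a : M) (x : ExteriorAlgebra 𝔽 M) :
    contraction u (ExteriorAlgebra.ι 𝔽 a * x) =
      u a • x - ExteriorAlgebra.ι 𝔽 a * contraction u x :=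
  CliffordAlgebra.contractLeft_ι_mul ..

lemma contraction_contraction (u : Module.Dual 𝔽 M) (x : ExteriorAlgebra 𝔽 M) :
    contraction u (contraction u x) = 0 :=
  CliffordAlgebra.contractLeft_contractLeft ..

lemma contraction_comm (u v : Module.Dual 𝔽 M) (x : ExteriorAlgebra 𝔽 M) :
    contraction u (contraction v x) = -contraction v (contraction u x) :=
  CliffordAlgebra.contractLeft_comm ..

lemma ι_mul_ι_mul (a b : M) (x : ExteriorAlgebra 𝔽 M) :
    ExteriorAlgebra.ι 𝔽 a * (ExteriorAlgebra.ι 𝔽 b * x) =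
      -(ExteriorAlgebra.ι 𝔽 b * (ExteriorAlgebra.ι 𝔽 a * x)) := by
  rw [← mul_assoc, ← mul_assoc, ← neg_mul]
  congr 1
  exact eq_neg_of_add_eq_zero_left (ExteriorAlgebra.ι_add_mul_swap a b)

lemma ι_mul_self_mul (a : M) (x : ExteriorAlgebra 𝔽 M) :
    ExteriorAlgebra.ι 𝔽 a * (ExteriorAlgebra.ι 𝔽 a * x) = 0 := by
  rw [← mul_assoc, ExteriorAlgebra.ι_sq_zero, zero_mul]

lemma ι_mul_mem {s : ℕ} (a : M) {x : ExteriorAlgebra 𝔽 M} (hx : x ∈ ⋀[𝔽]^s M) :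
    ExteriorAlgebra.ι 𝔽 a * x ∈ ⋀[𝔽]^(s + 1) M := by
  rw [ExteriorAlgebra.exteriorPower, pow_succ']
  exact Submodule.mul_mem_mul (LinearMap.mem_range_self _ a) hx

lemma contraction_of_mem_zero (u : Module.Dual 𝔽 M) {x : ExteriorAlgebra 𝔽 M}
    (hx : x ∈ ⋀[𝔽]^0 M) : contraction u x = 0 := by
  rw [ExteriorAlgebra.exteriorPower, pow_zero, Submodule.mem_one] at hx
  obtain ⟨r, rfl⟩ := hx
  exact CliffordAlgebra.contractLeft_algebraMap ..

lemma contraction_mem (u : Module.Dual 𝔽 M) (s : ℕ) :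
    ∀ {x : ExteriorAlgebra 𝔽 M}, x ∈ ⋀[𝔽]^(s + 1) M → contraction u x ∈ ⋀[𝔽]^s M := by
  induction s with
  | zero =>
    intro x hx
    rw [ExteriorAlgebra.exteriorPower, pow_succ'] at hx
    induction hx using Submodule.mul_induction_on' with
    | mem_mul_mem m hm y hy =>
      obtain ⟨a, rfl⟩ := hm
      rw [contraction_ι_mul, contraction_of_mem_zero u hy, mul_zero, sub_zero]
      exact Submodule.smul_mem _ _ hy
    | add x _ y _ hx hy => rw [map_add]; exact Submodule.add_mem _ hx hy
  | succ s ih =>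
    intro x hx
    rw [ExteriorAlgebra.exteriorPower, pow_succ'] at hx
    induction hx using Submodule.mul_induction_on' with
    | mem_mul_mem m hm y hy =>
      obtain ⟨a, rfl⟩ := hm
      rw [contraction_ι_mul]
      exact Submodule.sub_mem _ (Submodule.smul_mem _ _ hy) (ι_mul_mem a (ih hy))
    | add x _ y _ hx hy => rw [map_add]; exact Submodule.add_mem _ hx hy

lemma finrank_map_add_finrank_inf_ker {V W : Type*} [AddCommGroup V] [Module 𝔽 V]
    [AddCommGroup W] [Module 𝔽 W] (f : V →ₗ[𝔽] W) (p : Submodule 𝔽 V) [FiniteDimensional 𝔽 p] :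
    Module.finrank 𝔽 (p.map f) + Module.finrank 𝔽 (p ⊓ LinearMap.ker f : Submodule 𝔽 V) =
      Module.finrank 𝔽 p := by
  rw [← LinearMap.finrank_range_add_finrank_ker (f.domRestrict p), LinearMap.range_domRestrict,
    LinearMap.ker_domRestrict]
  congr 1
  rw [← (Submodule.comapSubtypeEquivOfLe
    (inf_le_left : p ⊓ LinearMap.ker f ≤ p)).finrank_eq, Submodule.comap_inf,
    Submodule.comap_subtype_self, top_inf_eq]

/-- The elements of degree `s` killed by the contractions with `u j`, `j ∈ J`. -/
def commonKernel {ι : Type*} (u : ι → Module.Dual 𝔽 M) (J : Finset ι) (s : ℕ) :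
    Submodule 𝔽 (ExteriorAlgebra 𝔽 M) :=
  ⋀[𝔽]^s M ⊓ ⨅ j ∈ J, LinearMap.ker (contraction (u j))

lemma mem_commonKernel {ι : Type*} {u : ι → Module.Dual 𝔽 M} {J : Finset ι} {s : ℕ}
    {x : ExteriorAlgebra 𝔽 M} :
    x ∈ commonKernel u J s ↔ x ∈ ⋀[𝔽]^s M ∧ ∀ j ∈ J, contraction (u j) x = 0 := by
  simp [commonKernel, Submodule.mem_iInf]

lemma card_le_finrank_of_dual [FiniteDimensional 𝔽 M] {ι : Type*} [DecidableEq ι]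
    (u : ι → Module.Dual 𝔽 M) (a : ι → M) (J : Finset ι)
    (h : ∀ i ∈ J, ∀ j ∈ J, u i (a j) = if i = j then 1 else 0) :
    J.card ≤ Module.finrank 𝔽 M := by
  have hli : LinearIndependent 𝔽 fun j : J => a j := by
    rw [Fintype.linearIndependent_iff]
    intro g hg i
    have := congrArg (u i) hg
    simp only [map_sum, map_smul, smul_eq_mul, map_zero] at this
    rw [Finset.sum_eq_single i] at this
    · simpa [h i i.2 i i.2] using this
    · intro j _ hj
      rw [h i i.2 j j.2, if_neg (fun e => hj (Subtype.ext e.symm)), mul_zero]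
    · intro hi; exact absurd (Finset.mem_univ i) hi
  simpa using hli.fintype_card_le_finrank

instance [FiniteDimensional 𝔽 M] {ι : Type*} (u : ι → Module.Dual 𝔽 M) (J : Finset ι) (s : ℕ) :
    FiniteDimensional 𝔽 (commonKernel u J s) :=
  Submodule.finiteDimensional_of_le (inf_le_left : _ ≤ ⋀[𝔽]^s M)

/-- Contraction with u_b maps the common kernel of J in degree s+1 onto that of J ∪ {b} in degree s,
wedging with a_b being a section. Its kernel there is the common kernel of J ∪ {b} in degree s+1.
Rank-nullity then reproduces Pascal's rule. -/
lemma finrank_commonKernel [FiniteDimensional 𝔽 M] {ι : Type*} [DecidableEq ι]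
    (u : ι → Module.Dual 𝔽 M) (a : ι → M) (J : Finset ι)
    (h : ∀ i ∈ J, ∀ j ∈ J, u i (a j) = if i = j then 1 else 0) (s : ℕ) :
    Module.finrank 𝔽 (commonKernel u J s) = (Module.finrank 𝔽 M - J.card).choose s := by
  induction J using Finset.induction_on generalizing s with
  | empty =>
    have : commonKernel u ∅ s = ⋀[𝔽]^s M := by ext x; simp [mem_commonKernel]
    rw [this, exteriorPower.finrank_eq, Finset.card_empty, Nat.sub_zero]
  | insert b J hb ih =>
    have hJ : ∀ i ∈ J, ∀ j ∈ J, u i (a j) = if i = j then 1 else 0 := fun i hi j hj =>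
      h i (Finset.mem_insert_of_mem hi) j (Finset.mem_insert_of_mem hj)
    have hub : ∀ j ∈ J, u j (a b) = 0 := by
      intro j hj
      rw [h j (Finset.mem_insert_of_mem hj) b (Finset.mem_insert_self b J), if_neg]
      rintro rfl
      exact hb hj
    have hbb : u b (a b) = 1 := by
      rw [h b (Finset.mem_insert_self b J) b (Finset.mem_insert_self b J), if_pos rfl]
    have hcard := card_le_finrank_of_dual u a (insert b J) h
    rw [Finset.card_insert_of_notMem hb] at hcard ⊢
    induction s with
    | zero =>
      have : commonKernel u (insert b J) 0 = commonKernel u J 0 := by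
        ext x
        rw [mem_commonKernel, mem_commonKernel]
        exact ⟨fun hx => ⟨hx.1, fun j _ => contraction_of_mem_zero _ hx.1⟩,
          fun hx => ⟨hx.1, fun j _ => contraction_of_mem_zero _ hx.1⟩⟩
      rw [this, ih hJ]
      simp
    | succ s ihs =>
      have hmap : (commonKernel u J (s + 1)).map (contraction (u b)) =
          commonKernel u (insert b J) s := by
        ext y
        rw [Submodule.mem_map, mem_commonKernel]
        constructor
        · rintro ⟨x, hx, rfl⟩
          rw [mem_commonKernel] at hx
          refine ⟨contraction_mem _ _ hx.1, fun j hj => ?_⟩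
          rcases Finset.mem_insert.1 hj with rfl | hj
          · exact contraction_contraction _ _
          · rw [contraction_comm, hx.2 j hj, map_zero, neg_zero]
        · rintro ⟨hy, hy'⟩
          refine ⟨ExteriorAlgebra.ι 𝔽 (a b) * y, mem_commonKernel.2 ⟨ι_mul_mem _ hy,
            fun j hj => ?_⟩, ?_⟩
          · rw [contraction_ι_mul, hub j hj, zero_smul, hy' j (Finset.mem_insert_of_mem hj),
              mul_zero, sub_zero]
          · rw [contraction_ι_mul, hbb, one_smul, hy' b (Finset.mem_insert_self b J), mul_zero,
              sub_zero]
      have hker : commonKernel u J (s + 1) ⊓ LinearMap.ker (contraction (u b)) =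
          commonKernel u (insert b J) (s + 1) := by
        ext x
        rw [Submodule.mem_inf, mem_commonKernel, mem_commonKernel, LinearMap.mem_ker,
          Finset.forall_mem_insert]
        tauto
      have hrn := finrank_map_add_finrank_inf_ker (contraction (u b)) (commonKernel u J (s + 1))
      rw [hmap, hker, ihs, ih hJ] at hrn
      obtain ⟨d, hd⟩ : ∃ d, Module.finrank 𝔽 M - J.card = d + 1 :=
        ⟨Module.finrank 𝔽 M - J.card - 1, by omega⟩
      have hd' : Module.finrank 𝔽 M - (J.card + 1) = d := by omega
      rw [hd, Nat.choose_succ_succ'] at hrn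
      rw [hd'] at hrn ⊢
      omega

/-- The combination `∑ a n ∧ W n` of elements of degree `t`. -/
def wedgeSum {N : ℕ} (a : Fin N → M) (t : ℕ) :
    (Fin N → ⋀[𝔽]^t M) →ₗ[𝔽] ExteriorAlgebra 𝔽 M :=
  ∑ n, (LinearMap.mulLeft 𝔽 (ExteriorAlgebra.ι 𝔽 (a n))).comp
    ((Submodule.subtype _).comp (LinearMap.proj n))

lemma wedgeSum_apply {N : ℕ} (a : Fin N → M) (t : ℕ) (W : Fin N → ⋀[𝔽]^t M) :
    wedgeSum a t W = ∑ n, ExteriorAlgebra.ι 𝔽 (a n) * (W n : ExteriorAlgebra 𝔽 M) := by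
  simp [wedgeSum]

lemma range_wedgeSum_le {N : ℕ} (a : Fin N → M) (t : ℕ) :
    LinearMap.range (wedgeSum (𝔽 := 𝔽) a t) ≤ ⋀[𝔽]^(t + 1) M := by
  rintro _ ⟨W, rfl⟩
  rw [wedgeSum_apply]
  exact Submodule.sum_mem _ fun n _ => ι_mul_mem _ (W n).2

instance [FiniteDimensional 𝔽 M] {N : ℕ} (a : Fin N → M) (t : ℕ) :
    FiniteDimensional 𝔽 (LinearMap.range (wedgeSum (𝔽 := 𝔽) a t)) :=
  Submodule.finiteDimensional_of_le (range_wedgeSum_le a t)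

/-- Eliminate one index at a time: vanishing of the contraction with u_b expresses w_b, up to a
multiple of a_b, through the a_j with j in J. Hence a_b ∧ w_b can be absorbed into the other terms.
-/
lemma eq_zero_of_sum_of_contraction_eq_zero {ι : Type*} [DecidableEq ι]
    (u : ι → Module.Dual 𝔽 M) (a : ι → M) (J : Finset ι)
    (h : ∀ i ∈ J, ∀ j ∈ J, u i (a j) = if i = j then 1 else 0)
    (w : ι → ExteriorAlgebra 𝔽 M)
    (hw : ∀ i ∈ J, contraction (u i) (∑ j ∈ J, ExteriorAlgebra.ι 𝔽 (a j) * w j) = 0) :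
    ∑ j ∈ J, ExteriorAlgebra.ι 𝔽 (a j) * w j = 0 := by
  induction J using Finset.induction_on generalizing w with
  | empty => simp
  | insert b J hb ih =>
    have hbJ : ∀ j ∈ J, u b (a j) = 0 := by
      intro j hj
      rw [h b (Finset.mem_insert_self b J) j (Finset.mem_insert_of_mem hj), if_neg]
      rintro rfl
      exact hb hj
    have hbb : u b (a b) = 1 := by
      rw [h b (Finset.mem_insert_self b J) b (Finset.mem_insert_self b J), if_pos rfl]
    have hcontr : contraction (u b) (∑ j ∈ J, ExteriorAlgebra.ι 𝔽 (a j) * w j) =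
        -∑ j ∈ J, ExteriorAlgebra.ι 𝔽 (a j) * contraction (u b) (w j) := by
      rw [map_sum, ← Finset.sum_neg_distrib]
      refine Finset.sum_congr rfl fun j hj => ?_
      rw [contraction_ι_mul, hbJ j hj, zero_smul, zero_sub]
    have hb0 := hw b (Finset.mem_insert_self b J)
    rw [Finset.sum_insert hb, map_add, contraction_ι_mul, hbb, one_smul, hcontr] at hb0
    have hwb : ExteriorAlgebra.ι 𝔽 (a b) * w b = ∑ j ∈ J, ExteriorAlgebra.ι 𝔽 (a j) *
        (-(ExteriorAlgebra.ι 𝔽 (a b) * contraction (u b) (w j))) := by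
      have h1 : w b = ExteriorAlgebra.ι 𝔽 (a b) * contraction (u b) (w b) +
          ∑ j ∈ J, ExteriorAlgebra.ι 𝔽 (a j) * contraction (u b) (w j) := by
        rw [← sub_eq_zero, ← hb0]
        abel
      conv_lhs => rw [h1]
      rw [mul_add, ι_mul_self_mul, zero_add, Finset.mul_sum]
      refine Finset.sum_congr rfl fun j _ => ?_
      rw [ι_mul_ι_mul, mul_neg]
    have hsum : ∑ j ∈ insert b J, ExteriorAlgebra.ι 𝔽 (a j) * w j =
        ∑ j ∈ J, ExteriorAlgebra.ι 𝔽 (a j) *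
          (-(ExteriorAlgebra.ι 𝔽 (a b) * contraction (u b) (w j)) + w j) := by
      rw [Finset.sum_insert hb, hwb, ← Finset.sum_add_distrib]
      exact Finset.sum_congr rfl fun j _ => (mul_add _ _ _).symm
    rw [hsum] at hw ⊢
    exact ih (fun i hi j hj => h i (Finset.mem_insert_of_mem hi) j (Finset.mem_insert_of_mem hj))
      _ fun i hi => hw i (Finset.mem_insert_of_mem hi)

/-- Within degree t+1 the range is a complement of the common kernel of the dual functionals, whose
dimension is known. -/
lemma finrank_range_wedgeSum [FiniteDimensional 𝔽 M] {N : ℕ} (u : Fin N → Module.Dual 𝔽 M)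
    (a : Fin N → M) (h : ∀ i j, u i (a j) = if i = j then 1 else 0) (t : ℕ) :
    Module.finrank 𝔽 (LinearMap.range (wedgeSum (𝔽 := 𝔽) a t)) +
      (Module.finrank 𝔽 M - N).choose (t + 1) = (Module.finrank 𝔽 M).choose (t + 1) := by
  classical
  set Rg := LinearMap.range (wedgeSum (𝔽 := 𝔽) a t)
  set Kr := commonKernel u Finset.univ (t + 1)
  have hKr : Module.finrank 𝔽 Kr = (Module.finrank 𝔽 M - N).choose (t + 1) := by
    rw [finrank_commonKernel u a Finset.univ fun i _ j _ => h i j, Finset.card_fin]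
  have hinf : Rg ⊓ Kr = ⊥ := by
    rw [eq_bot_iff]
    rintro x ⟨⟨W, rfl⟩, hx⟩
    rw [SetLike.mem_coe, mem_commonKernel] at hx
    rw [wedgeSum_apply] at hx ⊢
    exact (Submodule.mem_bot _).2 (eq_zero_of_sum_of_contraction_eq_zero u a Finset.univ
      (fun i _ j _ => h i j) _ hx.2)
  have hsup : Rg ⊔ Kr = ⋀[𝔽]^(t + 1) M := by
    refine le_antisymm (sup_le (range_wedgeSum_le a t) inf_le_left) fun x hx => ?_
    have hstep : ∀ J : Finset (Fin N), x ∈ Rg ⊔ commonKernel u J (t + 1) := by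
      intro J
      induction J using Finset.induction_on with
      | empty =>
        refine Submodule.mem_sup_right (mem_commonKernel.2 ⟨hx, by simp⟩)
      | insert b J hb ih =>
        obtain ⟨r, hr, y, hy, rfl⟩ := Submodule.mem_sup.1 ih
        rw [mem_commonKernel] at hy
        -- Contraction is an antiderivation and u_b(a_b) = 1, so y splits into a multiple of a_b and
        -- an element killed by u_b. Both parts keep the annihilation already obtained where it is
        -- needed.
        have hdec : y = ExteriorAlgebra.ι 𝔽 (a b) * contraction (u b) y +
            contraction (u b) (ExteriorAlgebra.ι 𝔽 (a b) * y) := by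
          rw [contraction_ι_mul, h b b, if_pos rfl, one_smul]
          abel
        have hmem : ExteriorAlgebra.ι 𝔽 (a b) * contraction (u b) y ∈ Rg := by
          refine ⟨Pi.single b ⟨contraction (u b) y, contraction_mem _ _ hy.1⟩, ?_⟩
          rw [wedgeSum_apply, Finset.sum_eq_single b]
          · simp
          · intro n _ hn
            simp [Pi.single_eq_of_ne hn]
          · simp
        rw [hdec, ← add_assoc]
        refine Submodule.add_mem_sup (Submodule.add_mem _ hr hmem) (mem_commonKernel.2
          ⟨contraction_mem _ _ (ι_mul_mem _ hy.1), fun j hj => ?_⟩)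
        rcases Finset.mem_insert.1 hj with rfl | hj'
        · exact contraction_contraction _ _
        · have hjb : j ≠ b := by rintro rfl; exact hb hj'
          rw [contraction_comm, contraction_ι_mul, h j b, if_neg hjb, hy.2 j hj']
          simp
    exact hstep Finset.univ
  have := Submodule.finrank_sup_add_finrank_inf_eq Rg Kr
  rw [hinf, hsup, finrank_bot, add_zero, exteriorPower.finrank_eq, hKr] at this
  exact this.symm

end Exterior

/-! ### Private schemes from exterior powers -/

lemma exists_submodule_finrank_eq {𝔽 V : Type*} [Field 𝔽] [AddCommGroup V] [Module 𝔽 V]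
    [FiniteDimensional 𝔽 V] (B : Submodule 𝔽 V) (d : ℕ) (hd : d ≤ Module.finrank 𝔽 B) :
    ∃ C ≤ B, Module.finrank 𝔽 C = d := by
  induction d with
  | zero => exact ⟨⊥, bot_le, finrank_bot 𝔽 V⟩
  | succ d ih =>
    obtain ⟨C, hCB, hC⟩ := ih (by omega)
    have hlt : C < B := lt_of_le_of_ne hCB (by rintro rfl; omega)
    obtain ⟨v, hvB, hvC⟩ := SetLike.exists_of_lt hlt
    refine ⟨C ⊔ Submodule.span 𝔽 {v}, sup_le hCB ?_, ?_⟩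
    · rw [Submodule.span_le]
      simpa using hvB
    · rw [Submodule.finrank_sup_span_singleton hvC, hC]

/-- Used to compress the transmission to exactly m bits, losing only directions in `B` that no
chosen virtual user needs. -/
lemma exists_surjective_ker_le {𝔽 V : Type*} [Field 𝔽] [AddCommGroup V] [Module 𝔽 V]
    [FiniteDimensional 𝔽 V] (B : Submodule 𝔽 V) (m : ℕ) (hm : m ≤ Module.finrank 𝔽 V)
    (hB : Module.finrank 𝔽 V ≤ m + Module.finrank 𝔽 B) :
    ∃ φ : V →ₗ[𝔽] (Fin m → 𝔽), Function.Surjective φ ∧ LinearMap.ker φ ≤ B := by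
  obtain ⟨C, hCB, hC⟩ := exists_submodule_finrank_eq B (Module.finrank 𝔽 V - m) (by omega)
  have hq : Module.finrank 𝔽 (V ⧸ C) = Module.finrank 𝔽 (Fin m → 𝔽) := by
    have := Submodule.finrank_quotient_add_finrank C
    rw [Module.finrank_fin_fun]
    omega
  refine ⟨(LinearEquiv.ofFinrankEq _ _ hq).toLinearMap.comp C.mkQ, ?_, ?_⟩
  · exact (LinearEquiv.ofFinrankEq _ _ hq).surjective.comp C.mkQ_surjective
  · rw [LinearEquiv.ker_comp, Submodule.ker_mkQ]
    exact hCB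

lemma exists_surjective_factor {𝔽 V W : Type*} [Field 𝔽] [AddCommGroup V] [Module 𝔽 V]
    [FiniteDimensional 𝔽 V] [AddCommGroup W] [Module 𝔽 W] (f : V →ₗ[𝔽] W) (g : ℕ)
    (hg : Module.finrank 𝔽 (LinearMap.range f) = g) :
    ∃ (κ : V →ₗ[𝔽] (Fin g → 𝔽)) (ρ : (Fin g → 𝔽) →ₗ[𝔽] W), Function.Surjective κ ∧
      Function.Injective ρ ∧ ∀ v, ρ (κ v) = f v := by
  have hq : Module.finrank 𝔽 (LinearMap.range f) = Module.finrank 𝔽 (Fin g → 𝔽) := by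
    rw [Module.finrank_fin_fun, hg]
  let e := LinearEquiv.ofFinrankEq _ _ hq
  refine ⟨e.toLinearMap.comp f.rangeRestrict, (Submodule.subtype _).comp e.symm.toLinearMap,
    e.surjective.comp f.surjective_rangeRestrict,
    Subtype.val_injective.comp e.symm.injective, fun v => ?_⟩
  simp

lemma exists_factor_of_ker_le {𝔽 V W U : Type*} [Field 𝔽] [AddCommGroup V] [Module 𝔽 V]
    [AddCommGroup W] [Module 𝔽 W] [AddCommGroup U] [Module 𝔽 U] (φ : V →ₗ[𝔽] W)
    (hφ : Function.Surjective φ) (f : V →ₗ[𝔽] U) (h : LinearMap.ker φ ≤ LinearMap.ker f) :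
    ∃ θ : W →ₗ[𝔽] U, ∀ v, θ (φ v) = f v := by
  obtain ⟨r, hr⟩ := φ.exists_rightInverse_of_surjective (LinearMap.range_eq_top.2 hφ)
  refine ⟨f.comp r, fun v => ?_⟩
  have h1 : r (φ v) - v ∈ LinearMap.ker φ := by
    rw [LinearMap.mem_ker, map_sub, sub_eq_zero]
    exact LinearMap.congr_fun hr (φ v)
  have h2 := h h1
  rw [LinearMap.mem_ker, map_sub, sub_eq_zero] at h2
  exact h2

section

variable {𝔽 M : Type} [Field 𝔽] [AddCommGroup M] [Module 𝔽 M]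

/-- The contents of the cache and the transmission can be prescribed independently. -/
lemma exists_wedgeSum_eq {N : ℕ} (u : Module.Dual 𝔽 M) (a : Fin N → M) (d : Fin N)
    (hu : ∀ n, u (a n) = if n = d then 1 else 0) (t : ℕ) (U : Fin N → ⋀[𝔽]^t M) :
    ∃ V : Fin N → ⋀[𝔽]^t M, (∀ n, contraction u (V n : ExteriorAlgebra 𝔽 M) = 0) ∧
      wedgeSum a t V = wedgeSum a t U := by
  classical
  have hmem : ∀ n, contraction u (ExteriorAlgebra.ι 𝔽 (a d) * (U n : ExteriorAlgebra 𝔽 M)) ∈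
      ⋀[𝔽]^t M := fun n => contraction_mem _ _ (ι_mul_mem _ (U n).2)
  have hmem' : ∀ n, ExteriorAlgebra.ι 𝔽 (a n) * contraction u (U n : ExteriorAlgebra 𝔽 M) ∈
      ⋀[𝔽]^t M := by
    intro n
    cases t with
    | zero => rw [contraction_of_mem_zero u (U n).2, mul_zero]; exact Submodule.zero_mem _
    | succ t => exact ι_mul_mem _ (contraction_mem _ _ (U n).2)
  have hsplit : ∀ n, (U n : ExteriorAlgebra 𝔽 M) =
      contraction u (ExteriorAlgebra.ι 𝔽 (a d) * (U n : ExteriorAlgebra 𝔽 M)) +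
      ExteriorAlgebra.ι 𝔽 (a d) * contraction u (U n : ExteriorAlgebra 𝔽 M) := by
    intro n
    rw [contraction_ι_mul, hu, if_pos rfl, one_smul]
    abel
  let V₀ : Fin N → ⋀[𝔽]^t M := fun n => ⟨_, hmem n⟩
  -- The part a_d ∧ u(U_n) of each coordinate is not killed by u. For n ≠ d it is moved to
  -- coordinate d by a_n ∧ a_d = -(a_d ∧ a_n); for n = d it contributes nothing, as a_d ∧ a_d = 0.
  let Q : ⋀[𝔽]^t M := ∑ n ∈ Finset.univ.erase d, ⟨_, hmem' n⟩
  have hQ : (Q : ExteriorAlgebra 𝔽 M) = ∑ n ∈ Finset.univ.erase d,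
      ExteriorAlgebra.ι 𝔽 (a n) * contraction u (U n : ExteriorAlgebra 𝔽 M) := by
    simp [Q]
  refine ⟨V₀ - Pi.single d Q, fun n => ?_, ?_⟩
  · have h0 : contraction u (V₀ n : ExteriorAlgebra 𝔽 M) = 0 := contraction_contraction _ _
    rw [Pi.sub_apply, Submodule.coe_sub, map_sub, h0, zero_sub, neg_eq_zero]
    by_cases hn : n = d
    · subst hn
      rw [Pi.single_eq_same, hQ, map_sum]
      refine Finset.sum_eq_zero fun i hi => ?_
      rw [contraction_ι_mul, hu, if_neg (Finset.ne_of_mem_erase hi), zero_smul,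
        contraction_contraction, mul_zero, sub_zero]
    · rw [Pi.single_eq_of_ne hn]
      simp
  · rw [map_sub, wedgeSum_apply, wedgeSum_apply, wedgeSum_apply]
    have h1 : ∑ n, ExteriorAlgebra.ι 𝔽 (a n) * ((Pi.single d Q : Fin N → ⋀[𝔽]^t M) n :
        ExteriorAlgebra 𝔽 M) = ExteriorAlgebra.ι 𝔽 (a d) * Q := by
      rw [Finset.sum_eq_single d]
      · rw [Pi.single_eq_same]
      · intro n _ hn
        rw [Pi.single_eq_of_ne hn]
        simp
      · simp
    have h2 : ∑ n, ExteriorAlgebra.ι 𝔽 (a n) * (U n : ExteriorAlgebra 𝔽 M) =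
        ∑ n, ExteriorAlgebra.ι 𝔽 (a n) * (V₀ n : ExteriorAlgebra 𝔽 M) +
        ∑ n, ExteriorAlgebra.ι 𝔽 (a n) * (ExteriorAlgebra.ι 𝔽 (a d) *
          contraction u (U n : ExteriorAlgebra 𝔽 M)) := by
      rw [← Finset.sum_add_distrib]
      refine Finset.sum_congr rfl fun n _ => ?_
      rw [← mul_add]
      congr 1
      exact hsplit n
    rw [h1, h2, hQ, ← Finset.add_sum_erase _ (fun n => ExteriorAlgebra.ι 𝔽 (a n) *
      (ExteriorAlgebra.ι 𝔽 (a d) * contraction u (U n : ExteriorAlgebra 𝔽 M)))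
      (Finset.mem_univ d), ι_mul_self_mul, zero_add,
      Finset.mul_sum, sub_eq_add_neg, ← Finset.sum_neg_distrib]
    congr 1
    exact Finset.sum_congr rfl fun n _ => (ι_mul_ι_mul _ _ _).symm

end

/-- The cache size is the rank of contraction with one functional in degree t. The bounds on m say
that the transmission ∑ a_n ∧ W_n can be reduced to m bits modulo elements killed by the
contractions of all chosen virtual users. -/
lemma exists_linearScheme {N K : ℕ} [NeZero N] {M : Type} [AddCommGroup M] [Module (ZMod 2) M]
    [FiniteDimensional (ZMod 2) M] (t m : ℕ) (u : Fin K → Fin N → Module.Dual (ZMod 2) M)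
    (a : Demands N K → Fin N → M)
    (hu : ∀ σ k x n, u k x (a σ n) = if n = x + σ k then 1 else 0)
    (hm : ∀ σ, m ≤ Module.finrank (ZMod 2) (LinearMap.range (wedgeSum (𝔽 := ZMod 2) (a σ) t)))
    (hm' : ∀ σ (j : Demands N K), Module.finrank (ZMod 2) (LinearMap.range (wedgeSum (𝔽 := ZMod 2) (a σ) t)) ≤
      m + Module.finrank (ZMod 2) (LinearMap.range (wedgeSum (𝔽 := ZMod 2) (a σ) t) ⊓
        ⨅ k, LinearMap.ker (contraction (u k (j k))) : Submodule _ _)) :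
    Nonempty (LinearScheme N K m ((Module.finrank (ZMod 2) M).choose t -
      (Module.finrank (ZMod 2) M - 1).choose t) (⋀[ZMod 2]^t M)) := by
  classical
  have hcache : ∀ k x, ∃ (κ : ⋀[ZMod 2]^t M →ₗ[ZMod 2] (Fin ((Module.finrank (ZMod 2) M).choose t -
      (Module.finrank (ZMod 2) M - 1).choose t) → ZMod 2))
      (ρ : _ →ₗ[ZMod 2] ExteriorAlgebra (ZMod 2) M), Function.Surjective κ ∧
      Function.Injective ρ ∧ ∀ v, ρ (κ v) =
        ((contraction (u k x)).domRestrict (⋀[ZMod 2]^t M)) v := by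
    intro k x
    refine exists_surjective_factor _ _ ?_
    have h1 := finrank_map_add_finrank_inf_ker (contraction (u k x)) (⋀[ZMod 2]^t M)
    have h2 := finrank_commonKernel (fun _ : Unit => u k x) (fun _ => a 0 (x + 0)) Finset.univ
      (fun _ _ _ _ => by simp [hu]) t
    have h3 : commonKernel (fun _ : Unit => u k x) Finset.univ t =
        ⋀[ZMod 2]^t M ⊓ LinearMap.ker (contraction (u k x)) := by
      ext y
      simp [mem_commonKernel]
    rw [h3] at h2
    rw [LinearMap.range_domRestrict]
    rw [exteriorPower.finrank_eq, h2] at h1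
    simp only [Finset.card_univ, Fintype.card_unit] at h1
    omega
  choose κ ρ hκ hρ hρκ using hcache
  have htrans : ∀ σ (j : Demands N K),
      ∃ φ : LinearMap.range (wedgeSum (𝔽 := ZMod 2) (a σ) t) →ₗ[ZMod 2] (Fin m → ZMod 2),
      Function.Surjective φ ∧ LinearMap.ker φ ≤
        Submodule.comap (Submodule.subtype _) (⨅ k, LinearMap.ker (contraction (u k (j k)))) := by
    intro σ j
    refine exists_surjective_ker_le _ m (hm σ) ((hm' σ j).trans (Nat.add_le_add_left ?_ m))
    rw [← (Submodule.comapSubtypeEquivOfLe (inf_le_left : LinearMap.range (wedgeSum (𝔽 := ZMod 2) (a σ) t) ⊓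
      (⨅ k, LinearMap.ker (contraction (u k (j k)))) ≤ _)).finrank_eq, Submodule.comap_inf,
      Submodule.comap_subtype_self, top_inf_eq]
  choose φ hφ hφker using htrans
  have hcontr : ∀ σ k x, ∀ r ∈ LinearMap.range (wedgeSum (𝔽 := ZMod 2) (a σ) t),
      contraction (u k x) r ∈ ⋀[ZMod 2]^t M := fun σ k x r hr =>
    contraction_mem _ _ (range_wedgeSum_le _ _ hr)
  have hout : ∀ σ (j : Demands N K) k, ∃ θ : (Fin m → ZMod 2) →ₗ[ZMod 2] ⋀[ZMod 2]^t M,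
      ∀ r, θ (φ σ j r) = ((contraction (u k (j k))).restrict (hcontr σ k (j k))) r := by
    intro σ j k
    refine exists_factor_of_ker_le _ (hφ σ j) _ fun r hr => ?_
    have h1 := hφker σ j hr
    rw [Submodule.mem_comap, Submodule.mem_iInf] at h1
    exact Subtype.ext (h1 k)
  choose θ hθ using hout
  let Y : Demands N K → Demands N K → (Fin N → ⋀[ZMod 2]^t M) →ₗ[ZMod 2] (Fin m → ZMod 2) :=
    fun σ j => (φ σ j).comp (wedgeSum (𝔽 := ZMod 2) (a σ) t).rangeRestrict
  have hθY : ∀ σ j k W, (θ σ j k (Y σ j W) : ExteriorAlgebra (ZMod 2) M) =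
      contraction (u k (j k)) (wedgeSum (a σ) t W) := by
    intro σ j k W
    exact congrArg Subtype.val (hθ σ j k _)
  have hdecode : ∀ σ (j : Demands N K) k W, contraction (u k (j k)) (wedgeSum (a σ) t W) =
      (W (j k + σ k) : ExteriorAlgebra (ZMod 2) M) -
        ∑ n, ExteriorAlgebra.ι (ZMod 2) (a σ n) * ρ k (j k) (κ k (j k) (W n)) := by
    intro σ j k W
    rw [wedgeSum_apply, map_sum]
    simp only [contraction_ι_mul, hu, Finset.sum_sub_distrib, hρκ, LinearMap.domRestrict_apply]
    congr 1
    rw [Finset.sum_eq_single (j k + σ k)]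
    · rw [if_pos rfl, one_smul]
    · intro n _ hn
      rw [if_neg hn, zero_smul]
    · simp
  -- The default 0 is harmless: for contents of actual caches, `hdecode` shows the sum to be a
  -- difference of elements of degree t.
  refine ⟨⟨κ, Y, θ, fun σ k x C =>
    if h : ∑ n, ExteriorAlgebra.ι (ZMod 2) (a σ n) * ρ k x (C n) ∈ ⋀[ZMod 2]^t M then ⟨_, h⟩ else 0,
    ?_, ?_, ?_⟩⟩
  · intro σ j k c y
    choose W₀ hW₀ using fun n => hκ k (j k) (c n)
    obtain ⟨⟨_, W₁, rfl⟩, hW₁⟩ := hφ σ j y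
    obtain ⟨V, hV, hVeq⟩ := exists_wedgeSum_eq (u k (j k)) (a σ) (j k + σ k) (hu σ k (j k)) t
      (W₁ - W₀)
    refine ⟨W₀ + V, fun n => ?_, ?_⟩
    · refine hρ k (j k) ?_
      rw [← hW₀ n, hρκ, hρκ]
      simp [hV]
    · rw [← hW₁]
      have : wedgeSum (a σ) t (W₀ + V) = wedgeSum (a σ) t W₁ := by
        rw [map_add, hVeq, map_sub]
        abel
      exact congrArg (φ σ j) (Subtype.ext this)
  -- Contracting twice gives 0, so decoder outputs lie in the kernel; conversely a kernel element
  -- placed as the demanded file, all others zero, is its own output. The kernel sees j only through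
  -- j k, which is what privacy needs.
  · have hrange : ∀ σ (j : Demands N K) k, LinearMap.range (θ σ j k) =
        LinearMap.ker ((contraction (u k (j k))).domRestrict (⋀[ZMod 2]^t M)) := by
      intro σ j k
      ext z
      constructor
      · rintro ⟨v, rfl⟩
        obtain ⟨r, rfl⟩ := hφ σ j v
        rw [LinearMap.mem_ker, LinearMap.domRestrict_apply, hθ]
        exact contraction_contraction _ _
      · intro hz
        rw [LinearMap.mem_ker, LinearMap.domRestrict_apply] at hz
        refine ⟨Y σ j (Pi.single (j k + σ k) z), Subtype.ext ?_⟩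
        rw [hθY, wedgeSum_apply, Finset.sum_eq_single (j k + σ k)]
        · rw [Pi.single_eq_same, contraction_ι_mul, hu, if_pos rfl, one_smul, hz, mul_zero,
            sub_zero]
        · intro n _ hn
          rw [Pi.single_eq_of_ne hn]
          simp
        · simp
    intro σ j j' k h
    rw [hrange, hrange, h]
  · intro σ j k W
    have h1 := hdecode σ j k W
    rw [← hθY] at h1
    have h2 : ∑ n, ExteriorAlgebra.ι (ZMod 2) (a σ n) * ρ k (j k) (κ k (j k) (W n)) =
        ((W (j k + σ k) - θ σ j k (Y σ j W) : ⋀[ZMod 2]^t M) : ExteriorAlgebra (ZMod 2) M) := by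
      rw [Submodule.coe_sub, h1]
      abel
    have h3 : ∑ n, ExteriorAlgebra.ι (ZMod 2) (a σ n) * ρ k (j k) (κ k (j k) (W n)) ∈
        ⋀[ZMod 2]^t M := h2 ▸ Subtype.coe_prop _
    rw [dif_pos h3]
    refine Subtype.ext ?_
    rw [Submodule.coe_add]
    simp only [h2]
    rw [Submodule.coe_sub]
    abel

lemma mem_uniformRegion_of_dual {N K : ℕ} [NeZero N] {M : Type} [AddCommGroup M]
    [Module (ZMod 2) M] [Finite M] (n t m : ℕ) (hn : Module.finrank (ZMod 2) M = n)
    (hn0 : 0 < n) (htn : t ≤ n)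
    (u : Fin K → Fin N → Module.Dual (ZMod 2) M) (a : Demands N K → Fin N → M)
    (hu : ∀ σ k x n, u k x (a σ n) = if n = x + σ k then 1 else 0)
    (hm : ∀ σ, m ≤ Module.finrank (ZMod 2) (LinearMap.range (wedgeSum (𝔽 := ZMod 2) (a σ) t)))
    (hm' : ∀ σ (j : Demands N K), Module.finrank (ZMod 2) (LinearMap.range (wedgeSum (𝔽 := ZMod 2) (a σ) t)) ≤
      m + Module.finrank (ZMod 2) (LinearMap.range (wedgeSum (𝔽 := ZMod 2) (a σ) t) ⊓
        ⨅ k, LinearMap.ker (contraction (u k (j k))) : Submodule _ _)) :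
    ((N : ℝ) * t / n, (m : ℝ) / n.choose t) ∈ uniformRegion N K := by
  have : FiniteDimensional (ZMod 2) M := Module.Finite.of_finite
  have : Finite (⋀[ZMod 2]^t M) := Module.finite_of_finite (ZMod 2)
  obtain ⟨c⟩ := exists_linearScheme t m u a hu hm hm'
  have hpos : 0 < n.choose t := Nat.choose_pos htn
  have h := c.mem_uniformRegion (n.choose t) (by rw [exteriorPower.finrank_eq, hn]) hpos
  -- A cache keeps the fraction t/n of each file.
  have hg : ((n.choose t - (n - 1).choose t : ℕ) : ℝ) * n = t * n.choose t := by
    obtain ⟨n, rfl⟩ : ∃ n', n = n' + 1 := ⟨n - 1, by omega⟩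
    cases t with
    | zero => simp
    | succ t =>
      rw [Nat.add_sub_cancel, Nat.choose_succ_succ', Nat.add_sub_cancel]
      have := Nat.add_one_mul_choose_eq n t
      rw [Nat.choose_succ_succ'] at this
      have h' : (((n + 1) * n.choose t : ℕ) : ℝ) =
        (((n.choose t + n.choose (t + 1)) * (t + 1) : ℕ) : ℝ) := congrArg _ this
      push_cast at h' ⊢
      linarith
  have hpos' : (0 : ℝ) < n.choose t := by exact_mod_cast hpos
  have hn' : (0 : ℝ) < n := by exact_mod_cast hn0
  rw [hn] at h
  convert h using 2
  rw [div_eq_div_iff hn'.ne' hpos'.ne']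
  linear_combination (-(N : ℝ)) * hg

/-- Virtual users that are independent of each other, for fewer users than files. -/
lemma level_mem_uniformRegion {N K : ℕ} (hK : 1 ≤ K) (hKN : K ≤ N) {t : ℕ} (ht : t ≤ N * K) :
    ((N : ℝ) * t / (N * K : ℕ), ((N * K).choose (t + 1) - (N * K - K).choose (t + 1) : ℝ) /
      (N * K).choose t) ∈ uniformRegion N K := by
  classical
  have : NeZero N := ⟨by omega⟩
  let M := Fin K × Fin N → ZMod 2
  have hM : Module.finrank (ZMod 2) M = N * K := by
    rw [Module.finrank_fintype_fun_eq_card, Fintype.card_prod, Fintype.card_fin, Fintype.card_fin,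
      mul_comm]
  let u : Fin K → Fin N → Module.Dual (ZMod 2) M := fun k x => LinearMap.proj (k, x)
  let a : Demands N K → Fin N → M := fun σ n p => if n = p.2 + σ p.1 then 1 else 0
  have hu : ∀ σ k x n, u k x (a σ n) = if n = x + σ k then 1 else 0 := fun _ _ _ _ => rfl
  have hle : (N * K - K).choose (t + 1) ≤ (N * K).choose (t + 1) :=
    Nat.choose_le_choose _ (Nat.sub_le _ _)
  have hrange : ∀ σ, Module.finrank (ZMod 2) (LinearMap.range (wedgeSum (𝔽 := ZMod 2) (a σ) t)) +
      (N * K - N).choose (t + 1) = (N * K).choose (t + 1) := by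
    intro σ
    have h := finrank_range_wedgeSum (fun n => u ⟨0, hK⟩ (n - σ ⟨0, hK⟩)) (a σ) (fun i j => by
      rw [hu, sub_add_cancel]
      exact if_congr eq_comm rfl rfl) t
    rwa [hM] at h
  rw [← Nat.cast_sub hle]
  refine mem_uniformRegion_of_dual (N * K) t _ hM (Nat.mul_pos (by omega) (by omega)) ht u a hu (fun σ => ?_)
    (fun σ j => ?_)
  · have h1 := hrange σ
    -- This is where K ≤ N enters: the reduced transmission is no longer than the full one.
    have h2 : (N * K - N).choose (t + 1) ≤ (N * K - K).choose (t + 1) :=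
      Nat.choose_le_choose _ (by omega)
    omega
  · let v : Fin K → M := fun k => Pi.single (k, j k) 1
    have hv : ∀ i k, u i (j i) (v k) = if i = k then 1 else 0 := by
      intro i k
      change (Pi.single (k, j k) 1 : Fin K × Fin N → ZMod 2) (i, j i) = _
      by_cases h : i = k
      · subst h; simp
      · have : ((i, j i) : Fin K × Fin N) ≠ (k, j k) := fun e => h (congrArg Prod.fst e)
        simp [this, h]
    have hker := finrank_commonKernel (fun k => u k (j k)) v Finset.univ
      (fun i _ k _ => hv i k) (t + 1)
    rw [hM, Finset.card_fin] at hker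
    set Rg := LinearMap.range (wedgeSum (𝔽 := ZMod 2) (a σ) t)
    set Kr := commonKernel (fun k => u k (j k)) Finset.univ (t + 1)
    -- Both subspaces lie in degree t+1, so their dimensions force an intersection large enough to
    -- drop.
    have hsum := Submodule.finrank_sup_add_finrank_inf_eq Rg Kr
    have hsup : Module.finrank (ZMod 2) (Rg ⊔ Kr : Submodule _ _) ≤ (N * K).choose (t + 1) := by
      rw [← hM, ← exteriorPower.finrank_eq]
      exact Submodule.finrank_mono (sup_le (range_wedgeSum_le _ _) inf_le_left)
    have hinf : Module.finrank (ZMod 2) (Rg ⊓ Kr : Submodule _ _) ≤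
        Module.finrank (ZMod 2)
          (Rg ⊓ ⨅ k, LinearMap.ker (contraction (u k (j k))) : Submodule _ _) := by
      have : FiniteDimensional (ZMod 2)
          (Rg ⊓ ⨅ k, LinearMap.ker (contraction (u k (j k))) : Submodule _ _) :=
        Submodule.finiteDimensional_of_le (inf_le_left : _ ≤ Rg)
      refine Submodule.finrank_mono (inf_le_inf_left _ ?_)
      exact le_iInf fun k => inf_le_right.trans (iInf₂_le k (Finset.mem_univ k))
    omega

/-- The virtual users of each user sum to the same functional, and all the files are leaders. -/
lemma pointsA_subset_uniformRegion {N K : ℕ} (hN : 1 ≤ N) (hK : 1 ≤ K) :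
    pointsA N K ⊆ uniformRegion N K := by
  classical
  rintro _ ⟨U, hU, t, ht, rfl⟩
  have : NeZero N := ⟨by omega⟩
  obtain ⟨K, rfl⟩ : ∃ K', K = K' + 1 := ⟨K - 1, by omega⟩
  let L : (Fin (K + 1) → Fin N → ZMod 2) →ₗ[ZMod 2] (Fin K → ZMod 2) :=
    { toFun := fun y i => ∑ x, (y i.succ x - y 0 x)
      map_add' := fun y z => by
        funext i
        simp only [Pi.add_apply, ← Finset.sum_add_distrib]
        exact Finset.sum_congr rfl fun x _ => by ring
      map_smul' := fun r y => by
        funext i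
        simp only [Pi.smul_apply, smul_eq_mul, RingHom.id_apply, Finset.mul_sum]
        exact Finset.sum_congr rfl fun x _ => by ring }
  have hL : ∀ y i, L y i = ∑ x, (y i.succ x - y 0 x) := fun _ _ => rfl
  -- Arrays whose rows all have the same sum: K independent conditions for K + 1 rows, hence
  -- dimension U. Every a_n qualifies, its rows each containing a single 1.
  let M := LinearMap.ker L
  have hM : Module.finrank (ZMod 2) M = U := by
    have hsurj : LinearMap.range L = ⊤ := by
      refine LinearMap.range_eq_top.2 fun z => ?_
      refine ⟨Fin.cons 0 fun i => Pi.single 0 (z i), funext fun i => ?_⟩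
      rw [hL]
      simp
    have h := LinearMap.finrank_range_add_finrank_ker L
    rw [hsurj, finrank_top, Module.finrank_fin_fun, Module.finrank_pi_fintype] at h
    simp only [Module.finrank_fin_fun, Finset.sum_const, Finset.card_univ, Fintype.card_fin,
      smul_eq_mul] at h
    have h2 : N * (K + 1) = (K + 1) * N := mul_comm _ _
    have h3 : K + 1 ≤ N * (K + 1) := Nat.le_mul_of_pos_left _ hN
    change K + Module.finrank (ZMod 2) M = _ at h
    omega
  let u : Fin (K + 1) → Fin N → Module.Dual (ZMod 2) M := fun k x =>
    ((LinearMap.proj (R := ZMod 2) (φ := fun _ : Fin N => ZMod 2) x).comp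
      (LinearMap.proj (R := ZMod 2) (φ := fun _ : Fin (K + 1) => Fin N → ZMod 2) k)).comp
      M.subtype
  have hmem : ∀ (σ : Demands N (K + 1)) (n : Fin N),
      (fun k x => if n = x + σ k then 1 else 0 : Fin (K + 1) → Fin N → ZMod 2) ∈ M := by
    intro σ n
    have hsum : ∀ k, ∑ x, (if n = x + σ k then (1 : ZMod 2) else 0) = 1 := by
      intro k
      rw [Finset.sum_eq_single (n - σ k)]
      · simp
      · intro x _ hx
        rw [if_neg]
        rintro rfl
        exact hx (add_sub_cancel_right _ _).symm
      · simp
    refine LinearMap.mem_ker.2 (funext fun i => ?_)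
    rw [hL, Finset.sum_sub_distrib, hsum, hsum, sub_self]
    rfl
  let a : Demands N (K + 1) → Fin N → M := fun σ n => ⟨_, hmem σ n⟩
  have hu : ∀ σ k x n, u k x (a σ n) = if n = x + σ k then 1 else 0 := fun _ _ _ _ => rfl
  have hrange : ∀ σ, Module.finrank (ZMod 2) (LinearMap.range (wedgeSum (𝔽 := ZMod 2) (a σ) t)) +
      (U - N).choose (t + 1) = U.choose (t + 1) := by
    intro σ
    have h := finrank_range_wedgeSum (fun n => u 0 (n - σ 0)) (a σ) (fun i j => by
      rw [hu, sub_add_cancel]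
      exact if_congr eq_comm rfl rfl) t
    rwa [hM] at h
  have hle : (U - N).choose (t + 1) ≤ U.choose (t + 1) :=
    Nat.choose_le_choose _ (Nat.sub_le _ _)
  rw [← Nat.cast_sub hle]
  -- Here m is the full dimension of the range, so nothing has to be dropped from the transmission.
  refine mem_uniformRegion_of_dual U t _ hM (by omega) ht u a hu (fun σ => ?_) (fun σ j => ?_)
  · have := hrange σ
    omega
  · have := hrange σ
    omega

/-! ### Schemes B and C -/

lemma zero_mem_level {N K : ℕ} (hK : 1 ≤ K) (hKN : K ≤ N) :
    ((0 : ℝ), (K : ℝ)) ∈ uniformRegion N K := by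
  have h := level_mem_uniformRegion hK hKN (t := 0) (by omega)
  have hle : K ≤ N * K := Nat.le_mul_of_pos_left _ (by omega)
  simpa [Nat.cast_sub hle] using h

lemma full_mem_level {N K : ℕ} (hK : 1 ≤ K) (hKN : K ≤ N) :
    ((N : ℝ), (0 : ℝ)) ∈ uniformRegion N K := by
  have h := level_mem_uniformRegion hK hKN (t := N * K) le_rfl
  have h0 : (((N * K : ℕ) : ℝ)) ≠ 0 := by
    have : 0 < N * K := Nat.mul_pos (by omega) (by omega)
    exact_mod_cast this.ne'
  rw [mul_div_assoc, div_self h0, Nat.choose_eq_zero_of_lt (Nat.lt_succ_self _),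
    Nat.choose_eq_zero_of_lt (by omega : N * K - K < N * K + 1)] at h
  simpa using h

lemma pointsB_subset_uniformRegion {N K : ℕ} (hK : 1 ≤ K) (hKN : K ≤ N) :
    pointsB N K ⊆ uniformRegion N K := by
  rintro _ ⟨m, hm0, hmN, rfl⟩
  have hN : (0 : ℝ) < N := by exact_mod_cast (by omega : 0 < N)
  have h := convex_uniformRegion N K (zero_mem_level hK hKN) (full_mem_level hK hKN)
    (a := 1 - m / N) (b := m / N) (by rw [sub_nonneg, div_le_one hN]; exact hmN) (by positivity)
    (by ring)
  rw [min_eq_right (by exact_mod_cast hKN)]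
  convert h using 1
  refine Prod.ext ?_ ?_
  · simp [hN.ne']
  · simp [mul_comm]

/-- Each point of Scheme C is the average of the levels s = t, …, NK-1 with weights proportional to
binom(NK, s) r^(NK-s-1). -/
lemma pointsC_subset_uniformRegion {N K : ℕ} (hK : 1 ≤ K) (hKN : K ≤ N) :
    pointsC N K ⊆ uniformRegion N K := by
  rintro _ ⟨t, r, ht1, htn, hr, -, rfl⟩
  set n := N * K with hn
  have hr0 : 0 < r := by linarith
  have hpos : ∀ s ∈ Finset.Icc t (n - 1), 0 < (n.choose s : ℝ) * r ^ (n - s - 1) := by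
    intro s hs
    have := Finset.mem_Icc.1 hs
    have : 0 < n.choose s := Nat.choose_pos (by omega)
    positivity
  set S := ∑ s ∈ Finset.Icc t (n - 1), (n.choose s : ℝ) * r ^ (n - s - 1)
  have hS : 0 < S := Finset.sum_pos hpos ⟨t, Finset.mem_Icc.2 ⟨le_rfl, htn⟩⟩
  have h := (convex_uniformRegion N K).sum_mem (t := Finset.Icc t (n - 1))
    (w := fun s => (n.choose s : ℝ) * r ^ (n - s - 1) / S)
    (z := fun s => ((N : ℝ) * s / n, (n.choose (s + 1) - (n - K).choose (s + 1) : ℝ) / n.choose s))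
    (fun s hs => div_nonneg (hpos s hs).le hS.le) (by rw [← Finset.sum_div, div_self hS.ne'])
    (fun s hs => level_mem_uniformRegion hK hKN (by have := Finset.mem_Icc.1 hs; omega))
  convert h using 1
  refine Prod.ext ?_ ?_
  · simp only [Prod.fst_sum, Prod.smul_fst, smul_eq_mul]
    rw [Finset.mul_sum, Finset.sum_div]
    refine Finset.sum_congr rfl fun s hs => ?_
    have hs' := Finset.mem_Icc.1 hs
    have hn0 : (n : ℝ) ≠ 0 := by exact_mod_cast (by omega : n ≠ 0)
    have hch : (n : ℝ) * (n - 1).choose (s - 1) = n.choose s * s := by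
      have := Nat.add_one_mul_choose_eq (n - 1) (s - 1)
      rw [Nat.sub_add_cancel (by omega), Nat.sub_add_cancel (by omega)] at this
      exact_mod_cast this
    rw [div_mul_div_comm, div_eq_div_iff hS.ne' (mul_ne_zero hS.ne' hn0)]
    linear_combination (N * r ^ (n - s - 1) * S : ℝ) * hch
  · simp only [Prod.snd_sum, Prod.smul_snd, smul_eq_mul]
    rw [Finset.sum_div]
    have himg : Finset.Icc (t + 1) n = (Finset.Icc t (n - 1)).image (· + 1) := by
      rw [Finset.image_add_right_Icc, Nat.sub_add_cancel (by omega)]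
    rw [himg, Finset.sum_image (fun _ _ _ _ h => Nat.succ_injective h)]
    refine Finset.sum_congr rfl fun s hs => ?_
    have hs' := Finset.mem_Icc.1 hs
    have : (n.choose s : ℝ) ≠ 0 := by
      exact_mod_cast (Nat.choose_pos (by omega : s ≤ n)).ne'
    rw [Nat.sub_sub]
    field_simp

/-! ### Upper bounds on the envelopes -/

lemma envelope_le {A : Set (ℝ × ℝ)} (hA : ∀ x ∈ A, 0 ≤ x.2) {m R : ℝ}
    (h : (m, R) ∈ convexHull ℝ A) : lowerConvexEnvelope A m ≤ R := by
  refine csInf_le ⟨0, fun R' hR' => ?_⟩ h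
  have hconv : Convex ℝ {x : ℝ × ℝ | 0 ≤ x.2} := by
    intro x hx y hy a b ha hb _
    exact add_nonneg (mul_nonneg ha hx) (mul_nonneg hb hy)
  exact convexHull_min (t := {x : ℝ × ℝ | 0 ≤ x.2}) hA hconv hR'

lemma chord_mem {A : Set (ℝ × ℝ)} {m₁ m₂ R₁ R₂ : ℝ} (h₁ : (m₁, R₁) ∈ convexHull ℝ A)
    (h₂ : (m₂, R₂) ∈ convexHull ℝ A) {b : ℝ} (hb0 : 0 ≤ b) (hb1 : b ≤ 1) {m R : ℝ}
    (hm : m = (1 - b) * m₁ + b * m₂) (hR : R = (1 - b) * R₁ + b * R₂) :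
    (m, R) ∈ convexHull ℝ A := by
  have h := convex_convexHull ℝ A h₁ h₂ (sub_nonneg.2 hb1) hb0 (sub_add_cancel 1 b)
  rwa [Prod.smul_mk, Prod.smul_mk, Prod.mk_add_mk, smul_eq_mul, smul_eq_mul, smul_eq_mul,
    smul_eq_mul, ← hm, ← hR] at h

/-! ### Bounds for the envelope of Scheme A -/

section SchemeA

variable {N K : ℕ}

lemma le_userCount (hN : 1 ≤ N) (hK : 1 ≤ K) : N ≤ N * K - K + 1 := by
  obtain ⟨N, rfl⟩ : ∃ N', N = N' + 1 := ⟨N - 1, by omega⟩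
  obtain ⟨K, rfl⟩ : ∃ K', K = K' + 1 := ⟨K - 1, by omega⟩
  have h : (N + 1) * (K + 1) = N * K + N + (K + 1) := by ring
  rw [h, Nat.add_sub_cancel]
  have : 0 ≤ N * K := Nat.zero_le _
  omega

lemma pointsA_nonneg : ∀ x ∈ pointsA N K, 0 ≤ x.2 := by
  rintro _ ⟨U, -, r, -, rfl⟩
  refine div_nonneg (sub_nonneg.2 ?_) (by positivity)
  exact_mod_cast Nat.choose_le_choose _ (Nat.sub_le _ _)

lemma zero_mem_pointsA (hN : 1 ≤ N) (hK : 1 ≤ K) : ((0 : ℝ), (N : ℝ)) ∈ pointsA N K := by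
  refine ⟨_, rfl, 0, Nat.zero_le _, ?_⟩
  have := le_userCount hN hK
  simp [Nat.cast_sub this]

lemma full_mem_pointsA : ((N : ℝ), (0 : ℝ)) ∈ pointsA N K := by
  refine ⟨_, rfl, _, le_rfl, ?_⟩
  have h0 : ((N * K - K + 1 : ℕ) : ℝ) ≠ 0 := by positivity
  rw [mul_div_assoc, div_self h0, Nat.choose_eq_zero_of_lt (Nat.lt_succ_self _),
    Nat.choose_eq_zero_of_lt (by omega : N * K - K + 1 - N < N * K - K + 1 + 1)]
  simp

lemma rateA_le_linear (hN : 1 ≤ N) (hK : 1 ≤ K) {M : ℝ} (hM : 0 ≤ M) (hMN : M ≤ N) :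
    rateA N K M ≤ N - M := by
  have hN' : (0 : ℝ) < N := by exact_mod_cast hN
  rw [rateA, min_eq_left hMN]
  refine envelope_le pointsA_nonneg (chord_mem (subset_convexHull ℝ _ (zero_mem_pointsA hN hK))
    (subset_convexHull ℝ _ full_mem_pointsA) (b := M / N) (by positivity)
    ((div_le_one hN').2 hMN) ?_ ?_)
  · field_simp; ring
  · field_simp; ring

lemma rateA_le_zero {M : ℝ} (hMN : (N : ℝ) ≤ M) : rateA N K M ≤ 0 := by
  rw [rateA, min_eq_right hMN]
  exact envelope_le pointsA_nonneg (subset_convexHull ℝ _ full_mem_pointsA)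

lemma rateA_le_one_sub (hN : 1 ≤ N) {M : ℝ} (hMN : M ≤ N)
    (hM : (N : ℝ) * (N * K - K) / (N * K - K + 1) ≤ M) : rateA N K M ≤ 1 - M / N := by
  have hN' : (0 : ℝ) < N := by exact_mod_cast hN
  have hKle : K ≤ N * K := Nat.le_mul_of_pos_left _ hN
  set V := N * K - K with hV
  have hVr : (N * K - K : ℝ) = V := by rw [hV, Nat.cast_sub hKle]; push_cast; ring
  rw [hVr] at hM
  have hV1 : (0 : ℝ) < V + 1 := by positivity
  have hmem : ((N : ℝ) * V / (V + 1), (1 : ℝ) / (V + 1)) ∈ pointsA N K := by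
    refine ⟨V + 1, rfl, V, Nat.le_succ _, ?_⟩
    rw [Nat.choose_self, Nat.choose_eq_zero_of_lt (by omega : V + 1 - N < V + 1),
      Nat.choose_succ_self_right]
    push_cast
    simp
  rw [rateA, min_eq_left hMN]
  rw [div_le_iff₀ hV1] at hM
  refine envelope_le pointsA_nonneg (chord_mem (subset_convexHull ℝ _ hmem)
    (subset_convexHull ℝ _ full_mem_pointsA) (b := M * (V + 1) / N - V) ?_ ?_ ?_ ?_)
  · rw [sub_nonneg, le_div_iff₀ hN']; linarith
  · rw [sub_le_iff_le_add, div_le_iff₀ hN']; nlinarith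
  · field_simp; ring
  · field_simp; ring

lemma sum_binomial_weights (U : ℕ) (p : ℝ) :
    ∑ r ∈ Finset.range (U + 1), (U.choose r : ℝ) * p ^ r * (1 - p) ^ (U - r) = 1 := by
  have h := add_pow p (1 - p) U
  rw [add_sub_cancel, one_pow] at h
  refine Eq.trans (Finset.sum_congr rfl fun r _ => ?_) h.symm
  ring

lemma sum_binomial_mean (U : ℕ) (p : ℝ) :
    ∑ r ∈ Finset.range (U + 1), (U.choose r : ℝ) * p ^ r * (1 - p) ^ (U - r) * r = U * p := by
  cases U with
  | zero => simp
  | succ V =>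
    rw [Finset.sum_range_succ']
    simp only [Nat.cast_zero, mul_zero, add_zero]
    have hw := congrArg (fun x => ((V + 1 : ℕ) : ℝ) * p * x) (sum_binomial_weights V p)
    simp only [mul_one, Finset.mul_sum] at hw
    rw [← hw]
    refine Finset.sum_congr rfl fun r _ => ?_
    have h : ((V + 1 : ℕ) : ℝ) * V.choose r = (V + 1).choose (r + 1) * ((r + 1 : ℕ) : ℝ) := by
      exact_mod_cast Nat.add_one_mul_choose_eq V r
    rw [Nat.add_sub_add_right]
    linear_combination (-(p ^ (r + 1) * (1 - p) ^ (V - r))) * h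

/-- Average the points over a binomial r with parameters U and p = M/N. The denominators binom(U, r)
cancel, and the rate is at most (1-p)/p times the total binomial mass of r ≥ 1. -/
lemma rateA_le_ratio (hN : 1 ≤ N) {M : ℝ} (hM : 0 < M) (hMN : M ≤ N) :
    rateA N K M ≤ (N - M) / M := by
  have hN' : (0 : ℝ) < N := by exact_mod_cast hN
  set U := N * K - K + 1 with hU
  have hU0 : (U : ℝ) ≠ 0 := by rw [hU]; positivity
  set p : ℝ := M / N with hp
  have hp0 : 0 < p := by positivity
  have hq0 : 0 ≤ 1 - p := by rw [sub_nonneg, hp, div_le_one hN']; exact hMN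
  have hch : ∀ r ∈ Finset.range (U + 1), (U.choose r : ℝ) ≠ 0 := by
    intro r hr
    have := Finset.mem_range.1 hr
    exact_mod_cast (Nat.choose_pos (by omega : r ≤ U)).ne'
  have h := (convex_convexHull ℝ (pointsA N K)).sum_mem (t := Finset.range (U + 1))
    (w := fun r => (U.choose r : ℝ) * p ^ r * (1 - p) ^ (U - r))
    (z := fun r => ((N : ℝ) * r / U,
      ((U.choose (r + 1) : ℝ) - ((U - N).choose (r + 1) : ℝ)) / (U.choose r : ℝ)))
    (fun r _ => by positivity) (sum_binomial_weights U p)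
    (fun r hr => subset_convexHull ℝ _ ⟨U, hU, r, by have := Finset.mem_range.1 hr; omega, rfl⟩)
  have hx : (∑ r ∈ Finset.range (U + 1), ((U.choose r : ℝ) * p ^ r * (1 - p) ^ (U - r)) •
      (((N : ℝ) * r / U, ((U.choose (r + 1) : ℝ) - ((U - N).choose (r + 1) : ℝ)) /
        (U.choose r : ℝ)) : ℝ × ℝ)) = (M, ∑ r ∈ Finset.range (U + 1),
        p ^ r * (1 - p) ^ (U - r) * ((U.choose (r + 1) : ℝ) - (U - N).choose (r + 1))) := by
    refine Prod.ext ?_ ?_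
    · simp only [Prod.fst_sum, Prod.smul_fst, smul_eq_mul]
      calc _ = N / U * ∑ r ∈ Finset.range (U + 1),
            (U.choose r : ℝ) * p ^ r * (1 - p) ^ (U - r) * r := by
            rw [Finset.mul_sum]
            exact Finset.sum_congr rfl fun r _ => by ring
        _ = M := by
            rw [sum_binomial_mean, hp]
            field_simp
    · simp only [Prod.snd_sum, Prod.smul_snd, smul_eq_mul]
      refine Finset.sum_congr rfl fun r hr => ?_
      have := hch r hr
      field_simp
  rw [hx] at h
  rw [rateA, min_eq_left hMN]
  refine (envelope_le pointsA_nonneg h).trans ?_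
  have hR : (N - M) / M = (1 - p) / p := by rw [hp]; field_simp
  rw [hR, le_div_iff₀ hp0, Finset.sum_mul]
  calc _ ≤ ∑ r ∈ Finset.range (U + 1), p ^ (r + 1) * (1 - p) ^ (U - r) * U.choose (r + 1) := by
        refine Finset.sum_le_sum fun r _ => ?_
        have h1 : (0 : ℝ) ≤ (U - N).choose (r + 1) := by positivity
        have h2 : 0 ≤ p ^ (r + 1) * (1 - p) ^ (U - r) := by positivity
        have h3 := mul_nonneg h2 h1
        have e : p ^ r * (1 - p) ^ (U - r) * ((U.choose (r + 1) : ℝ) - (U - N).choose (r + 1)) * p =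
          p ^ (r + 1) * (1 - p) ^ (U - r) * U.choose (r + 1) -
          p ^ (r + 1) * (1 - p) ^ (U - r) * (U - N).choose (r + 1) := by ring
        rw [e]
        linarith
    _ = (1 - p) * ∑ r ∈ Finset.range U, (U.choose (r + 1) : ℝ) * p ^ (r + 1) *
        (1 - p) ^ (U - (r + 1)) := by
        rw [Finset.sum_range_succ, Nat.choose_eq_zero_of_lt (Nat.lt_succ_self U), Nat.cast_zero,
          mul_zero, add_zero, Finset.mul_sum]
        refine Finset.sum_congr rfl fun r hr => ?_
        have := Finset.mem_range.1 hr
        rw [show U - r = U - (r + 1) + 1 by omega, pow_succ (1 - p)]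
        ring
    _ ≤ (1 - p) * 1 := by
        refine mul_le_mul_of_nonneg_left ?_ hq0
        have h1 := sum_binomial_weights U p
        rw [Finset.sum_range_succ'] at h1
        have h2 : 0 ≤ (U.choose 0 : ℝ) * p ^ 0 * (1 - p) ^ (U - 0) := by positivity
        linarith
    _ = 1 - p := mul_one _

end SchemeA

/-! ### Bounds for the joint envelope of Schemes B and C -/

section SchemeBC

variable {N K : ℕ}

lemma pointsBC_nonneg : ∀ x ∈ pointsB N K ∪ pointsC N K, 0 ≤ x.2 := by
  rintro _ (⟨m, hm, hmN, rfl⟩ | ⟨t, r, -, -, hr, -, rfl⟩)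
  · refine mul_nonneg (by positivity) (sub_nonneg.2 (div_le_one_of_le₀ hmN (by positivity)))
  · have hr0 : 0 ≤ r := by linarith
    refine div_nonneg (Finset.sum_nonneg fun s _ => mul_nonneg (sub_nonneg.2 ?_) (by positivity))
      (Finset.sum_nonneg fun s _ => by positivity)
    exact_mod_cast Nat.choose_le_choose _ (Nat.sub_le _ _)

lemma pointB_mem_hull (hKN : K ≤ N) {M : ℝ} (hM : 0 ≤ M) (hMN : M ≤ N) :
    (M, K * (1 - M / N)) ∈ convexHull ℝ (pointsB N K ∪ pointsC N K) := by
  refine subset_convexHull ℝ _ (Or.inl ⟨M, hM, hMN, ?_⟩)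
  rw [min_eq_right (by exact_mod_cast hKN)]

lemma sum_choose_mul_pow {m n : ℕ} (h : m ≤ n) (r : ℝ) :
    ∑ s ∈ Finset.range (n + 1), (m.choose s : ℝ) * r ^ (n - s) = r ^ (n - m) * (1 + r) ^ m := by
  rw [add_pow, Finset.mul_sum]
  rw [← Finset.sum_subset (Finset.range_mono (by omega : m + 1 ≤ n + 1))]
  · refine Finset.sum_congr rfl fun s hs => ?_
    have := Finset.mem_range.1 hs
    rw [show n - s = n - m + (m - s) by omega, pow_add]
    ring
  · intro s _ hs
    rw [Nat.choose_eq_zero_of_lt (by simpa [Finset.mem_range] using hs)]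
    simp

lemma sum_Icc_two_choose_mul_pow {m n : ℕ} (h : m ≤ n) (hn : 1 ≤ n) (r : ℝ) :
    ∑ s ∈ Finset.Icc 2 n, (m.choose s : ℝ) * r ^ (n - s) =
      r ^ (n - m) * (1 + r) ^ m - r ^ n - m * r ^ (n - 1) := by
  have h1 := sum_choose_mul_pow h r
  have h2 : Finset.range (n + 1) = insert 0 (insert 1 (Finset.Icc 2 n)) := by
    ext x
    simp only [Finset.mem_range, Finset.mem_insert, Finset.mem_Icc]
    omega
  rw [h2, Finset.sum_insert (by simp), Finset.sum_insert (by simp)] at h1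
  simp only [Nat.choose_zero_right, Nat.cast_one, one_mul, Nat.sub_zero, Nat.choose_one_right] at h1
  linarith

/-- The point of Scheme C with t = 1 is a binomial average, with success probability 1/(1+r),
lacking the levels 0 and NK. These are the Scheme B points (0, K) and (N, 0); adding them with their
binomial weights gives a closed form. -/
lemma ratio_mem_hull (hK : 1 ≤ K) (hKN : K < N) {r : ℝ} (hr1 : 1 ≤ r) (hrN : r ≤ N - 1) :
    ((N : ℝ) / (1 + r), r * (1 - (r / (1 + r)) ^ K)) ∈
      convexHull ℝ (pointsB N K ∪ pointsC N K) := by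
  have hr0 : 0 < r := by linarith
  have hNK : 2 ≤ N * K := by nlinarith
  set n := N * K with hn
  have hKn : K ≤ n := Nat.le_mul_of_pos_left _ (by omega)
  set S₀ := ∑ s ∈ Finset.Icc 1 (n - 1), ((n - 1).choose (s - 1) : ℝ) * r ^ (n - s - 1) with hS₀
  set S₁ := ∑ s ∈ Finset.Icc 1 (n - 1), (n.choose s : ℝ) * r ^ (n - s - 1) with hS₁
  set S₂ := ∑ s ∈ Finset.Icc (1 + 1) n, ((n.choose s : ℝ) - ((n - K).choose s : ℝ)) * r ^ (n - s)
    with hS₂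
  have hC : ((N : ℝ) * S₀ / S₁, S₂ / S₁) ∈ convexHull ℝ (pointsB N K ∪ pointsC N K) :=
    subset_convexHull ℝ _ (Or.inr ⟨1, r, le_rfl, by omega, hr1, hrN, rfl⟩)
  have h0 := pointB_mem_hull (K := K) hKN.le (le_refl (0 : ℝ)) (by positivity)
  have h1 := pointB_mem_hull (K := K) hKN.le (by positivity : (0 : ℝ) ≤ N) le_rfl
  have hN0 : (N : ℝ) ≠ 0 := by exact_mod_cast (by omega : N ≠ 0)
  rw [zero_div, sub_zero, mul_one] at h0
  rw [div_self hN0, sub_self, mul_zero] at h1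
  have hB : 0 < (1 + r) ^ n := by positivity
  have e1 : r * S₁ = (1 + r) ^ n - r ^ n - 1 := by
    have h := sum_choose_mul_pow (le_refl n) r
    have h2 : Finset.range (n + 1) = insert 0 (insert n (Finset.Icc 1 (n - 1))) := by
      ext x
      simp only [Finset.mem_range, Finset.mem_insert, Finset.mem_Icc]
      omega
    rw [h2, Finset.sum_insert (by simp; omega), Finset.sum_insert (by simp; omega)] at h
    simp only [Nat.choose_zero_right, Nat.cast_one, one_mul, Nat.sub_zero, Nat.choose_self,
      Nat.sub_self, pow_zero] at h
    rw [hS₁, Finset.mul_sum]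
    have h3 : ∑ s ∈ Finset.Icc 1 (n - 1), r * ((n.choose s : ℝ) * r ^ (n - s - 1)) =
        ∑ s ∈ Finset.Icc 1 (n - 1), (n.choose s : ℝ) * r ^ (n - s) := by
      refine Finset.sum_congr rfl fun s hs => ?_
      have := Finset.mem_Icc.1 hs
      rw [show n - s = n - s - 1 + 1 by omega, pow_succ, Nat.add_sub_cancel]
      ring
    rw [h3]
    linarith
  have e0 : r * S₀ = (1 + r) ^ (n - 1) - 1 := by
    have h := sum_choose_mul_pow (le_refl (n - 1)) r
    rw [Nat.sub_add_cancel (by omega : 1 ≤ n), Nat.sub_self, pow_zero, one_mul] at h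
    have h2 : Finset.range n = insert (n - 1) (Finset.range (n - 1)) := by
      ext x
      simp only [Finset.mem_range, Finset.mem_insert]
      omega
    rw [h2, Finset.sum_insert (by simp)] at h
    simp only [Nat.cast_one, one_mul, Nat.choose_self, Nat.sub_self, pow_zero] at h
    have h4 : Finset.Icc 1 (n - 1) = (Finset.range (n - 1)).image (· + 1) := by
      ext x
      simp only [Finset.mem_Icc, Finset.mem_image, Finset.mem_range]
      exact ⟨fun hx => ⟨x - 1, by omega, by omega⟩, by rintro ⟨y, hy, rfl⟩; omega⟩
    rw [hS₀, h4, Finset.sum_image (fun _ _ _ _ h => Nat.succ_injective h), Finset.mul_sum]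
    have h3 : ∑ s ∈ Finset.range (n - 1),
        r * (((n - 1).choose (s + 1 - 1) : ℝ) * r ^ (n - (s + 1) - 1)) =
        ∑ s ∈ Finset.range (n - 1), ((n - 1).choose s : ℝ) * r ^ (n - 1 - s) := by
      refine Finset.sum_congr rfl fun s hs => ?_
      have := Finset.mem_range.1 hs
      rw [show n - 1 - s = n - (s + 1) - 1 + 1 by omega, pow_succ, Nat.add_sub_cancel]
      ring
    rw [h3]
    linarith
  have e2 : S₂ = (1 + r) ^ n - r ^ K * (1 + r) ^ (n - K) - K * r ^ (n - 1) := by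
    have h := sum_Icc_two_choose_mul_pow (le_refl n) (by omega) r
    have h' := sum_Icc_two_choose_mul_pow (Nat.sub_le n K) (by omega) r
    rw [Nat.sub_sub_self hKn, Nat.cast_sub hKn] at h'
    rw [Nat.sub_self, pow_zero, one_mul] at h
    rw [hS₂]
    simp only [sub_mul, Finset.sum_sub_distrib]
    rw [h, h']
    ring
  have hS₁pos : 0 < S₁ := by
    refine Finset.sum_pos (fun s hs => ?_) ⟨1, Finset.mem_Icc.2 ⟨le_rfl, by omega⟩⟩
    have := Finset.mem_Icc.1 hs
    have : 0 < n.choose s := Nat.choose_pos (by omega)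
    positivity
  have hmix := (convex_convexHull ℝ (pointsB N K ∪ pointsC N K)).sum_mem
    (t := (Finset.univ : Finset (Fin 3)))
    (w := ![r * S₁ / (1 + r) ^ n, r ^ n / (1 + r) ^ n, 1 / (1 + r) ^ n])
    (z := ![((N : ℝ) * S₀ / S₁, S₂ / S₁), (0, (K : ℝ)), ((N : ℝ), 0)])
    (by intro i _; fin_cases i <;> simp <;> positivity)
    (by
      rw [Fin.sum_univ_three]
      simp only [Matrix.cons_val]
      rw [e1]
      field_simp
      ring)
    (by intro i _; fin_cases i <;> simpa)
  have hpn : (1 + r) ^ n = (1 + r) ^ (n - 1) * (1 + r) := by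
    rw [← pow_succ, Nat.sub_add_cancel (by omega)]
  have hpK : (1 + r) ^ n = (1 + r) ^ (n - K) * (1 + r) ^ K := by
    rw [← pow_add, Nat.sub_add_cancel hKn]
  have hrn : r ^ n = r ^ (n - 1) * r := by rw [← pow_succ, Nat.sub_add_cancel (by omega)]
  convert hmix using 1
  rw [Fin.sum_univ_three]
  simp only [Matrix.cons_val]
  refine Prod.ext ?_ ?_
  · simp only [Prod.fst_add, Prod.smul_fst, smul_eq_mul, mul_zero, add_zero]
    have h3 : r * S₁ / (1 + r) ^ n * (N * S₀ / S₁) = N * (r * S₀) / (1 + r) ^ n := by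
      field_simp
    rw [h3, e0, hpn]
    have : 0 < (1 + r) ^ (n - 1) := by positivity
    field_simp
    ring
  · simp only [Prod.snd_add, Prod.smul_snd, smul_eq_mul, mul_zero, add_zero]
    have h3 : r * S₁ / (1 + r) ^ n * (S₂ / S₁) = r * S₂ / (1 + r) ^ n := by
      field_simp
    rw [h3, e2, div_pow, hrn, hpK]
    have : 0 < (1 + r) ^ (n - K) := by positivity
    have : 0 < (1 + r) ^ K := by positivity
    field_simp
    ring

/-- Mixing the point of Scheme C for `t = 1` and `r = N / M - 1` with uncached transmission and full
caching. -/
lemma ratio_mem_hull' (hK : 1 ≤ K) (hKN : K < N) {M : ℝ} (hM1 : 1 ≤ M) (hM2 : M ≤ N / 2) :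
    (M, (N - M) / M * (1 - (1 - M / N) ^ K)) ∈ convexHull ℝ (pointsB N K ∪ pointsC N K) := by
  have hN : (0 : ℝ) < N := by exact_mod_cast (by omega : 0 < N)
  have hM0 : 0 < M := by linarith
  have h := ratio_mem_hull hK hKN (r := N / M - 1)
    (by rw [le_sub_iff_add_le, le_div_iff₀ hM0]; linarith)
    (by
      have : (N : ℝ) / M ≤ N := div_le_self hN.le hM1
      linarith)
  have e1 : 1 + ((N : ℝ) / M - 1) = N / M := by ring
  have e2 : (N : ℝ) / (N / M) = M := div_div_cancel₀ hN.ne'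
  have e3 : ((N : ℝ) / M - 1) / (N / M) = 1 - M / N := by
    rw [sub_div, div_self (by positivity), one_div_div]
  have e4 : (N : ℝ) / M - 1 = (N - M) / M := by rw [sub_div, div_self hM0.ne']
  rwa [e1, e2, e3, e4] at h

lemma rateBC_le_linear (hKN : K ≤ N) {M : ℝ} (hM : 0 ≤ M) (hMN : M ≤ N) :
    rateBC N K M ≤ K * (1 - M / N) := by
  rw [rateBC, min_eq_left hMN]
  exact envelope_le pointsBC_nonneg (pointB_mem_hull hKN hM hMN)

lemma rateBC_le_zero (hKN : K < N) {M : ℝ} (hMN : (N : ℝ) ≤ M) : rateBC N K M ≤ 0 := by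
  rw [rateBC, min_eq_right hMN]
  have h := pointB_mem_hull hKN.le (by positivity : (0 : ℝ) ≤ N) le_rfl
  have hN0 : (N : ℝ) ≠ 0 := by exact_mod_cast (by omega : N ≠ 0)
  rw [div_self hN0, sub_self, mul_zero] at h
  exact envelope_le pointsBC_nonneg h

lemma rateBC_le_ratio (hK : 1 ≤ K) (hKN : K < N) {M : ℝ} (hM1 : 1 ≤ M) (hM2 : M ≤ N / 2) :
    rateBC N K M ≤ (N - M) / M * (1 - (1 - M / N) ^ K) := by
  have hN : (0 : ℝ) < N := by exact_mod_cast (by omega : 0 < N)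
  rw [rateBC, min_eq_left (by linarith)]
  exact envelope_le pointsBC_nonneg (ratio_mem_hull' hK hKN hM1 hM2)

lemma rateBC_le_small (hK : 1 ≤ K) (hKN : K < N) {M : ℝ} (hM0 : 0 ≤ M) (hM1 : M ≤ 1) :
    rateBC N K M ≤ (1 - M) * K + M * ((N - 1) * (1 - (1 - 1 / N) ^ K)) := by
  have hN : (2 : ℝ) ≤ N := by exact_mod_cast (by omega : 2 ≤ N)
  rw [rateBC, min_eq_left (by linarith)]
  have h0 := pointB_mem_hull (K := K) hKN.le (le_refl (0 : ℝ)) (by linarith)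
  have h1 := ratio_mem_hull' hK hKN (le_refl (1 : ℝ)) (by linarith)
  refine envelope_le pointsBC_nonneg (chord_mem h0 h1 hM0 hM1 (by ring) ?_)
  simp

/-- Chord from the mixed point at N/2, whose rate 1 - 2^(-K) is at most 1, to (N, 0). -/
lemma rateBC_le_large (hK : 1 ≤ K) (hKN : K < N) {M : ℝ} (hM : N / 2 ≤ M) (hMN : M ≤ N) :
    rateBC N K M ≤ 2 * (1 - M / N) := by
  have hN : (2 : ℝ) ≤ N := by exact_mod_cast (by omega : 2 ≤ N)
  have hN0 : (0 : ℝ) < N := by linarith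
  rw [rateBC, min_eq_left hMN]
  have h0 := pointB_mem_hull (K := K) hKN.le hN0.le le_rfl
  rw [div_self hN0.ne', sub_self, mul_zero] at h0
  have h1 := ratio_mem_hull' hK hKN (M := N / 2) (by linarith) le_rfl
  have hb : M / N ≤ 1 := (div_le_one hN0).2 hMN
  have hb' : 1 / 2 ≤ M / N := by rw [le_div_iff₀ hN0]; linarith
  refine (envelope_le pointsBC_nonneg (chord_mem h0 h1 (b := 2 * (1 - M / N)) (by linarith)
    (by linarith) (by field_simp; ring) rfl)).trans ?_
  have h2 : ((N : ℝ) - N / 2) / (N / 2) = 1 := by field_simp; ring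
  have h3 : 1 - (N : ℝ) / 2 / N = 1 / 2 := by field_simp; ring
  rw [h2, h3, mul_zero, zero_add, one_mul]
  have h4 : (0 : ℝ) ≤ (1 / 2) ^ K := by positivity
  nlinarith

end SchemeBC

variable {N K : ℕ} {M : ℝ}

/-! ### Comparison of the optimal rates with the envelopes -/

lemma optRate_le_optPrivateRate' (hN : 1 ≤ N) (hK : 1 ≤ K) (hM : 0 ≤ M) :
    optRate N K M ≤ optPrivateRate N K M :=
  optRate_le_optPrivateRate hN
    ⟨N, uniformRegion_mono (pointsA_subset_uniformRegion hN hK (zero_mem_pointsA hN hK)) hM⟩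

lemma optPrivateRate_le_rateA (hN : 1 ≤ N) (hK : 1 ≤ K) (hM : 0 ≤ M) :
    optPrivateRate N K M ≤ rateA N K M := by
  have hN' : (0 : ℝ) < N := by exact_mod_cast hN
  refine optPrivateRate_le_envelope hN (pointsA_subset_uniformRegion hN hK) (min_le_left M N)
    ⟨_, chord_mem (subset_convexHull ℝ _ (zero_mem_pointsA hN hK))
      (subset_convexHull ℝ _ full_mem_pointsA) (b := min M N / N) (by positivity)
      ((div_le_one hN').2 (min_le_right _ _)) ?_ rfl⟩
  field_simp
  ring

lemma optPrivateRate_le_rateBC (hK : 1 ≤ K) (hKN : K < N) (hM : 0 ≤ M) :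
    optPrivateRate N K M ≤ rateBC N K M :=
  optPrivateRate_le_envelope (by omega)
    (Set.union_subset (pointsB_subset_uniformRegion hK hKN.le)
      (pointsC_subset_uniformRegion hK hKN.le)) (min_le_left M N)
    ⟨_, pointB_mem_hull hKN.le (by positivity) (min_le_right _ _)⟩

lemma rateA_le_two_mul_optRate (hN : 1 ≤ N) (hK : 1 ≤ K) (hM : 0 ≤ M) (h : (N : ℝ) / 2 ≤ M) :
    rateA N K M ≤ 2 * optRate N K M := by
  have hN' : (0 : ℝ) < N := by exact_mod_cast hN
  rcases le_total (N : ℝ) M with hMN | hMN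
  · linarith [rateA_le_zero (K := K) hMN, optRate_nonneg (K := K) hN hM]
  have hM0 : 0 < M := by linarith
  have h1 := rateA_le_ratio (K := K) hN hM0 hMN
  have h2 := one_sub_le_optRate hN hK hM
  have h3 : (N - M) / M ≤ 2 * (1 - M / N) := by
    have e : 2 * (1 - M / N) = (N - M) * 2 / N := by field_simp
    rw [e, div_le_div_iff₀ hM0 hN']
    nlinarith
  linarith

/-- The envelope is at most (N-M) min(1, 1/M), the optimum at least (N-M)/(2(M+1)); the quotient
2(M+1) min(1, 1/M) peaks at M = 1 with value 4. -/
lemma rateA_le_four_mul_optRate (hN : 1 ≤ N) (hK : 1 ≤ K) (hNK : N ≤ K) (hM : 0 ≤ M) :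
    rateA N K M ≤ 4 * optRate N K M := by
  rcases le_total (N : ℝ) M with hMN | hMN
  · linarith [rateA_le_zero (K := K) hMN, optRate_nonneg (K := K) hN hM]
  have hL := ratio_le_optRate (K := K) hN hM (Or.inl hNK)
  rcases le_total M 1 with hM1 | hM1
  · have h1 := rateA_le_linear hN hK hM hMN
    have h2 : (N - M : ℝ) ≤ 4 * ((N - M) / (2 * (M + 1))) := by
      rw [← mul_div_assoc, le_div_iff₀ (by linarith)]
      nlinarith
    linarith
  · have h1 := rateA_le_ratio (K := K) hN (by linarith) hMN
    have h2 : (N - M : ℝ) / M ≤ 4 * ((N - M) / (2 * (M + 1))) := by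
      rw [← mul_div_assoc, div_le_div_iff₀ (by linarith) (by linarith)]
      nlinarith
    linarith

lemma rateBC_le_two_mul_optRate (hK : 1 ≤ K) (hKN : K < N) (hM : 0 ≤ M) (h : (N : ℝ) / 2 ≤ M) :
    rateBC N K M ≤ 2 * optRate N K M := by
  have hN : 1 ≤ N := by omega
  rcases le_total (N : ℝ) M with hMN | hMN
  · linarith [rateBC_le_zero hKN hMN, optRate_nonneg (K := K) hN hM]
  · linarith [rateBC_le_large hK hKN h hMN, one_sub_le_optRate hN hK hM]

lemma quarter_le_one_sub_inv_pow {n : ℕ} (hn : 1 ≤ n) :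
    (1 / 4 : ℝ) ≤ (1 - 1 / ((n : ℝ) + 1)) ^ n := by
  have hn0 : (0 : ℝ) < n := by exact_mod_cast hn
  have h1 : (1 + 1 / (n : ℝ)) ^ n ≤ 4 := by
    calc (1 + 1 / (n : ℝ)) ^ n ≤ Real.exp (1 / n) ^ n := by
          gcongr
          rw [add_comm]
          exact Real.add_one_le_exp _
      _ = Real.exp 1 := by
          rw [← Real.exp_nat_mul, mul_one_div_cancel hn0.ne']
      _ ≤ 4 := by linarith [Real.exp_one_lt_d9]
  have h2 : (1 - 1 / ((n : ℝ) + 1)) ^ n * (1 + 1 / (n : ℝ)) ^ n = 1 := by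
    rw [← mul_pow]
    have : (1 - 1 / ((n : ℝ) + 1)) * (1 + 1 / (n : ℝ)) = 1 := by
      field_simp
      ring
    rw [this, one_pow]
  have h3 : 0 ≤ (1 - 1 / ((n : ℝ) + 1)) ^ n := by
    have : 1 / ((n : ℝ) + 1) ≤ 1 := by rw [div_le_one (by positivity)]; linarith
    exact pow_nonneg (sub_nonneg.2 this) _
  nlinarith

/-- The left side increases with K, so K = N - 1 is the worst case, where (1 - 1/N)^(N-1) ≥ 1/4. -/
lemma small_memory_bound (hKN : K < N) (hK : 1 ≤ K) (hM0 : 0 ≤ M) (hM1 : M ≤ 1) :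
    (1 - M) * K + M * ((N - 1) * (1 - (1 - 1 / N) ^ K)) ≤ (N - 1) * (1 - M / 4) := by
  obtain ⟨n, rfl⟩ : ∃ n, N = n + 1 := ⟨N - 1, by omega⟩
  have hq : (0 : ℝ) ≤ 1 - 1 / ((n : ℝ) + 1) := by
    rw [sub_nonneg, div_le_one (by positivity)]
    linarith [(Nat.cast_nonneg n : (0 : ℝ) ≤ n)]
  have hmono : Monotone fun k : ℕ =>
      (1 - M) * (k : ℝ) + M * (n * (1 - (1 - 1 / ((n : ℝ) + 1)) ^ k)) := by
    refine monotone_nat_of_le_succ fun k => ?_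
    have h1 : 0 ≤ M * n * (1 - 1 / ((n : ℝ) + 1)) ^ k * (1 / ((n : ℝ) + 1)) := by positivity
    rw [pow_succ]
    push_cast
    linarith
  have h := hmono (by omega : K ≤ n)
  have h4 := quarter_le_one_sub_inv_pow (n := n) (by omega)
  have h5 := mul_le_mul_of_nonneg_left h4 (by positivity : 0 ≤ M * n)
  push_cast
  rw [add_sub_cancel_right]
  simp only at h
  linarith

/-- Bernoulli's inequality with the real exponent N/3 ≥ 1, then cubing. -/
lemma one_sub_div_pow_ge (hKN : K ≤ N) (hN : 3 ≤ N) (hM0 : 0 ≤ M) (hM3 : M ≤ 3) :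
    (1 - M / 3) ^ 3 ≤ (1 - M / N) ^ K := by
  have hN3 : (3 : ℝ) ≤ N := by exact_mod_cast hN
  have hN0 : (0 : ℝ) < N := by linarith
  have hx1 : M / N ≤ 1 := by rw [div_le_one hN0]; linarith
  have hx0 : 0 ≤ M / N := by positivity
  have hb := one_add_mul_self_le_rpow_one_add (s := -(M / N)) (by linarith) (p := N / 3)
    (by linarith)
  have e : 1 + (N : ℝ) / 3 * -(M / N) = 1 - M / 3 := by field_simp; ring
  rw [e, ← sub_eq_add_neg] at hb
  calc (1 - M / 3) ^ 3 ≤ ((1 - M / N) ^ ((N : ℝ) / 3)) ^ 3 := by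
        gcongr
        linarith
    _ = (1 - M / N) ^ N := by
        rw [← Real.rpow_natCast, ← Real.rpow_mul (by linarith), ← Real.rpow_natCast]
        congr 1
        push_cast
        ring
    _ ≤ (1 - M / N) ^ K := pow_le_pow_of_le_one (by linarith) (by linarith) hKN

lemma rateBC_le_three_mul_optRate (hK : 1 ≤ K) (hKN : K < N) (hM : 0 ≤ M) (h : M < (N : ℝ) / 2) :
    rateBC N K M ≤ 3 * optRate N K M := by
  have hN : 1 ≤ N := by omega
  have hN2 : (2 : ℝ) ≤ N := by exact_mod_cast (by omega : 2 ≤ N)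
  have hK1 : (1 : ℝ) ≤ K := by exact_mod_cast hK
  -- In the first case all K users fit into the converse, which gives K/2 against the rate K of
  -- uncached transmission. Otherwise the optimal s is at most K.
  rcases le_or_gt (((K : ℝ) + 1) * (M + 1)) (N + 1) with hc | hc
  · have h1 := rateBC_le_linear hKN.le hM (by linarith)
    have h2 := half_le_optRate hN hKN.le hM hc
    have h3 : 0 ≤ M / N := by positivity
    nlinarith
  have hL := ratio_le_optRate hN hM (Or.inr hc)
  suffices hs : rateBC N K M ≤ 3 * ((N - M) / (2 * (M + 1))) by linarith
  rw [← mul_div_assoc, le_div_iff₀ (by linarith)]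
  rcases le_total M 1 with hM1 | hM1
  · have h1 := (rateBC_le_small hK hKN hM hM1).trans (small_memory_bound hKN hK hM hM1)
    have h2 : (1 - M / 4) * (2 * (M + 1)) ≤ 3 := by nlinarith
    have h3 := mul_le_mul_of_nonneg_left h2 (by linarith : (0 : ℝ) ≤ N - 1)
    have h4 := mul_le_mul_of_nonneg_right h1 (by linarith : 0 ≤ 2 * (M + 1))
    linarith
  have h1 := rateBC_le_ratio hK hKN hM1 h.le
  have hM0 : 0 < M := by linarith
  have hr : 0 ≤ (N - M) / M := div_nonneg (by linarith) hM0.le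
  have hrM : (N - M) / M * M = N - M := div_mul_cancel₀ _ hM0.ne'
  refine (mul_le_mul_of_nonneg_right h1 (by linarith)).trans ?_
  have e : 3 * (N - M) = (N - M) / M * (3 * M) := by linear_combination -3 * hrM
  rw [e, mul_assoc]
  refine mul_le_mul_of_nonneg_left ?_ hr
  -- What remains is (1 - (1-M/N)^K) · 2(M+1) ≤ 3M. From M = 2 on the power may be dropped. Below, M
  -- < N/2 forces N ≥ 3, and the cubic lower bound on the power suffices.
  rcases le_total M 2 with hM2 | hM2
  · have hN3 : 3 ≤ N := by
      have : (2 : ℝ) < N := by linarith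
      exact_mod_cast this
    have h2 := one_sub_div_pow_ge hKN.le hN3 hM (by linarith)
    have h3 := mul_le_mul_of_nonneg_right h2 (by linarith : 0 ≤ 2 * (M + 1))
    have h4 : 2 - M ≤ (1 - M / 3) ^ 3 * (2 * (M + 1)) := by
      obtain ⟨y, rfl⟩ : ∃ y, M = y + 1 := ⟨M - 1, by ring⟩
      have hy0 : 0 ≤ y := by linarith
      have hy1 : y ≤ 1 := by linarith
      nlinarith [mul_nonneg hy0 (sub_nonneg.2 hy1), sq_nonneg (y * (1 - y)), sq_nonneg (2 * y - 1),
        mul_nonneg (mul_nonneg hy0 hy0) (sub_nonneg.2 hy1), sq_nonneg (y ^ 2 - y / 2)]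
    linarith
  · have h2 : 0 ≤ (1 - M / N) ^ K := by
      refine pow_nonneg (sub_nonneg.2 ?_) _
      rw [div_le_one (by linarith)]
      linarith
    nlinarith

lemma bounds_of_le_mul {a p r c : ℝ} (hap : a ≤ p) (hpr : p ≤ r) (hc : 0 ≤ c) (h : r ≤ c * a) :
    r ≤ c * a ∧ r ≤ c * p ∧ p ≤ c * a :=
  ⟨h, h.trans (mul_le_mul_of_nonneg_left hap hc), hpr.trans h⟩

lemma optPrivateRate_eq_optRate (hN : 1 ≤ N) (hK : 1 ≤ K) (hM : 0 ≤ M)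
    (h : (N : ℝ) * (N * K - K) / (N * K - K + 1) ≤ M) :
    optPrivateRate N K M = optRate N K M := by
  refine le_antisymm ((optPrivateRate_le_rateA hN hK hM).trans ?_)
    (optRate_le_optPrivateRate' hN hK hM)
  rcases le_total (N : ℝ) M with hMN | hMN
  · exact (rateA_le_zero hMN).trans (optRate_nonneg hN hM)
  · exact (rateA_le_one_sub hN hMN h).trans (one_sub_le_optRate hN hK hM)

end CodedCaching

end

open CodedCaching in
theorem theorem5 (N K : ℕ) (hN : 1 ≤ N) (hK : 1 ≤ K) (M : ℝ) (hM : 0 ≤ M) :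
    (optRate N K M ≤ optPrivateRate N K M ∧ optPrivateRate N K M ≤ rateA N K M) ∧
    (N ≤ K →
      (M ≤ 1 - (N : ℝ) / K →
        rateA N K M ≤ 4 * optRate N K M ∧
        rateA N K M ≤ 4 * optPrivateRate N K M ∧
        optPrivateRate N K M ≤ 4 * optRate N K M) ∧
      (1 - (N : ℝ) / K ≤ M → M ≤ (N : ℝ) / 2 →
        rateA N K M ≤ 8 * optRate N K M ∧
        rateA N K M ≤ 8 * optPrivateRate N K M ∧
        optPrivateRate N K M ≤ 8 * optRate N K M) ∧
      ((N : ℝ) / 2 ≤ M →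
        rateA N K M ≤ 2 * optRate N K M ∧
        rateA N K M ≤ 2 * optPrivateRate N K M ∧
        optPrivateRate N K M ≤ 2 * optRate N K M)) ∧
    (K < N →
      optPrivateRate N K M ≤ rateBC N K M ∧
      (M < (N : ℝ) / 2 →
        rateBC N K M ≤ 3 * optRate N K M ∧
        rateBC N K M ≤ 3 * optPrivateRate N K M ∧
        optPrivateRate N K M ≤ 3 * optRate N K M) ∧
      ((N : ℝ) / 2 ≤ M →
        rateBC N K M ≤ 2 * optRate N K M ∧
        rateBC N K M ≤ 2 * optPrivateRate N K M ∧
        optPrivateRate N K M ≤ 2 * optRate N K M)) ∧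
    ((N : ℝ) * ((N : ℝ) * K - K) / ((N : ℝ) * K - K + 1) ≤ M →
      optPrivateRate N K M = optRate N K M) := by
  have hle := optRate_le_optPrivateRate' hN hK hM
  have hA := optPrivateRate_le_rateA hN hK hM
  have hnn := optRate_nonneg (K := K) hN hM
  refine ⟨⟨hle, hA⟩, fun hNK => ?_, fun hKN => ?_, optPrivateRate_eq_optRate hN hK hM⟩
  · have h4 := rateA_le_four_mul_optRate hN hK hNK hM
    exact ⟨fun _ => bounds_of_le_mul hle hA (by norm_num) h4,
      fun _ _ => bounds_of_le_mul hle hA (by norm_num) (by linarith),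
      fun h => bounds_of_le_mul hle hA (by norm_num) (rateA_le_two_mul_optRate hN hK hM h)⟩
  · have hBC := optPrivateRate_le_rateBC hK hKN hM
    exact ⟨hBC,
      fun h => bounds_of_le_mul hle hBC (by norm_num) (rateBC_le_three_mul_optRate hK hKN hM h),
      fun h => bounds_of_le_mul hle hBC (by norm_num) (rateBC_le_two_mul_optRate hK hKN hM h)⟩
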